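/- Let $r>0$, $K>0$, $n\ge 1$ an integer and $f(x)=(K-e^x)^+$. Let $X$ be a real-valued Lévy process with $X_0=0$ that is not compound Poisson, and $N$ a Poisson process of intensity $n$ independent of $X$, with jump times $T_k=\inf\{t\ge0: N_t\ge k\}$ ($T_0=0$). For $k\ge 0$ let $$V_k(x)=\sup_{\tau}\mathbb E\big[D(\tau\wedge T_k)\,f(x+X_{\tau\wedge T_k})\big],\qquad D(t)=\sum_{i\ge0}\mathbf 1_{\{t=T_i\}}e^{-ri/n},$$ the supremum running over all stopping times $\tau$ of the naturally enlarged filtration of $(X,N)$ with values in $\{T_0,T_1,\dots\}$. Let $\xi$ be exponentially distributed with mean $1/n$ and independent of $X$, and suppose that $$\mathbb P(X_\xi\in dx)=\Big(\mathbf 1_{\{x<0\}}\sum_{j=0}^{N_+}c_+(j)e^{\zeta_+(j)x}+\mathbf 1_{\{x>0\}}\sum_{j=0}^{N_-}c_-(j)e^{\zeta_-(j)x}\Big)dx ,$$ where $N_\pm\in\mathbb N\cup\{\infty\}$, $c_\pm(j)>0$, $\zeta_-(j)<0<\zeta_+(j)$, the numbers $\zeta_+(j)$ (resp. $\zeta_-(j)$)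 are distinct and tend to $+\infty$ (resp. $-\infty$) if $N_+=\infty$ (resp. $N_-=\infty$), and $\sum_j c_+(j)/\zeta_+(j)-\sum_j c_-(j)/\zeta_-(j)=1$. Suppose also that $\zeta_-(j)\neq-1$ for all $j$ and that $$\sup_j\sum_{q\ne j}\frac{c_\pm(q)}{|\zeta_\pm(q)-\zeta_\pm(j)|}<\infty\quad\text{for both signs}$$ (which is automatic for a sign with $N_\pm<\infty$). Then there are points $\log K=\bar x_0>\bar x_1>\bar x_2>\cdots$ and real numbers $A_\pm(i,j,m,k)$, $B(m,k)$, $C(m,k)$ such that for all $k\ge0$ and $x\in\mathbb R$ $$\begin{aligned}V_k(x)={}&\mathbf 1_{\{x\ge\bar x_0\}}\sum_{j=0}^{N_+}e^{-\zeta_+(j)x}\sum_{i=0}^{k-1}A_+(i,j,0,k)x^i\\&+\sum_{m=1}^k\mathbf 1_{\{x\in[\bar x_m,\bar x_{m-1})\}}\Big(\sum_{j=0}^{N_-}e^{-\zeta_-(j)x}\sum_{i=0}^{k-m}A_-(i,j,m,k)x^i+\sum_{j=0}^{N_+}e^{-\zeta_+(j)x}\sum_{i=0}^{k-m}A_+(i,j,m,k)x^i-B(m,k)e^x+C(m,k)\Big)\\&+\mathbf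 1_{\{x<\bar x_k\}}(K-e^x).\end{aligned}$$ For $k\ge1$, $\bar x_k$ is the unique solution $z\in(-\infty,\bar x_{k-1})$ of $e^{-r/n}\mathbb E[V_{k-1}(z+X_\xi)]-f(z)=0$, and the coefficients satisfy the following recursion, in which (as in the formula above) all series converge absolutely. *Notation.* Put $d=e^{-r/n}$, $$\Upsilon_0=\sum_{q}\frac{c_+(q)}{\zeta_+(q)+1}-\sum_q\frac{c_-(q)}{\zeta_-(q)+1},$$ $$\Upsilon_1(h,j)=(-1)^h\Big(\sum_{q\ne j}\frac{c_+(q)}{(\zeta_+(q)-\zeta_+(j))^{h+1}}-\sum_q\frac{c_-(q)}{(\zeta_-(q)-\zeta_+(j))^{h+1}}\Big),$$ $$\Upsilon_2(h,j)=(-1)^h\Big(\sum_{q}\frac{c_+(q)}{(\zeta_+(q)-\zeta_-(j))^{h+1}}-\sum_{q\ne j}\frac{c_-(q)}{(\zeta_-(q)-\zeta_-(j))^{h+1}}\Big).$$ Let $E_{b,i}$ be the antiderivative of $x^ie^{bx}$ without additive constant: $E_{0,i}(x)=\frac{x^{i+1}}{i+1}$, and for $b\ne0$, $E_{b,0}(x)=e^{bx}/b$,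 $E_{b,i}(x)=x^ie^{bx}/b-\frac ib E_{b,i-1}(x)$. For $k\ge1$ and $\zeta\in\mathbb R$ put $$F_\zeta(x;0,k)=\sum_q\sum_{i=0}^{k-2}A_+(i,q,0,k-1)E_{\zeta-\zeta_+(q),i}(x),\qquad F_\zeta(x;k,k)=K E_{\zeta,0}(x)-E_{\zeta+1,0}(x),$$ and for $1\le l\le k-1$ $$F_\zeta(x;l,k)=\sum_{\pm}\sum_q\sum_{i=0}^{k-1-l}A_\pm(i,q,l,k-1)E_{\zeta-\zeta_\pm(q),i}(x)-B(l,k-1)E_{\zeta+1,0}(x)+C(l,k-1)E_{\zeta,0}(x);$$ these are the antiderivatives of $V_{k-1}(x)e^{\zeta x}$ on $[\bar x_0,\infty)$, $(-\infty,\bar x_{k-1})$ and $[\bar x_l,\bar x_{l-1})$ obtained term by term. Write $F_\pm(x;l,j,k)=F_{\zeta_\pm(j)}(x;l,k)$ and $S_\pm(j;s,t)=\sum_{l=s}^{t}\big(F_\pm(\bar x_{l-1};l,j,k)-F_\pm(\bar x_l;l,j,k)\big)$; empty sums are zero. *Recursion for $k\ge1$.* (i) $A_+(0,j,k,k)=0$,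 $B(k,k)=d\,\Upsilon_0$, $C(k,k)=dK$, $A_-(0,j,k,k)=d\,c_-(j)\big(F_-(\bar x_{k-1};k,j,k)-F_-(\bar x_0;0,j,k)+S_-(j;1,k-1)\big)$, and $\bar x_k$ is the unique solution $z\in(-\infty,\bar x_{k-1})$ of $\sum_{q}e^{-\zeta_-(q)z}A_-(0,q,k,k)-B(k,k)e^z+C(k,k)=K-e^z$. (ii) For $1\le m\le k-1$ and $1\le i\le k-m$: $$A_+(0,j,m,k)=d\,c_+(j)\big(F_+(\bar x_{k-1};k,j,k)-F_+(\bar x_m;m,j,k)+S_+(j;m+1,k-1)\big)+d\sum_{h=0}^{k-m-1}A_+(h,j,m,k-1)\Upsilon_1(h,j)h!,$$ $$A_+(i,j,m,k)=d\sum_{h=1}^{k-m-i}A_+(i+h-1,j,m,k-1)\Upsilon_1(h-1,j)\tfrac{(h+i-1)!}{i!}+d\,\tfrac{c_+(j)}{i}A_+(i-1,j,m,k-1),$$ $$A_-(0,j,m,k)=d\,c_-(j)\big(F_-(\bar x_{m-1};m,j,k)-F_-(\bar x_0;0,j,k)+S_-(j;1,m-1)\big)+d\sum_{h=0}^{k-m-1}A_-(h,j,m,k-1)\Upsilon_2(h,j)h!,$$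 $$A_-(i,j,m,k)=d\sum_{h=1}^{k-m-i}A_-(i+h-1,j,m,k-1)\Upsilon_2(h-1,j)\tfrac{(h+i-1)!}{i!}-d\,\tfrac{c_-(j)}{i}A_-(i-1,j,m,k-1),$$ $$B(m,k)=d\,\Upsilon_0\,B(m,k-1),\qquad C(m,k)=d\,C(m,k-1).$$ (iii) For $1\le i\le k-1$: $$A_+(0,j,0,k)=d\,c_+(j)\big(F_+(\bar x_{k-1};k,j,k)-F_+(\bar x_0;0,j,k)+S_+(j;1,k-1)\big)+d\sum_{h=1}^{k-1}A_+(h-1,j,0,k-1)\Upsilon_1(h-1,j)(h-1)!,$$ $$A_+(i,j,0,k)=d\sum_{h=1}^{k-1-i}A_+(i+h-1,j,0,k-1)\Upsilon_1(h-1,j)\tfrac{(h+i-1)!}{i!}+d\,\tfrac{c_+(j)}{i}A_+(i-1,j,0,k-1).$$ -/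

import Mathlib

open MeasureTheory ProbabilityTheory Filter Topology
open scoped NNReal ENNReal

/-! ### The driving process and the stochastic time grid -/

section Processes

variable {Ω : Type*} [m : MeasurableSpace Ω]

/-- `X` is a real-valued Lévy process (started at `0`) under `P`. -/
structure IsLevyProcess (X : ℝ≥0 → Ω → ℝ) (P : Measure Ω) : Prop where
  measurable : ∀ t, Measurable (X t)
  zero : ∀ᵐ ω ∂P, X 0 ω = 0
  indep : HasIndepIncrements X P
  stationary : ∀ s t, P.map (fun ω => X (s + t) ω - X s ω) = P.map (X t)
  right_cont : ∀ ω t, ContinuousWithinAt (fun s => X s ω) (Set.Ici t) t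
  left_lim : ∀ ω t, ∃ l, Tendsto (fun s => X s ω) (𝓝[<] t) (𝓝 l)

/-- `X` is (in law) a compound Poisson process: for some jump rate `rate` and some jump
distribution `ν`, the characteristic function of `X t` is `exp (t * rate * (ν̂ - 1))`. -/
def IsCompoundPoisson (X : ℝ≥0 → Ω → ℝ) (P : Measure Ω) : Prop :=
  ∃ (rate : ℝ≥0) (ν : Measure ℝ), IsProbabilityMeasure ν ∧ ∀ (t : ℝ≥0) (z : ℝ),
    charFun (P.map (X t)) z = Complex.exp (((t : ℝ) : ℂ) * ((rate : ℝ) : ℂ) * (charFun ν z - 1))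

/-- `N` is a Poisson process with intensity `rate` under `P`.  (Paths are nondecreasing, so the
increments below are true differences.) -/
structure IsPoissonProcess (rate : ℝ≥0) (N : ℝ≥0 → Ω → ℕ) (P : Measure Ω) : Prop where
  measurable : ∀ t, Measurable (N t)
  zero : ∀ᵐ ω ∂P, N 0 ω = 0
  indep : HasIndepIncrements (fun t ω => (N t ω : ℝ)) P
  law : ∀ s t, s ≤ t → P.map (fun ω => N t ω - N s ω) = poissonMeasure (rate * (t - s))
  mono : ∀ ω, Monotone fun t => N t ω
  right_cont : ∀ ω t, ContinuousWithinAt (fun s => N s ω) (Set.Ici t) t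

/-- The `k`-th jump time `T_k = inf {t ≥ 0 | N_t ≥ k}` (so `T_0 = 0`). -/
noncomputable def jumpTime (N : ℝ≥0 → Ω → ℕ) (k : ℕ) (ω : Ω) : ℝ≥0 :=
  sInf {t | k ≤ N t ω}

/-- The filtration generated by the pair `(X, N)`, augmented by the `P`-null events. -/
def augmentedFiltration (P : Measure Ω) {X : ℝ≥0 → Ω → ℝ} {N : ℝ≥0 → Ω → ℕ}
    (hX : ∀ t, Measurable (X t)) (hN : ∀ t, Measurable (N t)) : Filtration ℝ≥0 m where
  seq t := (⨆ s ≤ t, MeasurableSpace.comap (X s) inferInstance ⊔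
      MeasurableSpace.comap (N s) inferInstance) ⊔
    MeasurableSpace.generateFrom {A | MeasurableSet[m] A ∧ P A = 0}
  mono' _ _ hst := sup_le_sup (biSup_mono fun _ h => le_trans h hst) le_rfl
  le' _ := sup_le
    (iSup₂_le fun s _ => sup_le (hX s).comap_le (hN s).comap_le)
    (MeasurableSpace.generateFrom_le fun _ h => h.1)

/-- The naturally enlarged (augmented and right-continuous) filtration of `(X, N)`. -/
noncomputable def enlargedFiltration (P : Measure Ω) {X : ℝ≥0 → Ω → ℝ} {N : ℝ≥0 → Ω → ℕ}
    (hX : ∀ t, Measurable (X t)) (hN : ∀ t, Measurable (N t)) : Filtration ℝ≥0 m :=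
  (augmentedFiltration P hX hN).rightCont

/-- The stopping times of the enlarged filtration of `(X, N)` that only take values on the grid
points `T_0, T_1, …`. -/
def gridStoppingTimes (P : Measure Ω) {X : ℝ≥0 → Ω → ℝ} {N : ℝ≥0 → Ω → ℕ}
    (hX : ∀ t, Measurable (X t)) (hN : ∀ t, Measurable (N t)) : Set (Ω → ℝ≥0) :=
  {τ | IsStoppingTime (enlargedFiltration P hX hN) (fun ω => (τ ω : WithTop ℝ≥0)) ∧
    ∀ ω, ∃ i, τ ω = jumpTime N i ω}

open Classical in
/-- The discount factor `D(t) = ∑_i 1_{t = T_i} e^{-r i / n}`. -/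
noncomputable def gridDiscount (r : ℝ) (n : ℕ) (N : ℝ≥0 → Ω → ℕ) (ω : Ω) (t : ℝ≥0) : ℝ :=
  ∑' i : ℕ, if t = jumpTime N i ω then Real.exp (-r * i / n) else 0

/-- The value function
`V_k(x) = sup_τ E_x[D(τ ∧ T_k) f(X_{τ ∧ T_k})]`, the supremum running over the grid-valued stopping
times; under `P_x` the process is `x + X`. -/
noncomputable def gridValue (P : Measure Ω) (r : ℝ) (n : ℕ) (f : ℝ → ℝ)
    {X : ℝ≥0 → Ω → ℝ} {N : ℝ≥0 → Ω → ℕ}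
    (hX : ∀ t, Measurable (X t)) (hN : ∀ t, Measurable (N t)) (k : ℕ) (x : ℝ) : ℝ :=
  ⨆ τ : gridStoppingTimes P hX hN,
    ∫ ω, gridDiscount r n N ω (min (τ.1 ω) (jumpTime N k ω)) *
      f (x + X (min (τ.1 ω) (jumpTime N k ω)) ω) ∂P

/-- The law of `X` at an independent exponentially distributed time with mean `1 / q`. -/
noncomputable def lawAtExpTime (q : ℝ) (X : ℝ≥0 → Ω → ℝ) (P : Measure Ω) : Measure ℝ :=
  (P.prod (expMeasure q)).map fun p => X p.2.toNNReal p.1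

end Processes

/-- The payoff of the put option with strike `K`, in terms of the log-price. -/
noncomputable def putPayoff (K x : ℝ) : ℝ := max (K - Real.exp x) 0

/-! ### Mixtures of exponentials -/

/-- The index set `{0, …, N}`, which is all of `ℕ` if `N = ∞`. -/
abbrev UpTo (N : ℕ∞) : Type := {j : ℕ // (j : ℕ∞) ≤ N}

/-- The parameters of a two-sided (finite or infinite) mixture of exponentials: `cp, zp` are
`c_+, ζ_+` and describe the negative half-line, `cm, zm` are `c_-, ζ_-` and describe the positive
half-line.  The exponents on either side are distinct and, if there are infinitely many of
them, tend to `±∞`. -/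
structure ExpMixture where
  Np : ℕ∞
  Nm : ℕ∞
  cp : UpTo Np → ℝ
  zp : UpTo Np → ℝ
  cm : UpTo Nm → ℝ
  zm : UpTo Nm → ℝ
  cp_pos : ∀ j, 0 < cp j
  zp_pos : ∀ j, 0 < zp j
  cm_pos : ∀ j, 0 < cm j
  zm_neg : ∀ j, zm j < 0
  zp_inj : Function.Injective zp
  zm_inj : Function.Injective zm
  zp_tendsto : Tendsto zp cofinite atTop
  zm_tendsto : Tendsto zm cofinite atBot
  summable_p : Summable fun j => cp j / zp j
  summable_m : Summable fun j => cm j / zm j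
  total : ∑' j, cp j / zp j - ∑' j, cm j / zm j = 1

namespace ExpMixture

/-- The density of the mixture. -/
noncomputable def density (μ : ExpMixture) (x : ℝ) : ℝ :=
  (if x < 0 then ∑' j, μ.cp j * Real.exp (μ.zp j * x) else 0) +
    (if 0 < x then ∑' j, μ.cm j * Real.exp (μ.zm j * x) else 0)

/-- The distribution of the mixture. -/
noncomputable def law (μ : ExpMixture) : Measure ℝ :=
  volume.withDensity fun x => ENNReal.ofReal (μ.density x)

end ExpMixture

/-- Non-clustering of weighted exponents: the sums `∑_{q ≠ j} c q / |z q - z j|` are bounded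
uniformly in `j`.  This holds trivially for finitely many exponents. -/
def NonClustering {ι : Type} [DecidableEq ι] (c z : ι → ℝ) : Prop :=
  ∃ M : ℝ, ∀ (j : ι) (s : Finset ι), ∑ q ∈ s.erase j, c q / |z q - z j| ≤ M

/-! ### The coefficients -/

/-- The antiderivative of `x ↦ x ^ i * exp (b * x)` obtained by repeated partial integration,
without additive constant. -/
noncomputable def expAntideriv (b : ℝ) : ℕ → ℝ → ℝ
  | 0, x => if b = 0 then x else Real.exp (b * x) / b
  | i + 1, x =>
    if b = 0 then x ^ (i + 2) / (i + 2)
    else x ^ (i + 1) * Real.exp (b * x) / b - (i + 1) / b * expAntideriv b i x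

theorem hasDerivAt_expAntideriv (b : ℝ) (i : ℕ) (x : ℝ) :
    HasDerivAt (expAntideriv b i) (x ^ i * Real.exp (b * x)) x := by
  by_cases hb : b = 0
  · subst hb
    cases i with
    | zero =>
      have he : expAntideriv 0 0 = fun x => x := by funext y; simp [expAntideriv]
      rw [he]
      exact (hasDerivAt_id' x).congr_deriv (by simp)
    | succ i =>
      have h := (hasDerivAt_pow (i + 2) x).div_const ((i : ℝ) + 2)
      have he : expAntideriv 0 (i + 1) = fun x => x ^ (i + 2) / ((i : ℝ) + 2) := by
        funext y; simp [expAntideriv]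
      rw [he]
      refine h.congr_deriv ?_
      have h2 : (i : ℝ) + 2 ≠ 0 := by positivity
      have h3 : i + 2 - 1 = i + 1 := rfl
      rw [h3]
      push_cast
      rw [zero_mul, Real.exp_zero, mul_one, mul_div_cancel_left₀ _ h2]
  · have hexp : HasDerivAt (fun y => Real.exp (b * y)) (Real.exp (b * x) * b) x := by
      simpa using ((hasDerivAt_id x).const_mul b).exp
    induction i with
    | zero =>
      have he : expAntideriv b 0 = fun y => Real.exp (b * y) / b := by
        funext y; simp [expAntideriv, hb]
      rw [he]
      refine (hexp.div_const b).congr_deriv ?_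
      rw [mul_div_cancel_right₀ _ hb, pow_zero, one_mul]
    | succ i ih =>
      have he : expAntideriv b (i + 1) = fun y =>
          y ^ (i + 1) * Real.exp (b * y) / b - (i + 1) / b * expAntideriv b i y := by
        funext y; simp [expAntideriv, hb]
      rw [he]
      refine ((((hasDerivAt_pow (i + 1) x).mul hexp).div_const b).sub
        (ih.const_mul (((i : ℝ) + 1) / b))).congr_deriv ?_
      push_cast
      field_simp
      ring

/-- Boundary points `x̄_k` and coefficients `A_+(i,j,m,k)`, `A_-(i,j,m,k)`, `B(m,k)`, `C(m,k)`. -/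
structure PutCoeffs (μ : ExpMixture) where
  xb : ℕ → ℝ
  Ap : ℕ → UpTo μ.Np → ℕ → ℕ → ℝ
  Am : ℕ → UpTo μ.Nm → ℕ → ℕ → ℝ
  B : ℕ → ℕ → ℝ
  C : ℕ → ℕ → ℝ

namespace ExpMixture

variable (μ : ExpMixture)

/-- `Υ_0`. -/
noncomputable def upsilon0 : ℝ :=
  ∑' q, μ.cp q / (μ.zp q + 1) - ∑' q, μ.cm q / (μ.zm q + 1)

/-- The summands of the first series in `Υ_1(h,j)`. -/
noncomputable def upsilon1p (h : ℕ) (j q : UpTo μ.Np) : ℝ :=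
  if q = j then 0 else μ.cp q / (μ.zp q - μ.zp j) ^ (h + 1)

/-- The summands of the second series in `Υ_1(h,j)`. -/
noncomputable def upsilon1m (h : ℕ) (j : UpTo μ.Np) (q : UpTo μ.Nm) : ℝ :=
  μ.cm q / (μ.zm q - μ.zp j) ^ (h + 1)

/-- `Υ_1(h,j)`. -/
noncomputable def upsilon1 (h : ℕ) (j : UpTo μ.Np) : ℝ :=
  (-1) ^ h * (∑' q, μ.upsilon1p h j q - ∑' q, μ.upsilon1m h j q)

/-- The summands of the first series in `Υ_2(h,j)`. -/
noncomputable def upsilon2p (h : ℕ) (j : UpTo μ.Nm) (q : UpTo μ.Np) : ℝ :=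
  μ.cp q / (μ.zp q - μ.zm j) ^ (h + 1)

/-- The summands of the second series in `Υ_2(h,j)`. -/
noncomputable def upsilon2m (h : ℕ) (j q : UpTo μ.Nm) : ℝ :=
  if q = j then 0 else μ.cm q / (μ.zm q - μ.zm j) ^ (h + 1)

/-- `Υ_2(h,j)`. -/
noncomputable def upsilon2 (h : ℕ) (j : UpTo μ.Nm) : ℝ :=
  (-1) ^ h * (∑' q, μ.upsilon2p h j q - ∑' q, μ.upsilon2m h j q)

/-- All series occurring in `Υ_0`, `Υ_1`, `Υ_2` converge absolutely. -/
def UpsilonSummable : Prop :=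
  (Summable fun q => μ.cp q / (μ.zp q + 1)) ∧ (Summable fun q => μ.cm q / (μ.zm q + 1)) ∧
  (∀ h j, Summable (μ.upsilon1p h j) ∧ Summable (μ.upsilon1m h j)) ∧
  (∀ h j, Summable (μ.upsilon2p h j) ∧ Summable (μ.upsilon2m h j))

end ExpMixture

namespace PutCoeffs

variable {μ : ExpMixture} (a : PutCoeffs μ)

/-- The `j`-th positive-exponent term `e^{-ζ_+(j) x} ∑_{i < d} A_+(i,j,m,k) x^i`. -/
noncomputable def termP (d m k : ℕ) (x : ℝ) (j : UpTo μ.Np) : ℝ :=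
  Real.exp (-μ.zp j * x) * ∑ i ∈ Finset.range d, a.Ap i j m k * x ^ i

/-- The `j`-th negative-exponent term `e^{-ζ_-(j) x} ∑_{i < d} A_-(i,j,m,k) x^i`. -/
noncomputable def termM (d m k : ℕ) (x : ℝ) (j : UpTo μ.Nm) : ℝ :=
  Real.exp (-μ.zm j * x) * ∑ i ∈ Finset.range d, a.Am i j m k * x ^ i

open Classical in
/-- The piecewise formula for `V_k(x)`. -/
noncomputable def formula (K : ℝ) (k : ℕ) (x : ℝ) : ℝ :=
  (if a.xb 0 ≤ x then ∑' j, a.termP k 0 k x j else 0) +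
  ∑ m ∈ Finset.Icc 1 k, (if a.xb m ≤ x ∧ x < a.xb (m - 1) then
    ∑' j, a.termM (k - m + 1) m k x j + ∑' j, a.termP (k - m + 1) m k x j
      - a.B m k * Real.exp x + a.C m k else 0) +
  (if x < a.xb k then K - Real.exp x else 0)

/-- All series occurring in the piecewise formula for `V_k` converge absolutely. -/
def FormulaSummable (k : ℕ) : Prop :=
  (∀ x, a.xb 0 ≤ x → Summable (a.termP k 0 k x)) ∧
  ∀ m ∈ Finset.Icc 1 k, ∀ x, a.xb m ≤ x → x < a.xb (m - 1) →
    Summable (a.termM (k - m + 1) m k x) ∧ Summable (a.termP (k - m + 1) m k x)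

/-- Termwise antiderivative of `x ↦ e^{ζ x} * termP d m k x j`. -/
noncomputable def antiP (d m k : ℕ) (ζ x : ℝ) (j : UpTo μ.Np) : ℝ :=
  ∑ i ∈ Finset.range d, a.Ap i j m k * expAntideriv (ζ - μ.zp j) i x

/-- Termwise antiderivative of `x ↦ e^{ζ x} * termM d m k x j`. -/
noncomputable def antiM (d m k : ℕ) (ζ x : ℝ) (j : UpTo μ.Nm) : ℝ :=
  ∑ i ∈ Finset.range d, a.Am i j m k * expAntideriv (ζ - μ.zm j) i x

/-- The antiderivative of `x ↦ V_{k-1}(x) e^{ζ x}` on the interval `I_l`, where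
`I_0 = [x̄_0, ∞)`, `I_l = [x̄_l, x̄_{l-1})` for `0 < l < k` and `I_k = (-∞, x̄_{k-1})`, obtained by
antidifferentiating the piecewise formula for `V_{k-1}` term by term.  For `ζ = ζ_±(j)` this is
`F_±(x; l, j, k)`. -/
noncomputable def F (K ζ x : ℝ) (l k : ℕ) : ℝ :=
  if l = 0 then ∑' q, a.antiP (k - 1) 0 (k - 1) ζ x q
  else if l < k then
    ∑' q, a.antiM (k - l) l (k - 1) ζ x q + ∑' q, a.antiP (k - l) l (k - 1) ζ x q
      - a.B l (k - 1) * expAntideriv (ζ + 1) 0 x + a.C l (k - 1) * expAntideriv ζ 0 x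
  else K * expAntideriv ζ 0 x - expAntideriv (ζ + 1) 0 x

/-- All series occurring in the values of `F` at the end points of the intervals converge
absolutely. -/
def FSummable (ζ : ℝ) (k : ℕ) : Prop :=
  Summable (a.antiP (k - 1) 0 (k - 1) ζ (a.xb 0)) ∧
  ∀ l ∈ Finset.Ico 1 k, ∀ x ∈ ({a.xb l, a.xb (l - 1)} : Set ℝ),
    Summable (a.antiM (k - l) l (k - 1) ζ x) ∧ Summable (a.antiP (k - l) l (k - 1) ζ x)

/-- `∑_{l = s}^{t - 1} (F(x̄_{l-1}; l, k) - F(x̄_l; l, k))`. -/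
noncomputable def increments (K ζ : ℝ) (k s t : ℕ) : ℝ :=
  ∑ l ∈ Finset.Ico s t, (a.F K ζ (a.xb (l - 1)) l k - a.F K ζ (a.xb l) l k)

/-- The recursive formulae expressing the coefficients at stage `k ≥ 1` through those at stage
`k - 1`; `d` is the one-step discount factor `e^{-r/n}` and `K` the strike. -/
structure Recursion (d K : ℝ) (k : ℕ) : Prop where
  -- the interval between the boundary points `k` and `k - 1`
  Ap_new : ∀ j, a.Ap 0 j k k = 0
  Am_new : ∀ j, a.Am 0 j k k = d * μ.cm j *
    (a.F K (μ.zm j) (a.xb (k - 1)) k k - a.F K (μ.zm j) (a.xb 0) 0 k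
      + a.increments K (μ.zm j) k 1 k)
  B_new : a.B k k = d * μ.upsilon0
  C_new : a.C k k = d * K
  summable_new : ∀ z < a.xb (k - 1), Summable fun q => Real.exp (-μ.zm q * z) * a.Am 0 q k k
  xb_lt : a.xb k < a.xb (k - 1)
  xb_unique : ∀ z < a.xb (k - 1),
    (∑' q, Real.exp (-μ.zm q * z) * a.Am 0 q k k - a.B k k * Real.exp z + a.C k k
      = K - Real.exp z ↔ z = a.xb k)
  -- the intervals between the boundary points `m` and `m - 1`, for `1 ≤ m < k`
  Ap_zero : ∀ j, ∀ m ∈ Finset.Ico 1 k, a.Ap 0 j m k = d * μ.cp j *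
    (a.F K (μ.zp j) (a.xb (k - 1)) k k - a.F K (μ.zp j) (a.xb m) m k
      + a.increments K (μ.zp j) k (m + 1) k)
    + d * ∑ h ∈ Finset.range (k - m), a.Ap h j m (k - 1) * μ.upsilon1 h j * h.factorial
  Ap_pos : ∀ j, ∀ m ∈ Finset.Ico 1 k, ∀ i ∈ Finset.Icc 1 (k - m), a.Ap i j m k =
    d * ∑ h ∈ Finset.Icc 1 (k - m - i), a.Ap (i + h - 1) j m (k - 1) * μ.upsilon1 (h - 1) j *
      ((h + i - 1).factorial / i.factorial)
    + d * (μ.cp j / i) * a.Ap (i - 1) j m (k - 1)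
  Am_zero : ∀ j, ∀ m ∈ Finset.Ico 1 k, a.Am 0 j m k = d * μ.cm j *
    (a.F K (μ.zm j) (a.xb (m - 1)) m k - a.F K (μ.zm j) (a.xb 0) 0 k
      + a.increments K (μ.zm j) k 1 m)
    + d * ∑ h ∈ Finset.range (k - m), a.Am h j m (k - 1) * μ.upsilon2 h j * h.factorial
  Am_pos : ∀ j, ∀ m ∈ Finset.Ico 1 k, ∀ i ∈ Finset.Icc 1 (k - m), a.Am i j m k =
    d * ∑ h ∈ Finset.Icc 1 (k - m - i), a.Am (i + h - 1) j m (k - 1) * μ.upsilon2 (h - 1) j *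
      ((h + i - 1).factorial / i.factorial)
    - d * (μ.cm j / i) * a.Am (i - 1) j m (k - 1)
  B_old : ∀ m ∈ Finset.Ico 1 k, a.B m k = d * μ.upsilon0 * a.B m (k - 1)
  C_old : ∀ m ∈ Finset.Ico 1 k, a.C m k = d * a.C m (k - 1)
  -- the interval above the boundary point `0`
  Ap_top_zero : ∀ j, a.Ap 0 j 0 k = d * μ.cp j *
    (a.F K (μ.zp j) (a.xb (k - 1)) k k - a.F K (μ.zp j) (a.xb 0) 0 k
      + a.increments K (μ.zp j) k 1 k)
    + d * ∑ h ∈ Finset.Icc 1 (k - 1), a.Ap (h - 1) j 0 (k - 1) * μ.upsilon1 (h - 1) j *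
      (h - 1).factorial
  Ap_top_pos : ∀ j, ∀ i ∈ Finset.Icc 1 (k - 1), a.Ap i j 0 k =
    d * ∑ h ∈ Finset.Icc 1 (k - 1 - i), a.Ap (i + h - 1) j 0 (k - 1) * μ.upsilon1 (h - 1) j *
      ((h + i - 1).factorial / i.factorial)
    + d * (μ.cp j / i) * a.Ap (i - 1) j 0 (k - 1)

end PutCoeffs

/-! The probabilistic half reduces the problem to a recursion on functions. Between consecutive jump
times of `N` the increment of `X` is independent of the past and distributed as `X_ξ`
(`map_restrict_jump_increment`). Stopping on the grid is therefore optimal stopping of a random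
walk, and `V_0 = f`, `V_{k+1} = max (f, d * E[V_k(· + X_ξ)])` (`gridValue_eq_valueSeq`). In the
variable `S = exp x` all these functions are convex. Continuation value minus `K - S` is then a
convex function of `S`, negative near `0` and positive at `K`, so it changes sign exactly once on
`(0, K]`: this is the next boundary point. Because the law charges every interval, one more exercise
date strictly raises the continuation value, and the boundaries decrease strictly
(`exists_boundarySeq`).

The analytic half computes the expectation. Both halves of the mixture are put into one family with
exponents `z p` and signed weights `w p` (`toFamily`), with `∑ w p / z p = 1`. Expanding the density
turns `E[v(x + X_ξ)]` into a sum over `p` of `|w p| * exp (-z p * x)` times the integral of `v u *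
exp (z p * u)` over a half-line ending at `x` (`hasSum_integral_density`). If `v` is an exponential
polynomial `∑ q, exp (-z q * u) * P q u - B * exp u + C` on each interval, the half-line integral is
a constant plus `w p` times a termwise antiderivative at `x`, up to the factor `|w p|`
(`IsStage.integral_side`).

This leaves a double series over `(p, q)`. Integration by parts shows that an off-diagonal term
carries the exponential of `q`, not of `p`, and depends on `p` only through `w p / (z p - z q) ^ (h
+ 1)`. Summing over `p` first therefore produces `Υ` times derivatives of `P q`. The diagonal terms
`p = q` have no exponential left to integrate and produce a primitive of `P p`. The terms with `B`
and `C` sum to `Υ_0` and `1`. The result is again an exponential polynomial with the same exponents,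
and `nextPoly` is the map on polynomials (`step_hasSum`); its coefficients are the recursion of the
theorem.

Convergence for infinitely many exponents is the delicate point. Non-clustering bounds `∑ |w p| / |z
p - z q|` over `p ≠ q`, but the higher powers of `1 / (z p - z q)` need a compensation: each further
power costs a factor `1 / |w q|`. The invariant `Regular` supplies it by requiring the `h`-th
derivative of `P q`, times its exponential, to be at most `|w q| ^ h * γ q` with `γ` summable.
`step_regular` shows that one step preserves this bound, which yields absolute convergence of all
series and justifies every exchange of sum, sum and integral. -/

/-! ### Antiderivatives of polynomials times exponentials -/

open Polynomial in
/-- The antiderivative of `x ↦ P x * exp (b * x)` without additive constant. -/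
noncomputable def polyExpAntideriv (b : ℝ) (P : ℝ[X]) (x : ℝ) : ℝ :=
  P.sum fun i a => a * expAntideriv b i x

open Polynomial in
/-- The antiderivative of a polynomial that vanishes at the origin. -/
noncomputable def polyPrimitive (P : ℝ[X]) : ℝ[X] :=
  P.sum fun i a => monomial (i + 1) (a / (i + 1))

section PolyExp

open Polynomial

theorem polynomial_sum_eq_range {R : Type*} [AddCommMonoid R] (P : ℝ[X]) (d : ℕ)
    (hd : ∀ i, d ≤ i → P.coeff i = 0) (f : ℕ → ℝ → R) (hf : ∀ i, f i 0 = 0) :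
    P.sum f = ∑ i ∈ Finset.range d, f i (P.coeff i) := by
  rw [Polynomial.sum_def]
  refine Finset.sum_subset (fun i hi => ?_) (fun i _ hi => ?_)
  · rw [Finset.mem_range]
    by_contra h
    exact (Polynomial.mem_support_iff.mp hi) (hd i (not_lt.mp h))
  · rw [Polynomial.notMem_support_iff.mp hi, hf]

theorem polyExpAntideriv_eq_range (b : ℝ) (P : ℝ[X]) (x : ℝ) (d : ℕ)
    (hd : ∀ i, d ≤ i → P.coeff i = 0) :
    polyExpAntideriv b P x = ∑ i ∈ Finset.range d, P.coeff i * expAntideriv b i x :=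
  polynomial_sum_eq_range P d hd _ (by simp)

theorem eval_eq_range (P : ℝ[X]) (x : ℝ) (d : ℕ) (hd : ∀ i, d ≤ i → P.coeff i = 0) :
    P.eval x = ∑ i ∈ Finset.range d, P.coeff i * x ^ i := by
  rw [Polynomial.eval_eq_sum]
  exact polynomial_sum_eq_range P d hd _ (by simp)

theorem eq_sum_C_mul_X_pow (P : ℝ[X]) (d : ℕ) (hd : ∀ i, d ≤ i → P.coeff i = 0) :
    P = ∑ i ∈ Finset.range d, C (P.coeff i) * X ^ i := by
  conv_lhs => rw [← Polynomial.sum_C_mul_X_pow_eq P]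
  exact polynomial_sum_eq_range P d hd _ (by simp)

theorem coeff_eq_zero_of_natDegree_lt (P : ℝ[X]) :
    ∀ i, P.natDegree + 1 ≤ i → P.coeff i = 0 :=
  fun _ hi => Polynomial.coeff_eq_zero_of_natDegree_lt hi

theorem hasDerivAt_polyExpAntideriv (b : ℝ) (P : ℝ[X]) (x : ℝ) :
    HasDerivAt (polyExpAntideriv b P) (P.eval x * Real.exp (b * x)) x := by
  have hd := coeff_eq_zero_of_natDegree_lt P
  have h1 : polyExpAntideriv b P = fun x => ∑ i ∈ Finset.range (P.natDegree + 1),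
      P.coeff i * expAntideriv b i x :=
    funext fun x => polyExpAntideriv_eq_range b P x _ hd
  rw [h1, eval_eq_range P x _ hd, Finset.sum_mul]
  refine HasDerivAt.fun_sum fun i _ => ?_
  rw [mul_assoc]
  exact (hasDerivAt_expAntideriv b i x).const_mul _

theorem expAntideriv_zero_left (i : ℕ) (x : ℝ) :
    expAntideriv 0 i x = x ^ (i + 1) / (i + 1) := by
  cases i with
  | zero => simp [expAntideriv]
  | succ i => simp [expAntideriv]; ring

/-- Exponent `0` is the resonant case, in which an exponent meets itself. It is the only source of
growing polynomial degrees. -/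
theorem polyExpAntideriv_zero_left (P : ℝ[X]) (x : ℝ) :
    polyExpAntideriv 0 P x = (polyPrimitive P).eval x := by
  rw [polyExpAntideriv, polyPrimitive, Polynomial.sum_def, Polynomial.sum_def,
    Polynomial.eval_finsetSum]
  refine Finset.sum_congr rfl fun i _ => ?_
  rw [expAntideriv_zero_left, Polynomial.eval_monomial]
  ring

theorem coeff_polyPrimitive_zero (P : ℝ[X]) : (polyPrimitive P).coeff 0 = 0 := by
  simp [polyPrimitive, Polynomial.sum_def, Polynomial.finsetSum_coeff, Polynomial.coeff_monomial]

theorem coeff_polyPrimitive_succ (P : ℝ[X]) (i : ℕ) :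
    (polyPrimitive P).coeff (i + 1) = P.coeff i / (i + 1) := by
  simp only [polyPrimitive, Polynomial.sum_def, Polynomial.finsetSum_coeff,
    Polynomial.coeff_monomial, add_left_inj]
  rw [Finset.sum_ite_eq']
  split_ifs with h
  · rfl
  · rw [Polynomial.notMem_support_iff.mp h, zero_div]

theorem derivative_polyPrimitive (P : ℝ[X]) : derivative (polyPrimitive P) = P := by
  ext i
  rw [Polynomial.coeff_derivative, coeff_polyPrimitive_succ]
  field_simp

theorem polyPrimitive_zero : polyPrimitive 0 = 0 := by simp [polyPrimitive]

/-- Repeated integration by parts. Derivatives of `X ^ i` of order above `i` vanish, so every cutoff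
`d > i` gives the same value, and one cutoff can serve a whole family of polynomials. -/
theorem expAntideriv_of_ne_zero {b : ℝ} (hb : b ≠ 0) (x : ℝ) (i d : ℕ) (hi : i < d) :
    expAntideriv b i x = Real.exp (b * x) * ∑ h ∈ Finset.range d,
      (-1) ^ h * (derivative^[h] (X ^ i : ℝ[X])).eval x / b ^ (h + 1) := by
  induction i generalizing d with
  | zero =>
    obtain ⟨d, rfl⟩ : ∃ e, d = e + 1 := ⟨d - 1, by omega⟩
    rw [Finset.sum_range_succ', Finset.sum_eq_zero]
    · simp [expAntideriv, hb]; ring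
    · intro h _
      rw [pow_zero, Polynomial.iterate_derivative_one (Nat.succ_pos h)]
      simp
  | succ i ih =>
    obtain ⟨d, rfl⟩ : ∃ e, d = e + 1 := ⟨d - 1, by omega⟩
    have h1 := ih d (by omega)
    rw [Finset.sum_range_succ']
    have h2 : ∀ h, (derivative^[h + 1] (X ^ (i + 1) : ℝ[X])).eval x
        = (i + 1) * (derivative^[h] (X ^ i : ℝ[X])).eval x := by
      intro h
      rw [Function.iterate_succ_apply, Polynomial.derivative_X_pow, Nat.add_sub_cancel,
        Polynomial.iterate_derivative_C_mul, Polynomial.eval_C_mul]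
      push_cast; ring
    simp only [h2, expAntideriv, hb, if_false, h1]
    rw [mul_add, Finset.mul_sum, Finset.mul_sum, Finset.mul_sum, sub_eq_add_neg, add_comm,
      ← Finset.sum_neg_distrib]
    congr 1
    · refine Finset.sum_congr rfl fun h _ => ?_
      field_simp
      ring
    · simp; ring

theorem iterate_derivative_sum_C_mul (d : ℕ) (a : ℕ → ℝ) (h : ℕ) :
    derivative^[h] (∑ i ∈ Finset.range d, C (a i) * X ^ i)
      = ∑ i ∈ Finset.range d, C (a i) * derivative^[h] (X ^ i : ℝ[X]) := by
  rw [Polynomial.iterate_derivative_sum]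
  simp only [Polynomial.iterate_derivative_C_mul]

theorem polyExpAntideriv_of_ne_zero {b : ℝ} (hb : b ≠ 0) (P : ℝ[X]) (x : ℝ) (d : ℕ)
    (hd : ∀ i, d ≤ i → P.coeff i = 0) :
    polyExpAntideriv b P x = Real.exp (b * x) * ∑ h ∈ Finset.range d,
      (-1) ^ h * (derivative^[h] P).eval x / b ^ (h + 1) := by
  have h1 : ∀ h, (derivative^[h] P).eval x
      = ∑ i ∈ Finset.range d, P.coeff i * (derivative^[h] (X ^ i : ℝ[X])).eval x := by
    intro h
    conv_lhs => rw [eq_sum_C_mul_X_pow P d hd]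
    rw [iterate_derivative_sum_C_mul, Polynomial.eval_finsetSum]
    simp
  rw [polyExpAntideriv_eq_range b P x d hd]
  simp only [h1, Finset.mul_sum, Finset.sum_div]
  rw [Finset.sum_comm]
  refine Finset.sum_congr rfl fun i hi => ?_
  rw [expAntideriv_of_ne_zero hb x i d (Finset.mem_range.mp hi), Finset.mul_sum, Finset.mul_sum]
  refine Finset.sum_congr rfl fun h _ => ?_
  ring

end PolyExp

/-! ### Signed families of exponentials and expectations under their density -/

/-- A two-sided family of exponentials with signed weights: the weight `w p` has the sign of the
exponent `z p`, and `|w p| * exp (z p * y)` is a density on the half-line `z p * y < 0`. -/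
structure ExpFamily (ι : Type) [DecidableEq ι] where
  w : ι → ℝ
  z : ι → ℝ
  pos : ∀ p, 0 < w p * z p
  inj : Function.Injective z
  total : HasSum (fun p => w p / z p) 1
  bound : ℝ
  bound_spec : ∀ (q : ι) (s : Finset ι), ∑ p ∈ s.erase q, |w p| / |z p - z q| ≤ bound
  ne_neg_one : ∀ p, z p ≠ -1
  summable_shift : Summable fun p => w p / (z p + 1)

namespace ExpFamily

variable {ι : Type} [DecidableEq ι] (E : ExpFamily ι)

theorem z_ne_zero (p : ι) : E.z p ≠ 0 := right_ne_zero_of_mul (E.pos p).ne'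

theorem w_ne_zero (p : ι) : E.w p ≠ 0 := left_ne_zero_of_mul (E.pos p).ne'

theorem abs_w_pos (p : ι) : 0 < |E.w p| := abs_pos.mpr (E.w_ne_zero p)

theorem abs_z_pos (p : ι) : 0 < |E.z p| := abs_pos.mpr (E.z_ne_zero p)

theorem abs_w_div_abs_z (p : ι) : |E.w p| / |E.z p| = E.w p / E.z p := by
  rw [← abs_div, abs_of_pos]
  have h := E.pos p
  have h2 : E.w p / E.z p = E.w p * E.z p / (E.z p) ^ 2 := by
    field_simp [E.z_ne_zero p]
  rw [h2]
  have := E.z_ne_zero p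
  positivity

theorem summable_abs : Summable fun p => |E.w p| / |E.z p| := by
  simp only [abs_w_div_abs_z]
  exact E.total.summable

/-- The half-line below `x` if `z p > 0`, above `x` if `z p < 0`. -/
def side (p : ι) (x : ℝ) : Set ℝ := {u | E.z p * (u - x) < 0}

theorem side_of_pos {p : ι} (h : 0 < E.z p) (x : ℝ) : E.side p x = Set.Iio x := by
  ext u
  simp only [side, Set.mem_ofPred_eq, Set.mem_Iio, mul_neg_iff]
  constructor
  · rintro (⟨_, h2⟩ | ⟨h1, _⟩) <;> linarith
  · intro h2
    exact Or.inl ⟨h, by linarith⟩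

theorem side_of_neg {p : ι} (h : E.z p < 0) (x : ℝ) : E.side p x = Set.Ioi x := by
  ext u
  simp only [side, Set.mem_ofPred_eq, Set.mem_Ioi, mul_neg_iff]
  constructor
  · rintro (⟨h1, _⟩ | ⟨_, h2⟩) <;> linarith
  · intro h2
    exact Or.inr ⟨h, by linarith⟩

theorem measurableSet_side (p : ι) (x : ℝ) : MeasurableSet (E.side p x) := by
  rcases lt_or_gt_of_ne (E.z_ne_zero p) with h | h
  · rw [E.side_of_neg h]; exact measurableSet_Ioi
  · rw [E.side_of_pos h]; exact measurableSet_Iio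

theorem integrableOn_exp_side (p : ι) (x : ℝ) :
    IntegrableOn (fun u => Real.exp (E.z p * u)) (E.side p x) := by
  rcases lt_or_gt_of_ne (E.z_ne_zero p) with h | h
  · rw [E.side_of_neg h]; exact integrableOn_exp_mul_Ioi h x
  · rw [E.side_of_pos h]; exact (integrableOn_exp_mul_Iic h x).mono_set Set.Iio_subset_Iic_self

theorem integral_exp_side (p : ι) (x : ℝ) :
    ∫ u in E.side p x, Real.exp (E.z p * u) = Real.exp (E.z p * x) / |E.z p| := by
  rcases lt_or_gt_of_ne (E.z_ne_zero p) with h | h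
  · rw [E.side_of_neg h, integral_exp_mul_Ioi h x, abs_of_neg h, div_neg, neg_div]
  · rw [E.side_of_pos h, ← integral_Iic_eq_integral_Iio, integral_exp_mul_Iic h x, abs_of_pos h]

section Bounded

variable {v : ℝ → ℝ} {K : ℝ} (hv : Measurable v) (hK : ∀ u, |v u| ≤ K)

include hv hK

theorem integrableOn_mul_exp_side (p : ι) (x : ℝ) :
    IntegrableOn (fun u => v u * Real.exp (E.z p * u)) (E.side p x) :=
  (E.integrableOn_exp_side p x).bdd_mul hv.aestronglyMeasurable
    (Eventually.of_forall fun u => by simpa using hK u)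

theorem integral_abs_side_le (p : ι) (x : ℝ) :
    ∫ u in E.side p x, |v u * Real.exp (E.z p * u)| ≤ K * (Real.exp (E.z p * x) / |E.z p|) := by
  rw [← E.integral_exp_side p x, ← integral_const_mul]
  refine integral_mono (E.integrableOn_mul_exp_side hv hK p x).abs
    ((E.integrableOn_exp_side p x).const_mul K) fun u => ?_
  simp only [abs_mul, abs_of_pos (Real.exp_pos _)]
  exact mul_le_mul_of_nonneg_right (hK u) (Real.exp_pos _).le

theorem abs_integral_side_le (p : ι) (x : ℝ) :
    |∫ u in E.side p x, v u * Real.exp (E.z p * u)|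
      ≤ K * (Real.exp (E.z p * x) / |E.z p|) :=
  (abs_integral_le_integral_abs).trans (E.integral_abs_side_le hv hK p x)

end Bounded

/-- The density of the mixture. -/
noncomputable def density (y : ℝ) : ℝ :=
  ∑' p, if E.z p * y < 0 then |E.w p| * Real.exp (E.z p * y) else 0

/-- The substitution `u = x + y` turns the `p`-th term of the density into a half-line integral of
`v` against an exponential. In its norm the factors `exp (-z p * x)` and `exp (z p * x)` cancel, so
it costs at most `K * |w p| / |z p|`. This is summable and allows exchanging sum and integral. -/
theorem hasSum_integral_density [Countable ι] {v : ℝ → ℝ} {K : ℝ} (hv : Measurable v)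
    (hK : ∀ u, |v u| ≤ K) (x : ℝ) :
    HasSum (fun p => |E.w p| * Real.exp (-E.z p * x) *
      ∫ u in E.side p x, v u * Real.exp (E.z p * u)) (∫ y, v (x + y) * E.density y) := by
  set g : ι → ℝ → ℝ := fun p => (E.side p x).indicator fun u => v u * Real.exp (E.z p * u) with hg
  set G : ι → ℝ → ℝ := fun p y => |E.w p| * Real.exp (-E.z p * x) * g p (x + y) with hG
  have hgi : ∀ p, Integrable (g p) := fun p =>
    (integrable_indicator_iff (E.measurableSet_side p x)).mpr
      (E.integrableOn_mul_exp_side hv hK p x)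
  have hint : ∀ p, ∫ y, G p y = |E.w p| * Real.exp (-E.z p * x) *
      ∫ u in E.side p x, v u * Real.exp (E.z p * u) := by
    intro p
    rw [hG, integral_const_mul, integral_add_left_eq_self (g p) x,
      integral_indicator (E.measurableSet_side p x)]
  have hGi : ∀ p, Integrable (G p) := fun p => ((hgi p).comp_add_left x).const_mul _
  have hnorm : ∀ p, ∫ y, ‖G p y‖ ≤ K * (|E.w p| / |E.z p|) := by
    intro p
    have h1 : ∀ y, ‖G p y‖ = |E.w p| * Real.exp (-E.z p * x) * |g p (x + y)| := fun y => by
      rw [Real.norm_eq_abs, hG, abs_mul, abs_mul, abs_abs, abs_of_pos (Real.exp_pos _)]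
    simp_rw [h1]
    rw [integral_const_mul, integral_add_left_eq_self (fun u => |g p u|) x]
    have h2 : (fun u => |g p u|) =
        (E.side p x).indicator fun u => |v u * Real.exp (E.z p * u)| := by
      funext u
      simp only [hg, Set.indicator]
      split_ifs <;> simp
    rw [h2, integral_indicator (E.measurableSet_side p x)]
    have h3 := E.integral_abs_side_le hv hK p x
    calc _ ≤ |E.w p| * Real.exp (-E.z p * x) * (K * (Real.exp (E.z p * x) / |E.z p|)) :=
          mul_le_mul_of_nonneg_left h3 (by positivity)
      _ = K * (|E.w p| / |E.z p|) * (Real.exp (-E.z p * x) * Real.exp (E.z p * x)) := by ring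
      _ = _ := by rw [← Real.exp_add]; simp
  have hsum : Summable fun p => ∫ y, ‖G p y‖ :=
    Summable.of_nonneg_of_le (fun p => integral_nonneg fun y => norm_nonneg _) hnorm
      (E.summable_abs.mul_left K)
  have h := hasSum_integral_of_summable_integral_norm hGi hsum
  simp only [hint] at h
  suffices hfun : (fun y => v (x + y) * E.density y) = fun y => ∑' p, G p y by rwa [hfun]
  funext y
  rw [density, ← tsum_mul_left]
  refine tsum_congr fun p => ?_
  have h4 : (x + y ∈ E.side p x) ↔ E.z p * y < 0 := by simp [side]
  simp only [hG, hg, Set.indicator, h4]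
  split_ifs
  · have : Real.exp (E.z p * y) = Real.exp (-E.z p * x) * Real.exp (E.z p * (x + y)) := by
      rw [← Real.exp_add]; ring_nf
    rw [this]; ring
  · simp

/-! ### Weighted gaps between exponents -/

/-- The weighted reciprocal distance between two exponents. -/
noncomputable def gap (p q : ι) : ℝ := if p = q then 0 else |E.w p| / |E.z p - E.z q|

theorem gap_nonneg (p q : ι) : 0 ≤ E.gap p q := by
  unfold gap; split_ifs <;> positivity

theorem sum_gap_le (q : ι) (s : Finset ι) : ∑ p ∈ s, E.gap p q ≤ E.bound := by
  refine le_trans (le_of_eq ?_) (E.bound_spec q s)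
  rw [← Finset.sum_erase s (a := q) (by simp [gap])]
  refine Finset.sum_congr rfl fun p hp => ?_
  rw [gap, if_neg (Finset.ne_of_mem_erase hp)]

theorem gap_le (p q : ι) : E.gap p q ≤ E.bound := by
  simpa using E.sum_gap_le q {p}

theorem bound_nonneg [Nonempty ι] : 0 ≤ E.bound :=
  (E.gap_nonneg (Classical.arbitrary ι) (Classical.arbitrary ι)).trans (E.gap_le _ _)

theorem summable_gap (q : ι) : Summable fun p => E.gap p q :=
  summable_of_sum_le (fun p => E.gap_nonneg p q) (E.sum_gap_le q)

theorem tsum_gap_le (q : ι) : ∑' p, E.gap p q ≤ E.bound :=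
  (E.summable_gap q).tsum_le_of_sum_le (E.sum_gap_le q)

/-- Column sums of the gap matrix are bounded uniformly, so weighting the columns by a summable
sequence gives a summable double series. All double series below are dominated by one of this kind.
-/
theorem summable_gap_mul {γ : ι → ℝ} (hγ : Summable γ) (h0 : ∀ q, 0 ≤ γ q) :
    Summable fun a : ι × ι => E.gap a.1 a.2 * γ a.2 := by
  have h : Summable fun a : ι × ι => E.gap a.2 a.1 * γ a.1 := by
    have h1 : ∀ q, Summable fun p => E.gap p q * γ q := fun q =>
      (E.summable_gap q).mul_right (γ q)
    have h2 : Summable fun q => ∑' p, E.gap p q * γ q := by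
      refine Summable.of_nonneg_of_le
        (fun q => tsum_nonneg fun p => mul_nonneg (E.gap_nonneg p q) (h0 q)) (fun q => ?_)
        (hγ.mul_left E.bound)
      rw [tsum_mul_right]
      exact mul_le_mul_of_nonneg_right (E.tsum_gap_le q) (h0 q)
    have h3 : (0 : ι × ι → ℝ) ≤ fun a => E.gap a.2 a.1 * γ a.1 :=
      fun a => mul_nonneg (E.gap_nonneg a.2 a.1) (h0 a.1)
    exact (summable_prod_of_nonneg h3).mpr ⟨h1, h2⟩
  exact (Equiv.prodComm ι ι).summable_iff.mp (by simpa [Function.comp_def] using h)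

/-- The powers of a gap that occur in iterated partial integration. -/
theorem abs_w_mul_pow_div_le {p q : ι} (hpq : p ≠ q) (h : ℕ) :
    |E.w p| * |E.w q| ^ h / |E.z p - E.z q| ^ (h + 1) ≤ E.gap p q * E.bound ^ h := by
  -- The non-clustering bound is applied with `p` and `q` exchanged: the weight of `q` absorbs all
  -- powers of the gap beyond the first.
  have h1 : |E.w q| / |E.z p - E.z q| ≤ E.bound := by
    have := E.gap_le q p
    rwa [gap, if_neg hpq.symm, abs_sub_comm] at this
  have h2 : |E.w p| * |E.w q| ^ h / |E.z p - E.z q| ^ (h + 1)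
      = |E.w p| / |E.z p - E.z q| * (|E.w q| / |E.z p - E.z q|) ^ h := by
    rw [div_pow, pow_succ]; field_simp
  rw [h2, gap, if_neg hpq]
  gcongr

/-! ### The sums of reciprocal powers -/

/-- The summands of `upsilon`. -/
noncomputable def upsilonTerm (h : ℕ) (q p : ι) : ℝ :=
  if p = q then 0 else E.w p / (E.z p - E.z q) ^ (h + 1)

/-- The sums of reciprocal powers of differences of exponents. -/
noncomputable def upsilon (h : ℕ) (q : ι) : ℝ := (-1) ^ h * ∑' p, E.upsilonTerm h q p

theorem abs_upsilonTerm_le (h : ℕ) (q p : ι) :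
    |E.upsilonTerm h q p| * |E.w q| ^ h ≤ E.gap p q * E.bound ^ h := by
  by_cases hpq : p = q
  · simp [upsilonTerm, gap, hpq]
  · have := E.abs_w_mul_pow_div_le hpq h
    rw [upsilonTerm, if_neg hpq, abs_div, abs_pow]
    refine le_trans (le_of_eq ?_) this
    ring

theorem summable_abs_upsilonTerm (h : ℕ) (q : ι) : Summable fun p => |E.upsilonTerm h q p| := by
  refine Summable.of_nonneg_of_le (fun p => abs_nonneg _) (fun p => ?_)
    ((E.summable_gap q).mul_right (E.bound ^ h / |E.w q| ^ h))
  have hw := pow_pos (E.abs_w_pos q) h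
  have h1 := E.abs_upsilonTerm_le h q p
  rw [mul_div_assoc', le_div_iff₀ hw]
  exact h1

theorem summable_upsilonTerm (h : ℕ) (q : ι) : Summable (E.upsilonTerm h q) :=
  (E.summable_abs_upsilonTerm h q).of_abs

/-- `upsilon h q` itself may grow like `|w q| ^ (-h)`. It is only ever multiplied by an `h`-th
derivative of the polynomial of `q`, where the invariant `Regular` provides the missing factor. -/
theorem abs_upsilon_le (h : ℕ) (q : ι) :
    |E.upsilon h q| * |E.w q| ^ h ≤ E.bound ^ (h + 1) := by
  have : Nonempty ι := ⟨q⟩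
  have hb := E.bound_nonneg
  rw [upsilon, abs_mul, abs_pow, abs_neg, abs_one, one_pow, one_mul]
  calc |∑' p, E.upsilonTerm h q p| * |E.w q| ^ h
      ≤ (∑' p, |E.upsilonTerm h q p|) * |E.w q| ^ h := by
        gcongr
        have := norm_tsum_le_tsum_norm (f := E.upsilonTerm h q)
          (by simpa using E.summable_abs_upsilonTerm h q)
        simpa using this
    _ = ∑' p, |E.upsilonTerm h q p| * |E.w q| ^ h := tsum_mul_right.symm
    _ ≤ ∑' p, E.gap p q * E.bound ^ h :=
        ((E.summable_abs_upsilonTerm h q).mul_right _).tsum_le_tsum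
          (E.abs_upsilonTerm_le h q) ((E.summable_gap q).mul_right _)
    _ = (∑' p, E.gap p q) * E.bound ^ h := tsum_mul_right
    _ ≤ E.bound * E.bound ^ h := by
        gcongr
        exact E.tsum_gap_le q
    _ = _ := by ring

/-- The sum `∑ w p / (z p + 1)`. -/
noncomputable def upsilonZero : ℝ := ∑' p, E.w p / (E.z p + 1)

end ExpFamily

/-! ### The one-step map on exponential polynomials -/

namespace ExpFamily

open Polynomial

variable {ι : Type} [DecidableEq ι] (E : ExpFamily ι)

/-- On `J`, the exponential polynomials `exp (-z p * x) * P p x` and their derivatives in the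
polynomial factor are dominated by a summable family. -/
def Regular (J : Set ℝ) (P : ι → ℝ[X]) : Prop :=
  ∃ γ : ι → ℝ, Summable γ ∧ (∀ p, 0 ≤ γ p) ∧ ∀ p, ∀ x ∈ J, ∀ h,
    |(derivative^[h] (P p)).eval x| * Real.exp (-E.z p * x) ≤ |E.w p| ^ h * γ p

theorem Regular.mono {E : ExpFamily ι} {J J' : Set ℝ} {P : ι → ℝ[X]} (h : E.Regular J P)
    (hJ : J' ⊆ J) : E.Regular J' P := by
  obtain ⟨γ, h1, h2, h3⟩ := h
  exact ⟨γ, h1, h2, fun p x hx => h3 p x (hJ hx)⟩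

theorem regular_zero (J : Set ℝ) : E.Regular J fun _ => 0 :=
  ⟨fun _ => 0, summable_zero, fun _ => le_rfl, fun p x _ h => by simp⟩

/-- The antiderivative of `u ↦ (∑ q, exp (-z q * u) * P q u - B * exp u + C) * exp (ζ * u)`
obtained term by term. -/
noncomputable def antideriv (P : ι → ℝ[X]) (B C ζ x : ℝ) : ℝ :=
  ∑' q, polyExpAntideriv (ζ - E.z q) (P q) x - B * expAntideriv (ζ + 1) 0 x
    + C * expAntideriv ζ 0 x

/-- The off-diagonal terms of the double series in the one-step recursion. -/
noncomputable def offDiag (P : ι → ℝ[X]) (x : ℝ) (p q : ι) : ℝ :=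
  if p = q then 0 else
    E.w p * Real.exp (-E.z p * x) * polyExpAntideriv (E.z p - E.z q) (P q) x

/-- The prefactor `exp (-z p * x)` cancels the `p`-part of the antiderivative's exponential. What
remains is the exponential of `q`, with `p` entering only through a reciprocal power of the gap. -/
theorem offDiag_eq (P : ι → ℝ[X]) (x : ℝ) (p q : ι) (D : ℕ)
    (hD : ∀ i, D ≤ i → (P q).coeff i = 0) :
    E.offDiag P x p q = ∑ h ∈ Finset.range D,
      Real.exp (-E.z q * x) * ((-1) ^ h * (derivative^[h] (P q)).eval x) *
        E.upsilonTerm h q p := by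
  by_cases hpq : p = q
  · simp [offDiag, upsilonTerm, hpq]
  · have hne : E.z p - E.z q ≠ 0 := sub_ne_zero.mpr fun h => hpq (E.inj h)
    rw [offDiag, if_neg hpq, polyExpAntideriv_of_ne_zero hne _ _ D hD]
    have hexp : Real.exp (-E.z p * x) * Real.exp ((E.z p - E.z q) * x)
        = Real.exp (-E.z q * x) := by
      rw [← Real.exp_add]; ring_nf
    rw [mul_assoc, ← mul_assoc (Real.exp _), hexp, Finset.mul_sum, Finset.mul_sum]
    refine Finset.sum_congr rfl fun h _ => ?_
    rw [upsilonTerm, if_neg hpq]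
    ring

theorem abs_offDiag_le {P : ι → ℝ[X]} {γ : ι → ℝ} {x : ℝ}
    (hγ : ∀ p h, |(derivative^[h] (P p)).eval x| * Real.exp (-E.z p * x) ≤ |E.w p| ^ h * γ p)
    (hγ0 : ∀ p, 0 ≤ γ p) {D : ℕ} (hD : ∀ p i, D ≤ i → (P p).coeff i = 0) (p q : ι) :
    |E.offDiag P x p q| ≤ E.gap p q * ((∑ h ∈ Finset.range D, E.bound ^ h) * γ q) := by
  rw [E.offDiag_eq P x p q D (hD q), Finset.sum_mul, Finset.mul_sum]
  refine (Finset.abs_sum_le_sum_abs _ _).trans (Finset.sum_le_sum fun h _ => ?_)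
  have h1 := E.abs_upsilonTerm_le h q p
  rw [abs_mul, abs_mul, abs_mul, abs_pow, abs_neg, abs_one, one_pow, one_mul,
    abs_of_pos (Real.exp_pos _), mul_comm (Real.exp _)]
  calc _ ≤ |E.w q| ^ h * γ q * |E.upsilonTerm h q p| :=
        mul_le_mul_of_nonneg_right (hγ q h) (abs_nonneg _)
    _ = |E.upsilonTerm h q p| * |E.w q| ^ h * γ q := by ring
    _ ≤ E.gap p q * E.bound ^ h * γ q := mul_le_mul_of_nonneg_right h1 (hγ0 q)
    _ = _ := by ring

theorem tsum_offDiag_left (P : ι → ℝ[X]) (x : ℝ) (q : ι) (D : ℕ)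
    (hD : ∀ i, D ≤ i → (P q).coeff i = 0) :
    ∑' p, E.offDiag P x p q = Real.exp (-E.z q * x) *
      ∑ h ∈ Finset.range D, E.upsilon h q * (derivative^[h] (P q)).eval x := by
  simp_rw [E.offDiag_eq P x _ q D hD]
  rw [Summable.tsum_finsetSum fun h _ => (E.summable_upsilonTerm h q).mul_left _, Finset.mul_sum]
  refine Finset.sum_congr rfl fun h _ => ?_
  rw [tsum_mul_left, upsilon]
  ring

/-- Separates the resonant term `q = p` from the rest of the series, so that summability of the
off-diagonal double series settles that of the antiderivatives. -/
theorem polyExpAntideriv_eq_offDiag (P : ι → ℝ[X]) (x : ℝ) (p q : ι) :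
    polyExpAntideriv (E.z p - E.z q) (P q) x = (E.w p * Real.exp (-E.z p * x))⁻¹ *
      E.offDiag P x p q + if q = p then (polyPrimitive (P p)).eval x else 0 := by
  by_cases hpq : p = q
  · subst hpq
    simp [offDiag, polyExpAntideriv_zero_left]
  · have := E.w_ne_zero p
    rw [offDiag, if_neg hpq, if_neg (Ne.symm hpq)]
    field_simp
    simp

section AtPoint

variable {P : ι → ℝ[X]} {γ : ι → ℝ} {x : ℝ}
    (hγ : ∀ p h, |(derivative^[h] (P p)).eval x| * Real.exp (-E.z p * x) ≤ |E.w p| ^ h * γ p)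
    (hγ0 : ∀ p, 0 ≤ γ p) (hγs : Summable γ)
    {D : ℕ} (hD : ∀ p i, D ≤ i → (P p).coeff i = 0)

include hγ hγ0 hγs hD

theorem summable_offDiag : Summable fun a : ι × ι => E.offDiag P x a.1 a.2 := by
  have h0 : ∀ q, 0 ≤ (∑ h ∈ Finset.range D, E.bound ^ h) * γ q := fun q => by
    have : Nonempty ι := ⟨q⟩
    have := E.bound_nonneg
    have := hγ0 q
    positivity
  exact Summable.of_norm_bounded (E.summable_gap_mul (hγs.mul_left _) h0)
    fun a => E.abs_offDiag_le hγ hγ0 hD a.1 a.2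

theorem summable_polyExpAntideriv (p : ι) :
    Summable fun q => polyExpAntideriv (E.z p - E.z q) (P q) x := by
  simp_rw [E.polyExpAntideriv_eq_offDiag P x p]
  exact (((E.summable_offDiag hγ hγ0 hγs hD).prod_factor p).mul_left _).add
    (hasSum_ite_eq p _).summable

theorem tsum_polyExpAntideriv (p : ι) :
    E.w p * Real.exp (-E.z p * x) * ∑' q, polyExpAntideriv (E.z p - E.z q) (P q) x
      = ∑' q, E.offDiag P x p q +
        E.w p * Real.exp (-E.z p * x) * (polyPrimitive (P p)).eval x := by
  have hw := E.w_ne_zero p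
  simp_rw [E.polyExpAntideriv_eq_offDiag P x p]
  rw [Summable.tsum_add (((E.summable_offDiag hγ hγ0 hγs hD).prod_factor p).mul_left _)
    (hasSum_ite_eq p _).summable, tsum_ite_eq, tsum_mul_left, mul_add, ← mul_assoc,
    mul_inv_cancel₀ (mul_ne_zero hw (Real.exp_pos _).ne'), one_mul]

theorem antideriv_eq (B C : ℝ) (p : ι) :
    E.w p * Real.exp (-E.z p * x) * E.antideriv P B C (E.z p) x
      = ∑' q, E.offDiag P x p q +
        E.w p * Real.exp (-E.z p * x) * (polyPrimitive (P p)).eval x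
        - B * Real.exp x * (E.w p / (E.z p + 1)) + C * (E.w p / E.z p) := by
  have h1 : E.z p + 1 ≠ 0 := fun h => E.ne_neg_one p (by linarith)
  have h2 : Real.exp (-E.z p * x) * Real.exp ((E.z p + 1) * x) = Real.exp x := by
    rw [← Real.exp_add]; ring_nf
  have h3 : Real.exp (-E.z p * x) * Real.exp (E.z p * x) = 1 := by
    rw [← Real.exp_add]; simp
  rw [antideriv, mul_add, mul_sub, E.tsum_polyExpAntideriv hγ hγ0 hγs hD p, expAntideriv,
    if_neg h1, expAntideriv, if_neg (E.z_ne_zero p)]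
  congr 1
  · congr 1
    rw [← h2]; ring
  · calc _ = C * (E.w p / E.z p) * (Real.exp (-E.z p * x) * Real.exp (E.z p * x)) := by ring
      _ = _ := by rw [h3, mul_one]

end AtPoint

/-- The polynomials after one step of the recursion. -/
noncomputable def nextPoly (P : ι → ℝ[X]) (κ : ι → ℝ) (d : ℝ) (D : ℕ) (p : ι) : ℝ[X] :=
  C d * (C (κ p) + C (E.w p) * polyPrimitive (P p)
    + ∑ h ∈ Finset.range D, C (E.upsilon h p) * derivative^[h] (P p))

section Step

variable {P : ι → ℝ[X]} {J : Set ℝ} {D : ℕ} {B C K : ℝ} {κ : ι → ℝ}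

/-- Compared with the `p`-th term of the expectation, the new `p`-th term has lost the row sum of
`offDiag` at `p` and gained the column sum at `p`; the contributions of `B` and `C` have been split
off. The identity serves twice: to sum over `p`, and to bound the new term without estimating the
primitive. -/
theorem exp_mul_eval_nextPoly {γ : ι → ℝ} {x : ℝ}
    (hγ : ∀ p h, |(derivative^[h] (P p)).eval x| * Real.exp (-E.z p * x) ≤ |E.w p| ^ h * γ p)
    (hγ0 : ∀ p, 0 ≤ γ p) (hγs : Summable γ)
    (hD : ∀ p i, D ≤ i → (P p).coeff i = 0) (κ : ι → ℝ) (B C d : ℝ) (p : ι) :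
    Real.exp (-E.z p * x) * (E.nextPoly P κ d D p).eval x =
      d * (Real.exp (-E.z p * x) * (κ p + E.w p * E.antideriv P B C (E.z p) x)
        - ∑' q, E.offDiag P x p q + B * Real.exp x * (E.w p / (E.z p + 1))
        - C * (E.w p / E.z p) + ∑' q, E.offDiag P x q p) := by
  have h := E.antideriv_eq hγ hγ0 hγs hD B C p
  rw [E.tsum_offDiag_left P x p D (hD p)]
  simp only [nextPoly, eval_mul, eval_add, eval_C, eval_finsetSum]
  linear_combination (-d) * h

theorem step_hasSum {d : ℝ} (hP : E.Regular J P) (hD : ∀ p i, D ≤ i → (P p).coeff i = 0)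
    {x : ℝ} (hx : x ∈ J) {s : ℝ}
    (hs : HasSum (fun p => Real.exp (-E.z p * x) *
      (κ p + E.w p * E.antideriv P B C (E.z p) x)) s) :
    HasSum (fun p => Real.exp (-E.z p * x) * (E.nextPoly P κ d D p).eval x)
      (d * s + d * E.upsilonZero * B * Real.exp x - d * C) := by
  obtain ⟨γ, hγs, hγ0, hγ⟩ := hP
  have hγx := fun p h => hγ p x hx h
  simp_rw [E.exp_mul_eval_nextPoly hγx hγ0 hγs hD κ B C d]
  have hsum := E.summable_offDiag hγx hγ0 hγs hD
  have hsum' : Summable fun a : ι × ι => E.offDiag P x a.2 a.1 :=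
    (Equiv.prodComm ι ι).summable_iff.mp (by simpa [Function.comp_def] using hsum)
  have e1 := hsum.prod.hasSum
  have e2 := hsum'.prod.hasSum
  -- Row sums and column sums of the absolutely convergent double series have the same total, so
  -- what was subtracted and what was added cancel after summation over `p`.
  have e3 : ∑' p, ∑' q, E.offDiag P x p q = ∑' p, ∑' q, E.offDiag P x q p :=
    Summable.tsum_comm (f := fun q p => E.offDiag P x p q) hsum'
  have h := ((((hs.sub e1).add ((E.summable_shift.hasSum).mul_left (B * Real.exp x))).sub
    (E.total.mul_left C)).add e2).mul_left d
  rw [← upsilonZero] at h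
  rw [e3] at h
  have e : d * s + d * E.upsilonZero * B * Real.exp x - d * C =
      d * (s - ∑' p, ∑' q, E.offDiag P x q p + B * Real.exp x * E.upsilonZero - C * 1 +
        ∑' p, ∑' q, E.offDiag P x q p) := by ring
  rw [e]
  exact h

/-- The value and the derivatives need different arguments. The primitive has no direct bound, so
the value is rewritten by `exp_mul_eval_nextPoly` and the half-line integral is controlled through
`hκ`. From the first derivative on, the constant `κ` is gone and the primitive has become `P p`
again, with a prefactor `w p` that pays for the derivative. -/
theorem step_regular {d : ℝ} (hP : E.Regular J P) (hD : ∀ p i, D ≤ i → (P p).coeff i = 0)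
    (hB : ∃ b, ∀ x ∈ J, |B * Real.exp x| ≤ b)
    (hκ : ∀ p, ∀ x ∈ J, |Real.exp (-E.z p * x) *
      (κ p + E.w p * E.antideriv P B C (E.z p) x)| ≤ K * (|E.w p| / |E.z p|)) :
    E.Regular J (E.nextPoly P κ d D) := by
  obtain ⟨γ, hγs, hγ0, hγ⟩ := hP
  obtain ⟨b, hb⟩ := hB
  set L := ∑ h ∈ Finset.range D, E.bound ^ h with hL
  set L' := ∑ h ∈ Finset.range D, E.bound ^ (h + 1) with hL'
  have hγL : ∀ q, 0 ≤ L * γ q := fun q => by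
    have : Nonempty ι := ⟨q⟩
    have := E.bound_nonneg
    have := hγ0 q
    positivity
  have hγL' : ∀ q, 0 ≤ L' * γ q := fun q => by
    have : Nonempty ι := ⟨q⟩
    have := E.bound_nonneg
    have := hγ0 q
    positivity
  have hgap := E.summable_gap_mul (hγs.mul_left L) hγL
  have hshift : Summable fun p => |E.w p / (E.z p + 1)| := E.summable_shift.abs
  have hup : ∀ p, ∀ x ∈ J, ∀ k, |(∑ h ∈ Finset.range D,
      E.upsilon h p * (derivative^[k] (derivative^[h] (P p))).eval x)| * Real.exp (-E.z p * x)
        ≤ |E.w p| ^ k * (L' * γ p) := by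
    intro p x hx k
    rw [hL', Finset.sum_mul, Finset.mul_sum]
    refine (mul_le_mul_of_nonneg_right (Finset.abs_sum_le_sum_abs _ _)
      (Real.exp_pos _).le).trans ?_
    rw [Finset.sum_mul]
    refine Finset.sum_le_sum fun h _ => ?_
    rw [← Function.iterate_add_apply, abs_mul, mul_assoc]
    calc |E.upsilon h p| * (|(derivative^[k + h] (P p)).eval x| * Real.exp (-E.z p * x))
        ≤ |E.upsilon h p| * (|E.w p| ^ (k + h) * γ p) :=
          mul_le_mul_of_nonneg_left (hγ p x hx _) (abs_nonneg _)
      _ = |E.upsilon h p| * |E.w p| ^ h * (|E.w p| ^ k * γ p) := by rw [pow_add]; ring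
      _ ≤ E.bound ^ (h + 1) * (|E.w p| ^ k * γ p) :=
          mul_le_mul_of_nonneg_right (E.abs_upsilon_le h p)
            (mul_nonneg (by positivity) (hγ0 p))
      _ = _ := by ring
  -- The first five summands dominate the value, matching the five terms of the identity. The
  -- derivatives need only `L' * γ p` and the final `γ p`, which comes from differentiating the
  -- primitive.
  set γ' : ι → ℝ := fun p => |d| * (|K| * (|E.w p| / |E.z p|) + ∑' q, E.gap p q * (L * γ q)
    + |b| * |E.w p / (E.z p + 1)| + |C| * (|E.w p| / |E.z p|) + L' * γ p + γ p) with hγ'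
  have hg0 : ∀ p, 0 ≤ ∑' q, E.gap p q * (L * γ q) := fun p =>
    tsum_nonneg fun q => mul_nonneg (E.gap_nonneg p q) (hγL q)
  refine ⟨γ', ?_, ?_, ?_⟩
  · exact ((((((E.summable_abs.mul_left _).add hgap.prod).add (hshift.mul_left _)).add
      (E.summable_abs.mul_left _)).add (hγs.mul_left L')).add hγs).mul_left _
  · intro p
    have := hg0 p
    have := hγL' p
    have := hγ0 p
    positivity
  · intro p x hx h
    have hp1 := hg0 p
    have hp2 := hγL' p
    have hp3 := hγ0 p
    have hA : 0 ≤ |K| * (|E.w p| / |E.z p|) := by positivity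
    have hA2 : 0 ≤ |b| * |E.w p / (E.z p + 1)| := by positivity
    have hA3 : 0 ≤ |C| * (|E.w p| / |E.z p|) := by positivity
    cases h with
    | zero =>
      rw [Function.iterate_zero, id, pow_zero, one_mul]
      have he := E.exp_mul_eval_nextPoly (fun p h => hγ p x hx h) hγ0 hγs hD κ B C d p
      have e0 : |(E.nextPoly P κ d D p).eval x| * Real.exp (-E.z p * x)
          = |Real.exp (-E.z p * x) * (E.nextPoly P κ d D p).eval x| := by
        rw [abs_mul, abs_of_pos (Real.exp_pos _), mul_comm]
      rw [e0, he, abs_mul, hγ']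
      refine mul_le_mul_of_nonneg_left ?_ (abs_nonneg d)
      have t1 := hκ p x hx
      have t1' : K * (|E.w p| / |E.z p|) ≤ |K| * (|E.w p| / |E.z p|) :=
        mul_le_mul_of_nonneg_right (le_abs_self K) (by positivity)
      have t2 : |∑' q, E.offDiag P x p q| ≤ ∑' q, E.gap p q * (L * γ q) := by
        exact tsum_of_norm_bounded (f := fun q => E.offDiag P x p q)
          (g := fun q => E.gap p q * (L * γ q)) (hgap.prod_factor p).hasSum fun q =>
            E.abs_offDiag_le (fun p h => hγ p x hx h) hγ0 hD p q
      have t3 : |B * Real.exp x * (E.w p / (E.z p + 1))| ≤ |b| * |E.w p / (E.z p + 1)| := by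
        rw [abs_mul]
        exact mul_le_mul_of_nonneg_right ((hb x hx).trans (le_abs_self b)) (abs_nonneg _)
      have t4 : |C * (E.w p / E.z p)| ≤ |C| * (|E.w p| / |E.z p|) := by
        rw [abs_mul, abs_div]
      have t5 : |∑' q, E.offDiag P x q p| ≤ L' * γ p := by
        rw [E.tsum_offDiag_left P x p D (hD p), abs_mul, abs_of_pos (Real.exp_pos _), mul_comm]
        simpa using hup p x hx 0
      rw [abs_le] at t1 t2 t3 t4 t5 ⊢
      constructor <;> linarith [t1.1, t1.2, t2.1, t2.2, t3.1, t3.2, t4.1, t4.2, t5.1, t5.2]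
    | succ h =>
      have he : derivative^[h + 1] (E.nextPoly P κ d D p) =
          Polynomial.C d * (Polynomial.C (E.w p) * derivative^[h] (P p) +
            ∑ k ∈ Finset.range D, Polynomial.C (E.upsilon k p) *
              derivative^[h + 1] (derivative^[k] (P p))) := by
        rw [nextPoly, iterate_derivative_C_mul, iterate_map_add, iterate_map_add,
          iterate_derivative_C_mul, iterate_derivative_sum, iterate_derivative_C (Nat.succ_pos h),
          zero_add]
        simp only [iterate_derivative_C_mul]
        rw [Function.iterate_succ_apply (f := derivative) (x := polyPrimitive (P p)),
          derivative_polyPrimitive]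
      rw [he]
      simp only [eval_mul, eval_add, eval_C, eval_finsetSum]
      rw [abs_mul, hγ']
      have s1 := hup p x hx (h + 1)
      have s2 := hγ p x hx h
      have s3 := mul_le_mul_of_nonneg_left s2 (abs_nonneg (E.w p))
      calc _ ≤ |d| * (|E.w p| * |(derivative^[h] (P p)).eval x| +
            |∑ k ∈ Finset.range D, E.upsilon k p *
              (derivative^[h + 1] (derivative^[k] (P p))).eval x|) * Real.exp (-E.z p * x) := by
            gcongr
            refine (abs_add_le _ _).trans (le_of_eq ?_)
            rw [abs_mul]
        _ = |d| * (|E.w p| * (|(derivative^[h] (P p)).eval x| * Real.exp (-E.z p * x)) +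
            |∑ k ∈ Finset.range D, E.upsilon k p *
              (derivative^[h + 1] (derivative^[k] (P p))).eval x| * Real.exp (-E.z p * x)) := by
            ring
        _ ≤ |d| * (|E.w p| * (|E.w p| ^ h * γ p) + |E.w p| ^ (h + 1) * (L' * γ p)) := by
            gcongr
        _ = |E.w p| ^ (h + 1) * (|d| * (L' * γ p + γ p)) := by ring
        _ ≤ _ := by
            refine mul_le_mul_of_nonneg_left (mul_le_mul_of_nonneg_left ?_ (abs_nonneg d))
              (by positivity)
            linarith

end Step

end ExpFamily

/-! ### Termwise integration over intervals and half-lines -/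

theorem tendsto_expAntideriv_atTop {b : ℝ} (hb : b < 0) (i : ℕ) :
    Tendsto (expAntideriv b i) atTop (𝓝 0) := by
  have hpow : ∀ i : ℕ, Tendsto (fun x : ℝ => x ^ i * Real.exp (b * x)) atTop (𝓝 0) := by
    intro i
    have h := (isLittleO_pow_exp_pos_mul_atTop i (neg_pos.mpr hb)).tendsto_div_nhds_zero
    refine h.congr fun x => ?_
    rw [div_eq_mul_inv, ← Real.exp_neg]
    ring_nf
  induction i with
  | zero =>
    have h := (hpow 0).div_const b
    simp only [pow_zero, one_mul, zero_div] at h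
    refine h.congr fun x => ?_
    simp [expAntideriv, hb.ne]
  | succ i ih =>
    have h := ((hpow (i + 1)).div_const b).sub (ih.const_mul (((i : ℝ) + 1) / b))
    simp only [zero_div, mul_zero, sub_zero] at h
    refine h.congr fun x => ?_
    simp [expAntideriv, hb.ne]

open Polynomial in
theorem tendsto_polyExpAntideriv_atTop {b : ℝ} (hb : b < 0) (P : ℝ[X]) :
    Tendsto (polyExpAntideriv b P) atTop (𝓝 0) := by
  have h1 : polyExpAntideriv b P = fun x => ∑ i ∈ Finset.range (P.natDegree + 1),
      P.coeff i * expAntideriv b i x :=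
    funext fun x => polyExpAntideriv_eq_range b P x _ (coeff_eq_zero_of_natDegree_lt P)
  rw [h1]
  have h2 : Tendsto (fun x => ∑ i ∈ Finset.range (P.natDegree + 1),
      P.coeff i * expAntideriv b i x) atTop
      (𝓝 (∑ i ∈ Finset.range (P.natDegree + 1), P.coeff i * 0)) :=
    tendsto_finsetSum _ fun i _ => (tendsto_expAntideriv_atTop hb i).const_mul _
  simpa using h2

namespace ExpFamily

open Polynomial

variable {ι : Type} [DecidableEq ι] (E : ExpFamily ι)

/-- The function represented by the polynomials `P` and the constants `B`, `C`. -/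
noncomputable def repr (P : ι → ℝ[X]) (B C x : ℝ) : ℝ :=
  ∑' q, Real.exp (-E.z q * x) * (P q).eval x - B * Real.exp x + C

theorem continuous_eval_mul_exp (P : ℝ[X]) (b : ℝ) :
    Continuous fun u => P.eval u * Real.exp (b * u) := by
  have := P.continuous
  fun_prop

theorem Regular.summable {E : ExpFamily ι} {P : ι → ℝ[X]} {J : Set ℝ} (hP : E.Regular J P)
    {x : ℝ} (hx : x ∈ J) : Summable fun q => Real.exp (-E.z q * x) * (P q).eval x := by
  obtain ⟨γ, hγs, hγ0, hγ⟩ := hP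
  refine Summable.of_norm_bounded hγs fun q => ?_
  have := hγ q x hx 0
  rw [Real.norm_eq_abs, abs_mul, abs_of_pos (Real.exp_pos _), mul_comm]
  simpa using this

/-- The zeroth-order bound in `Regular` dominates the series by `γ q * exp (z p * u)`, which is
integrable over a bounded interval. `Regular` must hold at both end points, since the antiderivative
series is evaluated there. -/
theorem integral_repr_interval [Countable ι] {P : ι → ℝ[X]} {J : Set ℝ} {D : ℕ}
    (hP : E.Regular J P) (hD : ∀ p i, D ≤ i → (P p).coeff i = 0) (B C : ℝ) (p : ι) {s t : ℝ}
    (hst : s ≤ t) (hJ : Set.Icc s t ⊆ J) :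
    ∫ u in s..t, E.repr P B C u * Real.exp (E.z p * u)
      = E.antideriv P B C (E.z p) t - E.antideriv P B C (E.z p) s := by
  have hP' := hP
  obtain ⟨γ, hγs, hγ0, hγ⟩ := hP
  have hsum : ∀ x ∈ J, Summable fun q => polyExpAntideriv (E.z p - E.z q) (P q) x :=
    fun x hx => E.summable_polyExpAntideriv (fun p h => hγ p x hx h) hγ0 hγs hD p
  have hsub : Set.uIoc s t ⊆ J := by
    rw [Set.uIoc_of_le hst]; exact Set.Ioc_subset_Icc_self.trans hJ
  have hexp : ∀ q u, Real.exp (-E.z q * u) * (P q).eval u * Real.exp (E.z p * u)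
      = (P q).eval u * Real.exp ((E.z p - E.z q) * u) := by
    intro q u
    rw [mul_right_comm, ← Real.exp_add]
    ring_nf
  have hi : ∀ q, ∫ u in s..t, Real.exp (-E.z q * u) * (P q).eval u * Real.exp (E.z p * u)
      = polyExpAntideriv (E.z p - E.z q) (P q) t - polyExpAntideriv (E.z p - E.z q) (P q) s := by
    intro q
    simp_rw [hexp]
    exact intervalIntegral.integral_eq_sub_of_hasDerivAt
      (fun u _ => hasDerivAt_polyExpAntideriv _ _ u)
      ((continuous_eval_mul_exp _ _).intervalIntegrable s t)
  have hmain : HasSum (fun q => ∫ u in s..t,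
      Real.exp (-E.z q * u) * (P q).eval u * Real.exp (E.z p * u))
      (∫ u in s..t, (∑' q, Real.exp (-E.z q * u) * (P q).eval u) * Real.exp (E.z p * u)) := by
    refine intervalIntegral.hasSum_integral_of_dominated_convergence
      (fun q u => γ q * Real.exp (E.z p * u)) (fun q => ?_) (fun q => ?_) ?_ ?_ ?_
    · simp_rw [hexp]
      exact (continuous_eval_mul_exp _ _).aestronglyMeasurable
    · refine Eventually.of_forall fun u hu => ?_
      have := hγ q u (hsub hu) 0
      rw [norm_mul, Real.norm_eq_abs, Real.norm_eq_abs, Real.abs_exp, abs_mul, Real.abs_exp]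
      refine mul_le_mul_of_nonneg_right ?_ (Real.exp_pos _).le
      rw [mul_comm]
      simpa using this
    · exact Eventually.of_forall fun u _ => hγs.mul_right _
    · simp_rw [tsum_mul_right]
      exact (by fun_prop : Continuous fun u => (∑' q, γ q) * Real.exp (E.z p * u)).intervalIntegrable
        s t
    · exact Eventually.of_forall fun u hu =>
        ((hP'.summable (hsub hu)).hasSum).mul_right _
  have hint : IntervalIntegrable
      (fun u => (∑' q, Real.exp (-E.z q * u) * (P q).eval u) * Real.exp (E.z p * u))
      volume s t := by
    rw [intervalIntegrable_iff]
    have hb : IntegrableOn (fun u => (∑' q, γ q) * Real.exp (E.z p * u)) (Set.uIoc s t) :=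
      intervalIntegrable_iff.mp
        ((by fun_prop : Continuous fun u => (∑' q, γ q) * Real.exp (E.z p * u)).intervalIntegrable
          s t)
    refine Integrable.mono' hb ?_ ?_
    · refine Measurable.aestronglyMeasurable ?_
      refine Measurable.mul ?_ (by fun_prop)
      refine Measurable.tsum fun q => ?_
      exact (by have := (P q).continuous; fun_prop :
        Continuous fun u => Real.exp (-E.z q * u) * (P q).eval u).measurable
    · rw [ae_restrict_iff' measurableSet_uIoc]
      refine Eventually.of_forall fun u hu => ?_
      rw [norm_mul, Real.norm_eq_abs (Real.exp _), Real.abs_exp]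
      refine mul_le_mul_of_nonneg_right ?_ (Real.exp_pos _).le
      refine tsum_of_norm_bounded hγs.hasSum fun q => ?_
      have := hγ q u (hsub hu) 0
      rw [norm_mul, Real.norm_eq_abs, Real.norm_eq_abs, Real.abs_exp, mul_comm]
      simpa using this
  have hB : ∀ ζ : ℝ, ∫ u in s..t, Real.exp (ζ * u) = expAntideriv ζ 0 t - expAntideriv ζ 0 s := by
    intro ζ
    refine intervalIntegral.integral_eq_sub_of_hasDerivAt (fun u _ => ?_)
      ((by fun_prop : Continuous fun u => Real.exp (ζ * u)).intervalIntegrable s t)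
    simpa using hasDerivAt_expAntideriv ζ 0 u
  have hfun : ∀ u, E.repr P B C u * Real.exp (E.z p * u)
      = (∑' q, Real.exp (-E.z q * u) * (P q).eval u) * Real.exp (E.z p * u)
        - B * Real.exp ((E.z p + 1) * u) + C * Real.exp (E.z p * u) := by
    intro u
    have : Real.exp ((E.z p + 1) * u) = Real.exp u * Real.exp (E.z p * u) := by
      rw [← Real.exp_add]; ring_nf
    rw [repr, this]; ring
  simp_rw [hfun]
  have c1 : IntervalIntegrable (fun u => B * Real.exp ((E.z p + 1) * u)) volume s t :=
    (by fun_prop : Continuous _).intervalIntegrable s t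
  have c2 : IntervalIntegrable (fun u => C * Real.exp (E.z p * u)) volume s t :=
    (by fun_prop : Continuous _).intervalIntegrable s t
  rw [intervalIntegral.integral_add (hint.sub c1) c2, intervalIntegral.integral_sub hint c1,
    intervalIntegral.integral_const_mul, intervalIntegral.integral_const_mul, hB, hB,
    ← hmain.tsum_eq]
  simp_rw [hi]
  rw [Summable.tsum_sub (hsum t (hJ (Set.right_mem_Icc.mpr hst)))
    (hsum s (hJ (Set.left_mem_Icc.mpr hst)))]
  simp only [antideriv]
  ring

/-- Near `+∞` only positive exponents `z q` may occur. Then `z p - z q < 0`, every antiderivative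
vanishes at infinity, and only the lower end point contributes. -/
theorem integral_repr_Ioi [Countable ι] {P : ι → ℝ[X]} {s : ℝ}
    (hP : E.Regular (Set.Ici s) P) {p : ι} (hp : E.z p < 0) (hP0 : ∀ q, E.z q < 0 → P q = 0) :
    ∫ u in Set.Ioi s, E.repr P 0 0 u * Real.exp (E.z p * u)
      = -E.antideriv P 0 0 (E.z p) s := by
  have hP' := hP
  obtain ⟨γ, hγs, hγ0, hγ⟩ := hP
  have hexp : ∀ q u, Real.exp (-E.z q * u) * (P q).eval u * Real.exp (E.z p * u)
      = (P q).eval u * Real.exp ((E.z p - E.z q) * u) := by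
    intro q u
    rw [mul_right_comm, ← Real.exp_add]
    ring_nf
  have hbound : ∀ q, ∀ u ∈ Set.Ioi s,
      ‖Real.exp (-E.z q * u) * (P q).eval u * Real.exp (E.z p * u)‖
        ≤ γ q * Real.exp (E.z p * u) := by
    intro q u hu
    have := hγ q u (Set.mem_Ici_of_Ioi hu) 0
    rw [norm_mul, Real.norm_eq_abs, Real.norm_eq_abs, Real.abs_exp, abs_mul, Real.abs_exp]
    refine mul_le_mul_of_nonneg_right ?_ (Real.exp_pos _).le
    rw [mul_comm]
    simpa using this
  have hmeas : ∀ q, Continuous fun u =>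
      Real.exp (-E.z q * u) * (P q).eval u * Real.exp (E.z p * u) := fun q => by
    have := (P q).continuous
    fun_prop
  have hbi : ∀ c : ℝ, IntegrableOn (fun u => c * Real.exp (E.z p * u)) (Set.Ioi s) := fun c =>
    (integrableOn_exp_mul_Ioi hp s).const_mul c
  have hi : ∀ q, ∫ u in Set.Ioi s, Real.exp (-E.z q * u) * (P q).eval u * Real.exp (E.z p * u)
      = -polyExpAntideriv (E.z p - E.z q) (P q) s := by
    intro q
    by_cases hq : E.z q < 0
    · simp [hP0 q hq, polyExpAntideriv]
    · have hint : IntegrableOn (fun u =>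
          Real.exp (-E.z q * u) * (P q).eval u * Real.exp (E.z p * u)) (Set.Ioi s) := by
        refine Integrable.mono' (hbi (γ q)) (hmeas q).aestronglyMeasurable ?_
        rw [ae_restrict_iff' measurableSet_Ioi]
        exact Eventually.of_forall (hbound q)
      simp_rw [hexp] at hint ⊢
      rw [integral_Ioi_of_hasDerivAt_of_tendsto
        (hasDerivAt_polyExpAntideriv (E.z p - E.z q) (P q) s).continuousAt.continuousWithinAt
        (fun u _ => hasDerivAt_polyExpAntideriv _ _ u) hint
        (tendsto_polyExpAntideriv_atTop (by linarith) _), zero_sub]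
  have hmain : HasSum (fun q => ∫ u in Set.Ioi s,
      Real.exp (-E.z q * u) * (P q).eval u * Real.exp (E.z p * u))
      (∫ u in Set.Ioi s, (∑' q, Real.exp (-E.z q * u) * (P q).eval u) * Real.exp (E.z p * u)) := by
    refine hasSum_integral_of_dominated_convergence
      (fun q u => γ q * Real.exp (E.z p * u)) (fun q => (hmeas q).aestronglyMeasurable)
      (fun q => ?_) ?_ ?_ ?_
    · rw [ae_restrict_iff' measurableSet_Ioi]
      exact Eventually.of_forall (hbound q)
    · exact Eventually.of_forall fun u => hγs.mul_right _
    · simp_rw [tsum_mul_right]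
      exact hbi _
    · rw [ae_restrict_iff' measurableSet_Ioi]
      exact Eventually.of_forall fun u hu =>
        ((hP'.summable (Set.mem_Ici_of_Ioi hu)).hasSum).mul_right _
  have hfun : ∀ u, E.repr P 0 0 u * Real.exp (E.z p * u)
      = (∑' q, Real.exp (-E.z q * u) * (P q).eval u) * Real.exp (E.z p * u) := by
    intro u; rw [repr]; ring
  simp_rw [hfun]
  rw [← hmain.tsum_eq]
  simp_rw [hi]
  rw [tsum_neg, antideriv]
  ring

theorem integral_repr_Iio {p : ι} (hp : 0 < E.z p) (B C s : ℝ) :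
    ∫ u in Set.Iio s, E.repr (fun _ => 0) B C u * Real.exp (E.z p * u)
      = E.antideriv (fun _ => 0) B C (E.z p) s := by
  have hfun : ∀ u, E.repr (fun _ => 0) B C u * Real.exp (E.z p * u)
      = C * Real.exp (E.z p * u) - B * Real.exp ((E.z p + 1) * u) := by
    intro u
    have : Real.exp ((E.z p + 1) * u) = Real.exp u * Real.exp (E.z p * u) := by
      rw [← Real.exp_add]; ring_nf
    rw [repr, this]; simp; ring
  have h1 : 0 < E.z p + 1 := by linarith
  simp_rw [hfun]
  rw [← integral_Iic_eq_integral_Iio, integral_sub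
    ((integrableOn_exp_mul_Iic hp s).const_mul C) ((integrableOn_exp_mul_Iic h1 s).const_mul B),
    integral_const_mul, integral_const_mul, integral_exp_mul_Iic hp, integral_exp_mul_Iic h1]
  simp [antideriv, polyExpAntideriv, expAntideriv, hp.ne', h1.ne']
  ring

theorem coeff_zero_nextPoly (P : ι → ℝ[X]) (κ : ι → ℝ) (d : ℝ) (D : ℕ) (p : ι) :
    (E.nextPoly P κ d D p).coeff 0 =
      d * (κ p + ∑ h ∈ Finset.range D, E.upsilon h p * (h.factorial * (P p).coeff h)) := by
  simp only [nextPoly, coeff_C_mul, coeff_add, coeff_C_zero, coeff_polyPrimitive_zero, mul_zero,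
    add_zero, finsetSum_coeff, coeff_iterate_derivative, zero_add, Nat.descFactorial_self,
    nsmul_eq_mul]

theorem coeff_succ_nextPoly (P : ι → ℝ[X]) (κ : ι → ℝ) (d : ℝ) (D : ℕ) (p : ι) (i : ℕ) :
    (E.nextPoly P κ d D p).coeff (i + 1) =
      d * (E.w p / (i + 1) * (P p).coeff i + ∑ h ∈ Finset.range D, E.upsilon h p *
        ((h + (i + 1)).factorial / (i + 1).factorial * (P p).coeff (i + 1 + h))) := by
  have hf : ∀ h : ℕ, ((i + 1 + h).descFactorial h : ℝ)
      = (h + (i + 1)).factorial / (i + 1).factorial := by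
    intro h
    rw [eq_div_iff (by positivity), add_comm h]
    have := Nat.factorial_mul_descFactorial (Nat.le_add_left h (i + 1))
    rw [Nat.add_sub_cancel] at this
    rw [mul_comm]
    exact_mod_cast this
  simp only [nextPoly, coeff_C_mul, coeff_add, coeff_C_succ, coeff_polyPrimitive_succ, zero_add,
    finsetSum_coeff, coeff_iterate_derivative, nsmul_eq_mul, hf]
  ring

/-- Only the primitive can raise the degree, and by one; the other summands are constants and
derivatives. -/
theorem coeff_nextPoly_eq_zero {P : ι → ℝ[X]} (κ : ι → ℝ) (d : ℝ) {D D' : ℕ} {p : ι}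
    (hD : ∀ i, D' ≤ i → (P p).coeff i = 0) (i : ℕ) (hi : D' + 1 ≤ i) :
    (E.nextPoly P κ d D p).coeff i = 0 := by
  obtain ⟨i, rfl⟩ : ∃ e, i = e + 1 := ⟨i - 1, by omega⟩
  rw [coeff_succ_nextPoly, hD i (by omega), mul_zero, zero_add, Finset.sum_eq_zero, mul_zero]
  intro h _
  rw [hD _ (by omega), mul_zero, mul_zero]

end ExpFamily

/-! ### Stage polynomials and their representation of the value functions -/

namespace ExpFamily

open Polynomial

variable {ι : Type} [DecidableEq ι] (E : ExpFamily ι)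

/-- The sum of the increments of `F` over the intervals `s, …, t - 1` between boundary points. -/
noncomputable def pieceSum (xb : ℕ → ℝ) (F : ℕ → ℝ → ℝ) (s t : ℕ) : ℝ :=
  ∑ l ∈ Finset.Ico s t, (F l (xb (l - 1)) - F l (xb l))

/-- The constant of integration on the `m`-th interval, if `F l` is the antiderivative of
`U * exp (z p * ·)` on the `l`-th interval and the lowest interval is the `k`-th. -/
noncomputable def constTerm (xb : ℕ → ℝ) (k m : ℕ) (F : ℕ → ℝ → ℝ) (p : ι) : ℝ :=
  if 0 < E.z p then
    -- On the lowest piece the integral from `-∞` to `x` is the antiderivative itself, so no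
    -- constant is left. The same happens below on the top piece for negative exponents and the
    -- integral from `x` to `∞`.
    (if m < k then
      E.w p * (F k (xb (k - 1)) - F m (xb m) + pieceSum xb F (m + 1) k) else 0)
  else
    (if 0 < m then
      -E.w p * (F m (xb (m - 1)) - F 0 (xb 0) + pieceSum xb F 1 m) else 0)

/-- The coefficient of `-exp x` on the `m`-th interval at stage `k`. -/
noncomputable def coeffB (d : ℝ) (k m : ℕ) : ℝ :=
  if m = 0 then 0 else (d * E.upsilonZero) ^ (k + 1 - m)

/-- The constant on the `m`-th interval at stage `k`. -/
noncomputable def coeffC (d K : ℝ) (k m : ℕ) : ℝ :=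
  if m = 0 then 0 else d ^ (k + 1 - m) * K

/-- The polynomial factors of the exponentials on the `m`-th interval at stage `k`. -/
noncomputable def stagePoly (xb : ℕ → ℝ) (d K : ℝ) : ℕ → ℕ → ι → ℝ[X]
  | 0, _ => fun _ => 0
  | k + 1, m => if m ≤ k + 1 then
      E.nextPoly (stagePoly xb d K k m)
        (fun p => E.constTerm xb (k + 1) m (fun l => E.antideriv (stagePoly xb d K k l)
          (E.coeffB d k l) (coeffC d K k l) (E.z p)) p) d (k + 1)
    else fun _ => 0

/-- The antiderivative of the stage `k` function times `exp (ζ * ·)` on the `l`-th interval. -/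
noncomputable def stageAnti (xb : ℕ → ℝ) (d K : ℝ) (k : ℕ) (ζ : ℝ) (l : ℕ) : ℝ → ℝ :=
  E.antideriv (E.stagePoly xb d K k l) (E.coeffB d k l) (coeffC d K k l) ζ

theorem stagePoly_succ (xb : ℕ → ℝ) (d K : ℝ) {k m : ℕ} (hm : m ≤ k + 1) :
    E.stagePoly xb d K (k + 1) m = E.nextPoly (E.stagePoly xb d K k m)
      (fun p => E.constTerm xb (k + 1) m (E.stageAnti xb d K k (E.z p)) p) d (k + 1) := by
  rw [stagePoly, if_pos hm]
  rfl

theorem stagePoly_of_lt (xb : ℕ → ℝ) (d K : ℝ) {k m : ℕ} (hm : k < m) :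
    E.stagePoly xb d K k m = fun _ => 0 := by
  cases k with
  | zero => rfl
  | succ k => rw [stagePoly, if_neg (by omega)]

/-- The degree grows by at most one per stage from the moment a piece acquires nonzero polynomials.
For piece `m ≥ 1` this is stage `m`; the top piece starts at stage `1`, like piece `1`, whence the
maximum. -/
theorem coeff_stagePoly_eq_zero (xb : ℕ → ℝ) (d K : ℝ) (k m : ℕ) (p : ι) (i : ℕ)
    (hi : k + 1 - max m 1 ≤ i) : (E.stagePoly xb d K k m p).coeff i = 0 := by
  induction k generalizing i with
  | zero => simp [stagePoly]
  | succ k ih =>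
    by_cases hm : m ≤ k + 1
    · rw [E.stagePoly_succ xb d K hm]
      exact E.coeff_nextPoly_eq_zero _ d (D' := k + 1 - max m 1) ih i (by omega)
    · rw [E.stagePoly_of_lt xb d K (by omega), coeff_zero]

theorem nextPoly_eq_zero {P : ι → ℝ[X]} {κ : ι → ℝ} {p : ι} (hP : P p = 0) (hκ : κ p = 0)
    (d : ℝ) (D : ℕ) : E.nextPoly P κ d D p = 0 := by
  simp [nextPoly, hP, hκ, polyPrimitive_zero]

/-- A negative exponent looks only to the right of `x`. From the top piece nothing but the top piece
is seen there, so no constant of integration ever starts such a polynomial. -/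
theorem stagePoly_zero_of_neg (xb : ℕ → ℝ) (d K : ℝ) (k : ℕ) {p : ι} (hp : E.z p < 0) :
    E.stagePoly xb d K k 0 p = 0 := by
  induction k with
  | zero => rfl
  | succ k ih =>
    rw [E.stagePoly_succ xb d K (Nat.zero_le _)]
    exact E.nextPoly_eq_zero ih (by simp [constTerm, hp.le]) _ _

/-- A positive exponent looks only to the left of `x`. When piece `k ≥ 1` is created it lies in the
lowest half-line of the preceding stage, where the polynomials vanish and no constant arises. -/
theorem stagePoly_diag_of_pos (xb : ℕ → ℝ) (d K : ℝ) (k : ℕ) {p : ι} (hp : 0 < E.z p) :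
    E.stagePoly xb d K k k p = 0 := by
  cases k with
  | zero => rfl
  | succ k =>
    rw [E.stagePoly_succ xb d K le_rfl]
    exact E.nextPoly_eq_zero (by rw [E.stagePoly_of_lt xb d K (Nat.lt_succ_self k)])
      (by simp [constTerm, hp]) _ _

theorem coeffB_succ (d : ℝ) {k m : ℕ} (hm : m ≤ k + 1) :
    E.coeffB d (k + 1) m = d * E.upsilonZero * E.coeffB d k m := by
  unfold coeffB
  split_ifs
  · simp
  · rw [show k + 1 + 1 - m = (k + 1 - m) + 1 by omega, pow_succ']

theorem coeffC_succ (d K : ℝ) {k m : ℕ} (hm : m ≤ k + 1) :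
    coeffC d K (k + 1) m = d * coeffC d K k m := by
  unfold coeffC
  split_ifs
  · simp
  · rw [show k + 1 + 1 - m = (k + 1 - m) + 1 by omega, pow_succ', mul_assoc]

/-- Index `k + 1` stands for the half-line below the last boundary. With coefficient `1` here, `K`
below and zero polynomials, the payoff `K - exp x` is covered by the same representation as the
other pieces. -/
theorem coeffB_bottom (d : ℝ) (k : ℕ) : E.coeffB d k (k + 1) = 1 := by simp [coeffB]

theorem coeffC_bottom (d K : ℝ) (k : ℕ) : coeffC d K k (k + 1) = K := by simp [coeffC]

/-- The closed interval between the boundary points `m` and `m - 1`; it is unbounded above for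
`m = 0` and unbounded below for `m = k + 1`. -/
def piece (xb : ℕ → ℝ) (k m : ℕ) : Set ℝ :=
  {x | (m ≤ k → xb m ≤ x) ∧ (1 ≤ m → x ≤ xb (m - 1))}

theorem piece_zero (xb : ℕ → ℝ) (k : ℕ) : piece xb k 0 = Set.Ici (xb 0) := by
  ext x; simp [piece]

theorem piece_bottom (xb : ℕ → ℝ) (k : ℕ) : piece xb k (k + 1) = Set.Iic (xb k) := by
  ext x; simp [piece]

theorem piece_eq_Icc (xb : ℕ → ℝ) {k m : ℕ} (h1 : 1 ≤ m) (hm : m ≤ k) :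
    piece xb k m = Set.Icc (xb m) (xb (m - 1)) := by
  ext x; simp [piece, h1, hm]

/-- An index keeps its interval from stage to stage, except that the lowest half-line, index `k +
1`, is cut off at the new boundary. -/
theorem piece_succ_subset (xb : ℕ → ℝ) {k m : ℕ} : piece xb (k + 1) m ⊆ piece xb k m :=
  fun _ hx => ⟨fun h => hx.1 (by omega), hx.2⟩

/-- A function that is represented by the stage `k` polynomials on all intervals. -/
structure IsStage (xb : ℕ → ℝ) (d K : ℝ) (k : ℕ) (v : ℝ → ℝ) : Prop where
  measurable : Measurable v
  abs_le : ∀ u, |v u| ≤ K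
  regular : ∀ m ≤ k + 1, E.Regular (piece xb k m) (E.stagePoly xb d K k m)
  eq_repr : ∀ m ≤ k + 1, ∀ x ∈ piece xb k m,
    v x = E.repr (E.stagePoly xb d K k m) (E.coeffB d k m) (coeffC d K k m) x

section Integrals

variable {E} {xb : ℕ → ℝ} {d K : ℝ} {k : ℕ} {v : ℝ → ℝ}

theorem coeff_stagePoly_eq_zero' (m : ℕ) :
    ∀ p i, k + 1 ≤ i → (E.stagePoly xb d K k m p).coeff i = 0 :=
  fun p i hi => E.coeff_stagePoly_eq_zero xb d K k m p i (by omega)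

variable (hv : E.IsStage xb d K k v)

include hv

theorem IsStage.integral_Iio_split {p : ι} (hp : 0 < E.z p) (s t : ℝ) :
    ∫ u in Set.Iio t, v u * Real.exp (E.z p * u) =
      (∫ u in Set.Iio s, v u * Real.exp (E.z p * u)) +
        ∫ u in s..t, v u * Real.exp (E.z p * u) := by
  have hi : ∀ x, IntegrableOn (fun u => v u * Real.exp (E.z p * u)) (Set.Iic x) := fun x => by
    have := E.integrableOn_mul_exp_side hv.measurable hv.abs_le p x
    rw [E.side_of_pos hp] at this
    exact (integrableOn_Iic_iff_integrableOn_Iio ).mpr this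
  have h := intervalIntegral.integral_Iic_sub_Iic (hi s) (hi t)
  rw [← integral_Iic_eq_integral_Iio, ← integral_Iic_eq_integral_Iio, ← h]
  ring

theorem IsStage.integral_Ioi_split {p : ι} (hp : E.z p < 0) {s t : ℝ} (hst : s ≤ t) :
    ∫ u in Set.Ioi s, v u * Real.exp (E.z p * u) =
      (∫ u in s..t, v u * Real.exp (E.z p * u)) +
        ∫ u in Set.Ioi t, v u * Real.exp (E.z p * u) := by
  have hi : ∀ x, IntegrableOn (fun u => v u * Real.exp (E.z p * u)) (Set.Ioi x) := fun x => by
    have := E.integrableOn_mul_exp_side hv.measurable hv.abs_le p x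
    rwa [E.side_of_neg hp] at this
  have h := intervalIntegral.integral_Ioi_sub_Ioi (hi s) hst
  rw [← h]
  ring

theorem IsStage.integral_Iio_bottom {p : ι} (hp : 0 < E.z p) {x : ℝ} (hx : x ≤ xb k) :
    ∫ u in Set.Iio x, v u * Real.exp (E.z p * u) = E.stageAnti xb d K k (E.z p) (k + 1) x := by
  have h0 := E.stagePoly_of_lt xb d K (Nat.lt_succ_self k)
  rw [stageAnti, h0, ← E.integral_repr_Iio hp]
  refine setIntegral_congr_fun measurableSet_Iio fun u hu => ?_
  rw [hv.eq_repr (k + 1) le_rfl u (by rw [piece_bottom]; exact (le_of_lt hu).trans hx), h0]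

variable [Countable ι]

theorem IsStage.integral_interval {m : ℕ} (hm : m ≤ k + 1) (p : ι) {s t : ℝ} (hst : s ≤ t)
    (hJ : Set.Icc s t ⊆ piece xb k m) :
    ∫ u in s..t, v u * Real.exp (E.z p * u)
      = E.stageAnti xb d K k (E.z p) m t - E.stageAnti xb d K k (E.z p) m s := by
  rw [stageAnti, ← E.integral_repr_interval (hv.regular m hm) (coeff_stagePoly_eq_zero' m)
    _ _ p hst hJ]
  refine intervalIntegral.integral_congr fun u hu => ?_
  rw [Set.uIcc_of_le hst] at hu
  rw [hv.eq_repr m hm u (hJ hu)]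

theorem IsStage.integral_Ioi_top {p : ι} (hp : E.z p < 0) {x : ℝ} (hx : xb 0 ≤ x) :
    ∫ u in Set.Ioi x, v u * Real.exp (E.z p * u) = -E.stageAnti xb d K k (E.z p) 0 x := by
  have hB : E.coeffB d k 0 = 0 := by simp [coeffB]
  have hC : coeffC d K k 0 = 0 := by simp [coeffC]
  have hreg := hv.regular 0 (Nat.zero_le _)
  rw [piece_zero] at hreg
  rw [stageAnti, hB, hC, ← E.integral_repr_Ioi (hreg.mono (Set.Ici_subset_Ici.mpr hx)) hp
    fun q hq => E.stagePoly_zero_of_neg xb d K k hq]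
  refine setIntegral_congr_fun measurableSet_Ioi fun u hu => ?_
  rw [hv.eq_repr 0 (Nat.zero_le _) u (by rw [piece_zero]; exact hx.trans (le_of_lt hu)), hB, hC]

theorem IsStage.integral_Iio_boundary (hxb : StrictAnti xb) {p : ι} (hp : 0 < E.z p) (j : ℕ)
    (hj : j ≤ k) :
    ∫ u in Set.Iio (xb (k - j)), v u * Real.exp (E.z p * u) =
      E.stageAnti xb d K k (E.z p) (k + 1) (xb k) +
        pieceSum xb (E.stageAnti xb d K k (E.z p)) (k - j + 1) (k + 1) := by
  induction j with
  | zero => simp [pieceSum, hv.integral_Iio_bottom hp le_rfl]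
  | succ j ih =>
    have h1 : 1 ≤ k - j := by omega
    have hle : xb (k - j) ≤ xb (k - j - 1) := hxb.antitone (by omega)
    have h2 : k - (j + 1) = k - j - 1 := by omega
    have h3 : k - j - 1 + 1 = k - j := by omega
    rw [h2, hv.integral_Iio_split hp (xb (k - j)) _, ih (by omega), h3,
      hv.integral_interval (m := k - j) (by omega) p hle (by
        rw [piece_eq_Icc xb h1 (Nat.sub_le _ _)])]
    rw [pieceSum, pieceSum, Finset.sum_eq_sum_Ico_succ_bot (by omega : k - j < k + 1)]
    ring

theorem IsStage.integral_Ioi_boundary (hxb : StrictAnti xb) {p : ι} (hp : E.z p < 0) (j : ℕ)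
    (hj : j ≤ k) :
    ∫ u in Set.Ioi (xb j), v u * Real.exp (E.z p * u) =
      -E.stageAnti xb d K k (E.z p) 0 (xb 0) +
        pieceSum xb (E.stageAnti xb d K k (E.z p)) 1 (j + 1) := by
  induction j with
  | zero => simp [pieceSum, hv.integral_Ioi_top hp le_rfl]
  | succ j ih =>
    have hle : xb (j + 1) ≤ xb j := hxb.antitone (by omega)
    rw [hv.integral_Ioi_split hp hle, ih (by omega),
      hv.integral_interval (m := j + 1) (by omega) p hle (by
        rw [piece_eq_Icc xb (by omega) hj, Nat.add_sub_cancel])]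
    rw [pieceSum, pieceSum, Finset.sum_Ico_succ_top (by omega : 1 ≤ j + 1), Nat.add_sub_cancel]
    ring

/-- The signed weights unify the two directions. For `z p > 0` the integral grows as its upper end
moves right; for `z p < 0` it shrinks as its lower end does, but then `w p = -|w p|`. Either way the
dependence on `x` is `w p` times the antiderivative on the piece containing `x`, and everything
beyond the end of that piece is collected in `constTerm`. -/
theorem IsStage.integral_side (hxb : StrictAnti xb) {m : ℕ} (hm : m ≤ k + 1) (p : ι) {x : ℝ}
    (hx : x ∈ piece xb k m) :
    |E.w p| * ∫ u in E.side p x, v u * Real.exp (E.z p * u) =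
      E.constTerm xb (k + 1) m (E.stageAnti xb d K k (E.z p)) p +
        E.w p * E.stageAnti xb d K k (E.z p) m x := by
  rcases lt_or_gt_of_ne (E.z_ne_zero p) with hp | hp
  · have hw : E.w p < 0 := by
      have := E.pos p
      nlinarith
    rw [E.side_of_neg hp, abs_of_neg hw, constTerm, if_neg (not_lt.mpr hp.le)]
    rcases Nat.eq_zero_or_pos m with rfl | hm0
    · rw [piece_zero] at hx
      rw [hv.integral_Ioi_top hp hx]
      simp
    · have hx2 := hx.2 hm0
      have hb := hv.integral_Ioi_boundary hxb hp (m - 1) (by omega)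
      rw [if_pos hm0, hv.integral_Ioi_split hp hx2, hb,
        hv.integral_interval hm p hx2 fun u hu =>
          ⟨fun h => (hx.1 h).trans hu.1, fun _ => hu.2⟩, Nat.sub_add_cancel hm0]
      ring
  · have hw : 0 < E.w p := pos_of_mul_pos_left (E.pos p) hp.le
    rw [E.side_of_pos hp, abs_of_pos hw, constTerm, if_pos hp]
    rcases Nat.lt_or_ge m (k + 1) with hmk | hmk
    · have hx1 := hx.1 (by omega)
      have hb := hv.integral_Iio_boundary hxb hp (k - m) (by omega)
      rw [Nat.sub_sub_self (by omega : m ≤ k)] at hb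
      rw [if_pos hmk, hv.integral_Iio_split hp (xb m) x, hb,
        hv.integral_interval hm p hx1 fun u hu =>
          ⟨fun _ => hu.1, fun h => hu.2.trans (hx.2 h)⟩, Nat.add_sub_cancel]
      ring
    · obtain rfl : m = k + 1 := le_antisymm hm hmk
      rw [piece_bottom] at hx
      rw [hv.integral_Iio_bottom hp hx]
      simp

theorem IsStage.next_regular (hxb : StrictAnti xb) {m : ℕ} (hm : m ≤ k + 1) :
    E.Regular (piece xb k m) (E.stagePoly xb d K (k + 1) m) := by
  rw [E.stagePoly_succ xb d K hm]
  refine E.step_regular (B := E.coeffB d k m) (C := coeffC d K k m) (K := K) (hv.regular m hm)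
    (coeff_stagePoly_eq_zero' m) ?_ fun p x hx => ?_
  -- The top piece is unbounded above, so `exp x` has no bound there, but its coefficient is zero.
  · rcases Nat.eq_zero_or_pos m with rfl | hm0
    · exact ⟨0, fun x _ => by simp [coeffB]⟩
    · refine ⟨|E.coeffB d k m| * Real.exp (xb (m - 1)), fun x hx => ?_⟩
      rw [abs_mul, Real.abs_exp]
      have := hx.2 hm0
      gcongr
  · rw [← stageAnti, ← hv.integral_side hxb hm p hx, abs_mul, abs_mul, abs_abs, Real.abs_exp]
    have := E.abs_integral_side_le hv.measurable hv.abs_le p x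
    calc _ ≤ Real.exp (-E.z p * x) * (|E.w p| * (K * (Real.exp (E.z p * x) / |E.z p|))) := by
          gcongr
      _ = K * (|E.w p| / |E.z p|) * (Real.exp (-E.z p * x) * Real.exp (E.z p * x)) := by ring
      _ = _ := by rw [← Real.exp_add]; simp

theorem IsStage.next_eq (hxb : StrictAnti xb) {m : ℕ} (hm : m ≤ k + 1) {x : ℝ}
    (hx : x ∈ piece xb k m) :
    d * ∫ y, v (x + y) * E.density y =
      E.repr (E.stagePoly xb d K (k + 1) m) (E.coeffB d (k + 1) m) (coeffC d K (k + 1) m) x := by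
  have h := E.hasSum_integral_density hv.measurable hv.abs_le x
  have h' : HasSum (fun p => Real.exp (-E.z p * x) *
      (E.constTerm xb (k + 1) m (E.stageAnti xb d K k (E.z p)) p +
        E.w p * E.stageAnti xb d K k (E.z p) m x)) (∫ y, v (x + y) * E.density y) := by
    convert h using 2 with p
    rw [← hv.integral_side hxb hm p hx]
    ring
  have h2 := E.step_hasSum (d := d) (hv.regular m hm) (coeff_stagePoly_eq_zero' m) hx h'
  rw [repr, E.stagePoly_succ xb d K hm, h2.tsum_eq, E.coeffB_succ d hm, coeffC_succ d K hm]
  ring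

end Integrals

/-- `hlow` and `hstep` both include the boundary point, where stopping and continuing are worth the
same. The representation therefore holds on closed pieces, as needed for evaluating antiderivatives
at the end points in the next step. -/
theorem isStage_of_recursion [Countable ι] {xb : ℕ → ℝ} {d K : ℝ} (hxb : StrictAnti xb)
    {U : ℕ → ℝ → ℝ} (hmeas : ∀ k, Measurable (U k)) (habs : ∀ k u, |U k u| ≤ K)
    (hzero : ∀ x, xb 0 ≤ x → U 0 x = 0) (hlow : ∀ k x, x ≤ xb k → U k x = K - Real.exp x)
    (hstep : ∀ k x, xb (k + 1) ≤ x → U (k + 1) x = d * ∫ y, U k (x + y) * E.density y) (k : ℕ) :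
    E.IsStage xb d K k (U k) := by
  have hbot : ∀ k, ∀ x ∈ piece xb k (k + 1), U k x = E.repr (E.stagePoly xb d K k (k + 1))
      (E.coeffB d k (k + 1)) (coeffC d K k (k + 1)) x := by
    intro k x hx
    rw [piece_bottom] at hx
    rw [E.coeffB_bottom, coeffC_bottom, E.stagePoly_of_lt xb d K (Nat.lt_succ_self k),
      hlow k x hx, repr]
    simp
    ring
  induction k with
  | zero =>
    refine ⟨hmeas 0, habs 0, fun m _ => E.regular_zero _, fun m hm x hx => ?_⟩
    rcases Nat.eq_zero_or_pos m with rfl | h0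
    · rw [piece_zero] at hx
      rw [hzero x hx]
      simp [repr, stagePoly, coeffB, coeffC]
    · obtain rfl : m = 0 + 1 := by omega
      exact hbot 0 x hx
  | succ k ih =>
    refine ⟨hmeas _, habs _, fun m hm => ?_, fun m hm x hx => ?_⟩
    · rcases Nat.lt_or_ge (k + 1) m with h | h
      · rw [E.stagePoly_of_lt xb d K h]
        exact E.regular_zero _
      · exact (ih.next_regular hxb h).mono (piece_succ_subset xb)
    · rcases Nat.lt_or_ge (k + 1) m with h | h
      · obtain rfl : m = k + 1 + 1 := by omega
        exact hbot (k + 1) x hx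
      · rw [← ih.next_eq hxb h (piece_succ_subset xb hx)]
        exact hstep k x ((hxb.antitone h).trans (hx.1 h))

end ExpFamily

/-! ### Reading off coefficients; positivity of the density -/

namespace ExpFamily

open Polynomial

variable {ι : Type} [DecidableEq ι] (E : ExpFamily ι)

theorem sum_Icc_one_eq_range (f : ℕ → ℝ) (n : ℕ) :
    ∑ h ∈ Finset.Icc 1 n, f h = ∑ h ∈ Finset.range n, f (h + 1) := by
  induction n with
  | zero => simp
  | succ n ih => rw [Finset.sum_Icc_succ_top (by omega), ih, Finset.sum_range_succ]

theorem sum_range_eq_of_eq_zero {f : ℕ → ℝ} {a b : ℕ} (hab : a ≤ b)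
    (h : ∀ i, a ≤ i → f i = 0) : ∑ i ∈ Finset.range b, f i = ∑ i ∈ Finset.range a, f i := by
  symm
  refine Finset.sum_subset (Finset.range_subset_range.mpr hab) fun i _ hi => h i ?_
  simpa using hi

theorem coeff_zero_stagePoly (xb : ℕ → ℝ) (d K : ℝ) {k m : ℕ} (hm : m ≤ k + 1) (p : ι) :
    (E.stagePoly xb d K (k + 1) m p).coeff 0 =
      d * E.constTerm xb (k + 1) m (E.stageAnti xb d K k (E.z p)) p +
      d * ∑ h ∈ Finset.range (k + 1 - max m 1),
        (E.stagePoly xb d K k m p).coeff h * E.upsilon h p * h.factorial := by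
  rw [E.stagePoly_succ xb d K hm, coeff_zero_nextPoly, mul_add,
    sum_range_eq_of_eq_zero (a := k + 1 - max m 1) (by omega) fun i hi => by
      rw [E.coeff_stagePoly_eq_zero xb d K k m p i hi, mul_zero, mul_zero]]
  congr 2
  exact Finset.sum_congr rfl fun h _ => by ring

/-- `nextPoly` sums over all `h < k + 1`. The degree bound cuts the sum to the range in the
recursion, and the shift of `h` by one aligns the indices. The quotient of factorials comes from
differentiating a monomial `h - 1` times. -/
theorem coeff_pos_stagePoly (xb : ℕ → ℝ) (d K : ℝ) {k m : ℕ} (hm : m ≤ k + 1) (p : ι) {i : ℕ}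
    (hi : 1 ≤ i) :
    (E.stagePoly xb d K (k + 1) m p).coeff i =
      d * ∑ h ∈ Finset.Icc 1 (k + 1 - max m 1 - i),
        (E.stagePoly xb d K k m p).coeff (i + h - 1) * E.upsilon (h - 1) p *
          ((h + i - 1).factorial / i.factorial) +
      d * (E.w p / i) * (E.stagePoly xb d K k m p).coeff (i - 1) := by
  obtain ⟨i, rfl⟩ : ∃ e, i = e + 1 := ⟨i - 1, by omega⟩
  rw [E.stagePoly_succ xb d K hm, coeff_succ_nextPoly, sum_Icc_one_eq_range,
    sum_range_eq_of_eq_zero (a := k + 1 - max m 1 - (i + 1)) (by omega) fun h hh => by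
      rw [E.coeff_stagePoly_eq_zero xb d K k m p _ (by omega), mul_zero, mul_zero]]
  have h1 : ∀ h, i + 1 + (h + 1) - 1 = i + 1 + h := fun h => by omega
  have h2 : ∀ h, h + 1 + (i + 1) - 1 = h + (i + 1) := fun h => by omega
  simp only [h1, h2, Nat.add_sub_cancel]
  rw [mul_add, add_comm]
  congr 1
  · congr 1
    exact Finset.sum_congr rfl fun h _ => by ring
  · push_cast; ring

/-- With `t = |z p| * |y|`, the inequality `t ≤ exp t` gives `exp (-t) ≤ 1 / t`, so for `y ≠ 0` the
series is dominated by `∑ |w p| / |z p|`. For `y = 0` all terms vanish. -/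
theorem summable_density (y : ℝ) :
    Summable fun p => if E.z p * y < 0 then |E.w p| * Real.exp (E.z p * y) else 0 := by
  refine Summable.of_norm_bounded (E.summable_abs.mul_right |y|⁻¹) fun p => ?_
  split_ifs with h
  · have hy : y ≠ 0 := fun h0 => by simp [h0] at h
    have ht : 0 < |E.z p| * |y| := mul_pos (E.abs_z_pos p) (abs_pos.mpr hy)
    have he : E.z p * y = -(|E.z p| * |y|) := by
      rw [← abs_mul, abs_of_neg h, neg_neg]
    have h1 : |E.z p| * |y| ≤ Real.exp (|E.z p| * |y|) :=
      (le_add_of_nonneg_right zero_le_one).trans (Real.add_one_le_exp _)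
    rw [Real.norm_eq_abs, abs_mul, abs_abs, Real.abs_exp, he, Real.exp_neg, div_eq_mul_inv,
      mul_assoc, ← mul_inv]
    gcongr
  · rw [norm_zero]; positivity

theorem measurable_density [Countable ι] : Measurable E.density := by
  refine Measurable.tsum fun p => ?_
  refine Measurable.ite (measurableSet_lt (by fun_prop) (by fun_prop)) ?_ measurable_const
  fun_prop

theorem density_nonneg (y : ℝ) : 0 ≤ E.density y :=
  tsum_nonneg fun p => by split_ifs <;> positivity

theorem density_pos {y : ℝ} {p : ι} (hp : E.z p * y < 0) : 0 < E.density y :=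
  (E.summable_density y).tsum_pos (fun p => by split_ifs <;> positivity) p (by
    rw [if_pos hp]
    have := E.abs_w_pos p
    positivity)

end ExpFamily

/-! ### Mixtures of exponentials as signed families -/

namespace ExpMixture

variable (μ : ExpMixture)

theorem sum_abs_cm_le (s : Finset (UpTo μ.Nm)) : ∑ q ∈ s, μ.cm q / |μ.zm q| ≤ 1 := by
  have h0 : ∀ q, 0 ≤ μ.cm q / |μ.zm q| := fun q => div_nonneg (μ.cm_pos q).le (abs_nonneg _)
  have h1 : ∀ q, μ.cm q / |μ.zm q| = -(μ.cm q / μ.zm q) := fun q => by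
    rw [abs_of_neg (μ.zm_neg q), div_neg]
  have hs : Summable fun q => μ.cm q / |μ.zm q| := by
    simp_rw [h1]; exact μ.summable_m.neg
  refine (hs.sum_le_tsum s fun q _ => h0 q).trans ?_
  simp_rw [h1]
  rw [tsum_neg, ← μ.total]
  have : 0 ≤ ∑' j, μ.cp j / μ.zp j :=
    tsum_nonneg fun j => div_nonneg (μ.cp_pos j).le (μ.zp_pos j).le
  linarith

theorem sum_abs_cp_le (s : Finset (UpTo μ.Np)) : ∑ q ∈ s, μ.cp q / |μ.zp q| ≤ 1 := by
  have h0 : ∀ q, 0 ≤ μ.cp q / μ.zp q := fun q => div_nonneg (μ.cp_pos q).le (μ.zp_pos q).le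
  have h1 : ∀ q, μ.cp q / |μ.zp q| = μ.cp q / μ.zp q := fun q => by
    rw [abs_of_pos (μ.zp_pos q)]
  simp_rw [h1]
  refine (μ.summable_p.sum_le_tsum s fun q _ => h0 q).trans ?_
  rw [← μ.total]
  have : ∑' j, μ.cm j / μ.zm j ≤ 0 :=
    tsum_nonpos fun j => div_nonpos_of_nonneg_of_nonpos (μ.cm_pos j).le (μ.zm_neg j).le
  linarith

/-- All but finitely many `zm q` are at most `-2`, and then `|zm q| ≤ 2 * |zm q + 1|`. -/
theorem summable_cm_shift : Summable fun q => μ.cm q / (μ.zm q + 1) := by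
  refine Summable.of_norm_bounded_eventually (g := fun q => 2 * |μ.cm q / μ.zm q|)
    (μ.summable_m.abs.mul_left 2) ?_
  filter_upwards [μ.zm_tendsto.eventually_le_atBot (-2)] with q hq
  have h1 : |μ.zm q| = -μ.zm q := abs_of_neg (by linarith)
  have h2 : |μ.zm q + 1| = -(μ.zm q + 1) := abs_of_neg (by linarith)
  rw [Real.norm_eq_abs, abs_div, abs_div, h1, h2, mul_div_assoc', div_le_div_iff₀ (by linarith)
    (by linarith)]
  nlinarith [abs_nonneg (μ.cm q)]

theorem summable_cp_shift : Summable fun q => μ.cp q / (μ.zp q + 1) := by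
  refine Summable.of_nonneg_of_le (fun q => ?_) (fun q => ?_) μ.summable_p
  · exact div_nonneg (μ.cp_pos q).le (by linarith [μ.zp_pos q])
  · exact div_le_div_of_nonneg_left (μ.cp_pos q).le (μ.zp_pos q) (by linarith)

/-- The two halves of a mixture of exponentials as one family with signed weights. -/
noncomputable def toFamily (hone : ∀ j, μ.zm j ≠ -1) (hp : NonClustering μ.cp μ.zp)
    (hm : NonClustering μ.cm μ.zm) : ExpFamily (UpTo μ.Np ⊕ UpTo μ.Nm) where
  w := Sum.elim μ.cp fun j => -μ.cm j
  z := Sum.elim μ.zp μ.zm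
  pos := by
    rintro (j | j)
    · exact mul_pos (μ.cp_pos j) (μ.zp_pos j)
    · exact mul_pos_of_neg_of_neg (neg_neg_of_pos (μ.cm_pos j)) (μ.zm_neg j)
  inj := by
    rintro (i | i) (j | j) h
    · exact congrArg _ (μ.zp_inj h)
    · exact absurd (h : μ.zp i = μ.zm j) ((μ.zm_neg j).trans (μ.zp_pos i)).ne'
    · exact absurd (h : μ.zm i = μ.zp j) ((μ.zm_neg i).trans (μ.zp_pos j)).ne
    · exact congrArg _ (μ.zm_inj h)
  total := by
    have h := HasSum.sum (f := fun p => Sum.elim μ.cp (fun j => -μ.cm j) p / Sum.elim μ.zp μ.zm p)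
      μ.summable_p.hasSum
      (b := -∑' j, μ.cm j / μ.zm j) (by
        have := μ.summable_m.hasSum.neg
        simpa [Function.comp_def, neg_div] using this)
    rwa [← sub_eq_add_neg, μ.total] at h
  -- The maximum covers exponents on the same side as `q`. The `1` covers the opposite side: there
  -- `|z p - z q| ≥ |z p|`, and `∑ |w p| / |z p|` over one side is at most the total mass `1`.
  bound := max hp.choose hm.choose + 1
  bound_spec := by
    have h1 := hp.choose_spec
    have h2 := hm.choose_spec
    rintro (j | j) s
    · rw [Finset.sum_sum_eq_sum_toLeft_add_sum_toRight]
      refine add_le_add ?_ ?_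
      · refine le_trans (le_of_eq ?_) ((h1 j s.toLeft).trans (le_max_left _ _))
        have : (s.erase (Sum.inl j)).toLeft = s.toLeft.erase j := by ext; simp
        rw [this]
        exact Finset.sum_congr rfl fun q _ => by simp [abs_of_pos (μ.cp_pos q)]
      · refine le_trans (Finset.sum_le_sum fun q _ => ?_) (μ.sum_abs_cm_le _)
        simp only [Sum.elim_inr, Sum.elim_inl, abs_neg, abs_of_pos (μ.cm_pos q)]
        have h3 := μ.zm_neg q
        have h4 := μ.zp_pos j
        refine div_le_div_of_nonneg_left (μ.cm_pos q).le (abs_pos.mpr h3.ne) ?_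
        rw [abs_of_neg h3, abs_of_neg (by linarith)]
        linarith
    · rw [Finset.sum_sum_eq_sum_toLeft_add_sum_toRight, add_comm]
      refine add_le_add ?_ ?_
      · refine le_trans (le_of_eq ?_) ((h2 j s.toRight).trans (le_max_right _ _))
        have : (s.erase (Sum.inr j)).toRight = s.toRight.erase j := by ext; simp
        rw [this]
        exact Finset.sum_congr rfl fun q _ => by simp [abs_of_pos (μ.cm_pos q)]
      · refine le_trans (Finset.sum_le_sum fun q _ => ?_) (μ.sum_abs_cp_le _)
        simp only [Sum.elim_inr, Sum.elim_inl, abs_of_pos (μ.cp_pos q)]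
        have h3 := μ.zp_pos q
        have h4 := μ.zm_neg j
        refine div_le_div_of_nonneg_left (μ.cp_pos q).le (abs_pos.mpr h3.ne') ?_
        rw [abs_of_pos h3, abs_of_pos (by linarith)]
        linarith
  ne_neg_one := by
    rintro (j | j)
    · exact (by have := μ.zp_pos j; simp only [Sum.elim_inl]; linarith : _ > _).ne'
    · exact hone j
  summable_shift := by
    refine Summable.sum _ μ.summable_cp_shift ?_
    refine μ.summable_cm_shift.neg.congr fun q => ?_
    simp [neg_div]

section Family

variable {μ} (hone : ∀ j, μ.zm j ≠ -1) (hp : NonClustering μ.cp μ.zp)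
  (hm : NonClustering μ.cm μ.zm)

theorem density_toFamily (y : ℝ) : (μ.toFamily hone hp hm).density y = μ.density y := by
  have hs := (μ.toFamily hone hp hm).summable_density y
  rw [ExpFamily.density, density, Summable.tsum_sum (hs.comp_injective Sum.inl_injective)
    (hs.comp_injective Sum.inr_injective)]
  congr 1
  · have h : ∀ j, (μ.toFamily hone hp hm).z (Sum.inl j) * y < 0 ↔ y < 0 := fun j => by
      change μ.zp j * y < 0 ↔ _
      rw [mul_neg_iff]
      have := μ.zp_pos j
      constructor
      · rintro (⟨_, h⟩ | ⟨h, _⟩)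
        · exact h
        · linarith
      · exact fun h => Or.inl ⟨this, h⟩
    simp only [h]
    split_ifs
    · exact tsum_congr fun j => by
        change |μ.cp j| * Real.exp (μ.zp j * y) = _
        rw [abs_of_pos (μ.cp_pos j)]
    · exact tsum_zero
  · have h : ∀ j, (μ.toFamily hone hp hm).z (Sum.inr j) * y < 0 ↔ 0 < y := fun j => by
      change μ.zm j * y < 0 ↔ _
      rw [mul_neg_iff]
      have := μ.zm_neg j
      constructor
      · rintro (⟨h, _⟩ | ⟨_, h⟩)
        · linarith
        · exact h
      · exact fun h => Or.inr ⟨this, h⟩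
    simp only [h]
    split_ifs
    · exact tsum_congr fun j => by
        change |-μ.cm j| * Real.exp (μ.zm j * y) = _
        rw [abs_neg, abs_of_pos (μ.cm_pos j)]
    · exact tsum_zero

theorem upsilon0_eq : μ.upsilon0 = (μ.toFamily hone hp hm).upsilonZero := by
  have hs := (μ.toFamily hone hp hm).summable_shift
  rw [ExpFamily.upsilonZero, Summable.tsum_sum (hs.comp_injective Sum.inl_injective)
    (hs.comp_injective Sum.inr_injective), upsilon0, sub_eq_add_neg, ← tsum_neg]
  congr 1
  exact tsum_congr fun q => by
    change _ = -μ.cm q / (μ.zm q + 1)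
    rw [neg_div]

theorem upsilonTerm_inl_inl (h : ℕ) (j q : UpTo μ.Np) :
    (μ.toFamily hone hp hm).upsilonTerm h (Sum.inl j) (Sum.inl q) = μ.upsilon1p h j q := by
  simp [ExpFamily.upsilonTerm, upsilon1p, toFamily]

theorem upsilonTerm_inl_inr (h : ℕ) (j : UpTo μ.Np) (q : UpTo μ.Nm) :
    (μ.toFamily hone hp hm).upsilonTerm h (Sum.inl j) (Sum.inr q) = -μ.upsilon1m h j q := by
  simp [ExpFamily.upsilonTerm, upsilon1m, toFamily, neg_div]

theorem upsilonTerm_inr_inl (h : ℕ) (j : UpTo μ.Nm) (q : UpTo μ.Np) :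
    (μ.toFamily hone hp hm).upsilonTerm h (Sum.inr j) (Sum.inl q) = μ.upsilon2p h j q := by
  simp [ExpFamily.upsilonTerm, upsilon2p, toFamily]

theorem upsilonTerm_inr_inr (h : ℕ) (j q : UpTo μ.Nm) :
    (μ.toFamily hone hp hm).upsilonTerm h (Sum.inr j) (Sum.inr q) = -μ.upsilon2m h j q := by
  simp only [ExpFamily.upsilonTerm, upsilon2m, toFamily, Sum.inr.injEq, Sum.elim_inr]
  split_ifs
  · simp
  · rw [neg_div]

include hone hp hm in
theorem upsilonSummable : μ.UpsilonSummable := by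
  have hs := (μ.toFamily hone hp hm).summable_upsilonTerm
  refine ⟨μ.summable_cp_shift, μ.summable_cm_shift, fun h j => ⟨?_, ?_⟩, fun h j => ⟨?_, ?_⟩⟩
  · exact ((hs h (Sum.inl j)).comp_injective Sum.inl_injective).congr
      fun q => (upsilonTerm_inl_inl hone hp hm h j q).symm ▸ rfl
  · have := ((hs h (Sum.inl j)).comp_injective Sum.inr_injective).neg
    exact this.congr fun q => by
      rw [Function.comp_apply, upsilonTerm_inl_inr, neg_neg]
  · exact ((hs h (Sum.inr j)).comp_injective Sum.inl_injective).congr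
      fun q => (upsilonTerm_inr_inl hone hp hm h j q).symm ▸ rfl
  · have := ((hs h (Sum.inr j)).comp_injective Sum.inr_injective).neg
    exact this.congr fun q => by
      rw [Function.comp_apply, upsilonTerm_inr_inr, neg_neg]

theorem upsilon1_eq (h : ℕ) (j : UpTo μ.Np) :
    μ.upsilon1 h j = (μ.toFamily hone hp hm).upsilon h (Sum.inl j) := by
  have hs := (μ.toFamily hone hp hm).summable_upsilonTerm h (Sum.inl j)
  rw [ExpFamily.upsilon, Summable.tsum_sum (hs.comp_injective Sum.inl_injective)
    (hs.comp_injective Sum.inr_injective), upsilon1]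
  simp only [upsilonTerm_inl_inl, upsilonTerm_inl_inr]
  rw [tsum_neg, sub_eq_add_neg]

theorem upsilon2_eq (h : ℕ) (j : UpTo μ.Nm) :
    μ.upsilon2 h j = (μ.toFamily hone hp hm).upsilon h (Sum.inr j) := by
  have hs := (μ.toFamily hone hp hm).summable_upsilonTerm h (Sum.inr j)
  rw [ExpFamily.upsilon, Summable.tsum_sum (hs.comp_injective Sum.inl_injective)
    (hs.comp_injective Sum.inr_injective), upsilon2]
  simp only [upsilonTerm_inr_inl, upsilonTerm_inr_inr]
  rw [tsum_neg, sub_eq_add_neg]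

end Family

end ExpMixture

/-! ### From the abstract recursion to the explicit formula -/

/-- A sequence of value functions that satisfies the one-step recursion with boundary points
`xb`. -/
structure IsValueSeq {ι : Type} [DecidableEq ι] (E : ExpFamily ι) (xb : ℕ → ℝ) (d K : ℝ)
    (U : ℕ → ℝ → ℝ) : Prop where
  strictAnti : StrictAnti xb
  measurable : ∀ k, Measurable (U k)
  abs_le : ∀ k u, |U k u| ≤ K
  zero : ∀ x, xb 0 ≤ x → U 0 x = 0
  low : ∀ k x, x ≤ xb k → U k x = K - Real.exp x
  step : ∀ k x, xb (k + 1) ≤ x → U (k + 1) x = d * ∫ y, U k (x + y) * E.density y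
  unique : ∀ k, ∀ z < xb k,
    (d * ∫ y, U k (z + y) * E.density y = K - Real.exp z ↔ z = xb (k + 1))

namespace ExpFamily

open Polynomial

variable {ι : Type} [DecidableEq ι] {E : ExpFamily ι} {xb : ℕ → ℝ} {d K : ℝ} {U : ℕ → ℝ → ℝ}

theorem _root_.IsValueSeq.isStage [Countable ι] (hU : IsValueSeq E xb d K U) (k : ℕ) :
    E.IsStage xb d K k (U k) :=
  E.isStage_of_recursion hU.strictAnti hU.measurable hU.abs_le hU.zero hU.low hU.step k

theorem IsStage.summable_antideriv {k : ℕ} {v : ℝ → ℝ} (hv : E.IsStage xb d K k v) {m : ℕ}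
    (hm : m ≤ k + 1) (p : ι) {x : ℝ} (hx : x ∈ piece xb k m) :
    Summable fun q => polyExpAntideriv (E.z p - E.z q) (E.stagePoly xb d K k m q) x := by
  obtain ⟨γ, hγs, hγ0, hγ⟩ := hv.regular m hm
  exact E.summable_polyExpAntideriv (fun p h => hγ p x hx h) hγ0 hγs
    (coeff_stagePoly_eq_zero' m) p

end ExpFamily

namespace ExpMixture

open ExpFamily Polynomial

variable {μ : ExpMixture} (hone : ∀ j, μ.zm j ≠ -1) (hp : NonClustering μ.cp μ.zp)
  (hm : NonClustering μ.cm μ.zm)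

/-- The coefficients of the put value functions. -/
noncomputable def putCoeffs (xb : ℕ → ℝ) (d K : ℝ) : PutCoeffs μ where
  xb := xb
  Ap i j m k := ((μ.toFamily hone hp hm).stagePoly xb d K k m (Sum.inl j)).coeff i
  Am i j m k := ((μ.toFamily hone hp hm).stagePoly xb d K k m (Sum.inr j)).coeff i
  B m k := (μ.toFamily hone hp hm).coeffB d k m
  C m k := coeffC d K k m

variable (xb : ℕ → ℝ) (d K : ℝ)

local notation "𝓔" => μ.toFamily hone hp hm
local notation "𝓐" => putCoeffs hone hp hm xb d K

theorem antiP_putCoeffs {e m k : ℕ} (he : k + 1 - max m 1 ≤ e) (ζ x : ℝ) (j : UpTo μ.Np) :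
    (𝓐).antiP e m k ζ x j
      = polyExpAntideriv (ζ - (𝓔).z (Sum.inl j)) ((𝓔).stagePoly xb d K k m (Sum.inl j)) x :=
  (polyExpAntideriv_eq_range _ _ _ _ fun i hi =>
    (𝓔).coeff_stagePoly_eq_zero xb d K k m _ i (he.trans hi)).symm

theorem antiM_putCoeffs {e m k : ℕ} (he : k + 1 - max m 1 ≤ e) (ζ x : ℝ) (j : UpTo μ.Nm) :
    (𝓐).antiM e m k ζ x j
      = polyExpAntideriv (ζ - (𝓔).z (Sum.inr j)) ((𝓔).stagePoly xb d K k m (Sum.inr j)) x :=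
  (polyExpAntideriv_eq_range _ _ _ _ fun i hi =>
    (𝓔).coeff_stagePoly_eq_zero xb d K k m _ i (he.trans hi)).symm

theorem termP_putCoeffs {e m k : ℕ} (he : k + 1 - max m 1 ≤ e) (x : ℝ) (j : UpTo μ.Np) :
    (𝓐).termP e m k x j = Real.exp (-(𝓔).z (Sum.inl j) * x) *
      ((𝓔).stagePoly xb d K k m (Sum.inl j)).eval x := by
  rw [eval_eq_range _ _ _ fun i hi =>
    (𝓔).coeff_stagePoly_eq_zero xb d K k m _ i (he.trans hi)]
  rfl

theorem termM_putCoeffs {e m k : ℕ} (he : k + 1 - max m 1 ≤ e) (x : ℝ) (j : UpTo μ.Nm) :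
    (𝓐).termM e m k x j = Real.exp (-(𝓔).z (Sum.inr j) * x) *
      ((𝓔).stagePoly xb d K k m (Sum.inr j)).eval x := by
  rw [eval_eq_range _ _ _ fun i hi =>
    (𝓔).coeff_stagePoly_eq_zero xb d K k m _ i (he.trans hi)]
  rfl

variable {xb d K} {U : ℕ → ℝ → ℝ}

variable (hU : IsValueSeq (μ.toFamily hone hp hm) xb d K U)

include hU

/-- The three cases of `F` are one antiderivative with vanishing parts removed: no negative
exponents, `B` or `C` on the top piece, no series on the lowest. On the pieces between, splitting
into two series uses summability over all exponents, which is why `x` must lie in the closed piece.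
-/
theorem F_putCoeffs {k l : ℕ} (hl : l ≤ k + 1) (p : UpTo μ.Np ⊕ UpTo μ.Nm) {x : ℝ}
    (hx : x ∈ piece xb k l) :
    (𝓐).F K ((𝓔).z p) x l (k + 1) = (𝓔).stageAnti xb d K k ((𝓔).z p) l x := by
  have hs := (hU.isStage k).summable_antideriv hl p hx
  have htsum := Summable.tsum_sum (hs.comp_injective Sum.inl_injective)
    (hs.comp_injective Sum.inr_injective)
  rw [stageAnti, antideriv, htsum, PutCoeffs.F]
  by_cases h0 : l = 0
  · subst h0
    rw [if_pos rfl, Nat.add_sub_cancel]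
    simp_rw [antiP_putCoeffs hone hp hm xb d K (e := k) (m := 0) (k := k) (by omega)]
    have hz : ∀ q, (𝓔).stagePoly xb d K k 0 (Sum.inr q) = 0 := fun q =>
      (𝓔).stagePoly_zero_of_neg xb d K k (μ.zm_neg q)
    simp [hz, polyExpAntideriv, coeffB, coeffC]
  · rw [if_neg h0]
    by_cases hlk : l < k + 1
    · rw [if_pos hlk, Nat.add_sub_cancel]
      simp_rw [antiP_putCoeffs hone hp hm xb d K (e := k + 1 - l) (m := l) (k := k) (by omega),
        antiM_putCoeffs hone hp hm xb d K (e := k + 1 - l) (m := l) (k := k) (by omega)]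
      rw [add_comm (∑' q, _)]
      rfl
    · obtain rfl : l = k + 1 := by omega
      rw [if_neg hlk, (𝓔).stagePoly_of_lt xb d K (Nat.lt_succ_self k), coeffB_bottom,
        coeffC_bottom]
      simp [polyExpAntideriv]
      ring

theorem left_mem_piece {k m : ℕ} : xb m ∈ piece xb k m :=
  ⟨fun _ => le_rfl, fun _ => hU.strictAnti.antitone (by omega)⟩

theorem right_mem_piece {k m : ℕ} : xb (m - 1) ∈ piece xb k m :=
  ⟨fun _ => hU.strictAnti.antitone (by omega), fun _ => le_rfl⟩

theorem increments_putCoeffs {k s t : ℕ} (ht : t ≤ k + 1) (p : UpTo μ.Np ⊕ UpTo μ.Nm) :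
    (𝓐).increments K ((𝓔).z p) (k + 1) s t
      = pieceSum xb ((𝓔).stageAnti xb d K k ((𝓔).z p)) s t := by
  refine Finset.sum_congr rfl fun l hl => ?_
  have hl' := Finset.mem_Ico.mp hl
  change (𝓐).F K ((𝓔).z p) (xb (l - 1)) l (k + 1) - (𝓐).F K ((𝓔).z p) (xb l) l (k + 1) = _
  rw [F_putCoeffs hone hp hm hU (by omega) p (right_mem_piece hone hp hm hU),
    F_putCoeffs hone hp hm hU (by omega) p (left_mem_piece hone hp hm hU)]

theorem fSummable_putCoeffs (k : ℕ) (p : UpTo μ.Np ⊕ UpTo μ.Nm) :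
    (𝓐).FSummable ((𝓔).z p) (k + 1) := by
  have hs := fun m (h : m ≤ k + 1) => (hU.isStage k).summable_antideriv h
  refine ⟨?_, fun l hl x hx => ?_⟩
  · have h := (hs 0 (Nat.zero_le _) p (left_mem_piece hone hp hm hU)).comp_injective
      Sum.inl_injective
    refine h.congr fun q => ?_
    exact (antiP_putCoeffs hone hp hm xb d K (by omega) _ _ q).symm
  · have hl' := Finset.mem_Ico.mp hl
    have hxp : x ∈ piece xb k l := by
      rcases hx with rfl | hx
      · exact left_mem_piece hone hp hm hU
      · rw [Set.mem_singleton_iff] at hx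
        subst hx
        exact right_mem_piece hone hp hm hU
    have h := hs l (by omega) p hxp
    refine ⟨(h.comp_injective Sum.inr_injective).congr fun q => ?_,
      (h.comp_injective Sum.inl_injective).congr fun q => ?_⟩
    · exact (antiM_putCoeffs hone hp hm xb d K (by omega) _ _ q).symm
    · exact (antiP_putCoeffs hone hp hm xb d K (by omega) _ _ q).symm

theorem constTerm_inl {k m : ℕ} (hmk : m < k + 1) (j : UpTo μ.Np) :
    (𝓔).constTerm xb (k + 1) m ((𝓔).stageAnti xb d K k ((𝓔).z (Sum.inl j))) (Sum.inl j) =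
      μ.cp j * ((𝓐).F K (μ.zp j) (xb k) (k + 1) (k + 1) - (𝓐).F K (μ.zp j) (xb m) m (k + 1)
        + (𝓐).increments K (μ.zp j) (k + 1) (m + 1) (k + 1)) := by
  have h1 := F_putCoeffs hone hp hm hU (k := k) le_rfl (Sum.inl j)
    (right_mem_piece hone hp hm hU)
  have h2 := F_putCoeffs hone hp hm hU (k := k) hmk.le (Sum.inl j)
    (left_mem_piece hone hp hm hU)
  have h3 := increments_putCoeffs hone hp hm hU (k := k) (s := m + 1) le_rfl (Sum.inl j)
  have h4 : 0 < (𝓔).z (Sum.inl j) := μ.zp_pos j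
  rw [constTerm, if_pos h4, if_pos hmk, ← h1, ← h2, ← h3]
  rfl

theorem constTerm_inr {k m : ℕ} (hm0 : 0 < m) (hmk : m ≤ k + 1) (j : UpTo μ.Nm) :
    (𝓔).constTerm xb (k + 1) m ((𝓔).stageAnti xb d K k ((𝓔).z (Sum.inr j))) (Sum.inr j) =
      μ.cm j * ((𝓐).F K (μ.zm j) (xb (m - 1)) m (k + 1) - (𝓐).F K (μ.zm j) (xb 0) 0 (k + 1)
        + (𝓐).increments K (μ.zm j) (k + 1) 1 m) := by
  have h1 := F_putCoeffs hone hp hm hU (k := k) hmk (Sum.inr j)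
    (right_mem_piece hone hp hm hU)
  have h2 := F_putCoeffs hone hp hm hU (k := k) (Nat.zero_le _) (Sum.inr j)
    (left_mem_piece hone hp hm hU (m := 0))
  have h3 := increments_putCoeffs hone hp hm hU (k := k) (s := 1) hmk (Sum.inr j)
  have h4 : ¬ 0 < (𝓔).z (Sum.inr j) := not_lt.mpr (μ.zm_neg j).le
  have h5 : -(𝓔).w (Sum.inr j) = μ.cm j := neg_neg _
  rw [constTerm, if_neg h4, if_pos hm0, ← h1, ← h2, ← h3, h5]
  rfl

/-- On the piece about to be created only constants with negative exponents survive. The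
representation of the continuation value holds on the whole half-line below `xb k`, including where
stopping is better, so the series can characterise the next boundary. -/
theorem hasSum_bottom (k : ℕ) {z : ℝ} (hz : z < xb k) :
    Summable (fun q => Real.exp (-μ.zm q * z) * (𝓐).Am 0 q (k + 1) (k + 1)) ∧
    ∑' q, Real.exp (-μ.zm q * z) * (𝓐).Am 0 q (k + 1) (k + 1)
      - (𝓐).B (k + 1) (k + 1) * Real.exp z + (𝓐).C (k + 1) (k + 1)
      = d * ∫ y, U k (z + y) * (𝓔).density y := by
  have hmem : z ∈ piece xb k (k + 1) := by
    rw [piece_bottom]; exact hz.le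
  have hs := ((hU.isStage k).next_regular hU.strictAnti le_rfl).summable hmem
  have hterm : ∀ q, Real.exp (-(𝓔).z (Sum.inr q) * z) *
      ((𝓔).stagePoly xb d K (k + 1) (k + 1) (Sum.inr q)).eval z
      = Real.exp (-μ.zm q * z) * (𝓐).Am 0 q (k + 1) (k + 1) := by
    intro q
    rw [eval_eq_range _ _ 1 fun i hi =>
      (𝓔).coeff_stagePoly_eq_zero xb d K (k + 1) (k + 1) _ i (by omega)]
    rw [Finset.sum_range_one, pow_zero, mul_one]
    rfl
  have h2 := (hs.comp_injective Sum.inr_injective).congr hterm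
  refine ⟨h2, ?_⟩
  rw [(hU.isStage k).next_eq hU.strictAnti le_rfl hmem, ExpFamily.repr,
    Summable.tsum_sum (hs.comp_injective Sum.inl_injective)
      (hs.comp_injective Sum.inr_injective)]
  simp_rw [hterm]
  have h0 : ∀ q, (𝓔).stagePoly xb d K (k + 1) (k + 1) (Sum.inl q) = 0 := fun q =>
    (𝓔).stagePoly_diag_of_pos xb d K (k + 1) (μ.zp_pos q)
  simp only [h0, eval_zero, mul_zero, tsum_zero, zero_add]
  rfl

theorem recursion_putCoeffs (k : ℕ) : (𝓐).Recursion d K (k + 1) where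
  Ap_new j := by
    change ((𝓔).stagePoly xb d K (k + 1) (k + 1) (Sum.inl j)).coeff 0 = 0
    rw [(𝓔).stagePoly_diag_of_pos xb d K (k + 1) (p := Sum.inl j) (μ.zp_pos j), coeff_zero]
  Am_new j := by
    change ((𝓔).stagePoly xb d K (k + 1) (k + 1) (Sum.inr j)).coeff 0 = _
    rw [(𝓔).coeff_zero_stagePoly xb d K le_rfl,
      constTerm_inr hone hp hm hU (Nat.succ_pos k) le_rfl,
      (𝓔).stagePoly_of_lt xb d K (Nat.lt_succ_self k)]
    simp only [coeff_zero, zero_mul, Finset.sum_const_zero, mul_zero, add_zero, mul_assoc]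
    rfl
  B_new := by
    change (𝓔).coeffB d (k + 1) (k + 1) = _
    rw [(𝓔).coeffB_succ d le_rfl, coeffB_bottom, upsilon0_eq hone hp hm, mul_one]
  C_new := by
    change coeffC d K (k + 1) (k + 1) = _
    rw [coeffC_succ d K le_rfl, coeffC_bottom]
  summable_new z hz := (hasSum_bottom hone hp hm hU k hz).1
  xb_lt := hU.strictAnti (Nat.lt_succ_self k)
  xb_unique z hz := by
    rw [(hasSum_bottom hone hp hm hU k hz).2]
    exact hU.unique k z hz
  Ap_zero j m hmk := by
    have hm' := Finset.mem_Ico.mp hmk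
    change ((𝓔).stagePoly xb d K (k + 1) m (Sum.inl j)).coeff 0 = _
    rw [(𝓔).coeff_zero_stagePoly xb d K (by omega), constTerm_inl hone hp hm hU (by omega),
      max_eq_left hm'.1, mul_assoc]
    simp_rw [upsilon1_eq hone hp hm]
    rfl
  Ap_pos j m hmk i hi := by
    have hm' := Finset.mem_Ico.mp hmk
    have hi' := Finset.mem_Icc.mp hi
    change ((𝓔).stagePoly xb d K (k + 1) m (Sum.inl j)).coeff i = _
    rw [(𝓔).coeff_pos_stagePoly xb d K (by omega) _ hi'.1, max_eq_left hm'.1]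
    simp_rw [upsilon1_eq hone hp hm]
    rfl
  Am_zero j m hmk := by
    have hm' := Finset.mem_Ico.mp hmk
    change ((𝓔).stagePoly xb d K (k + 1) m (Sum.inr j)).coeff 0 = _
    rw [(𝓔).coeff_zero_stagePoly xb d K (by omega),
      constTerm_inr hone hp hm hU (by omega) (by omega), max_eq_left hm'.1, mul_assoc]
    simp_rw [upsilon2_eq hone hp hm]
    rfl
  Am_pos j m hmk i hi := by
    have hm' := Finset.mem_Ico.mp hmk
    have hi' := Finset.mem_Icc.mp hi
    change ((𝓔).stagePoly xb d K (k + 1) m (Sum.inr j)).coeff i = _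
    rw [(𝓔).coeff_pos_stagePoly xb d K (by omega) _ hi'.1, max_eq_left hm'.1]
    simp_rw [upsilon2_eq hone hp hm]
    rw [sub_eq_add_neg, ← neg_mul, ← mul_neg, ← neg_div]
    rfl
  B_old m hmk := by
    have hm' := Finset.mem_Ico.mp hmk
    rw [upsilon0_eq hone hp hm]
    exact (𝓔).coeffB_succ d (by omega)
  C_old m hmk := by
    have hm' := Finset.mem_Ico.mp hmk
    exact coeffC_succ d K (by omega)
  Ap_top_zero j := by
    change ((𝓔).stagePoly xb d K (k + 1) 0 (Sum.inl j)).coeff 0 = _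
    rw [(𝓔).coeff_zero_stagePoly xb d K (by omega), constTerm_inl hone hp hm hU (by omega),
      sum_Icc_one_eq_range, mul_assoc]
    simp_rw [upsilon1_eq hone hp hm]
    rfl
  Ap_top_pos j i hi := by
    have hi' := Finset.mem_Icc.mp hi
    change ((𝓔).stagePoly xb d K (k + 1) 0 (Sum.inl j)).coeff i = _
    rw [(𝓔).coeff_pos_stagePoly xb d K (by omega) _ hi'.1]
    simp_rw [upsilon1_eq hone hp hm]
    rfl

theorem formulaSummable_putCoeffs (k : ℕ) : (𝓐).FormulaSummable k := by
  have hs := (hU.isStage k).regular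
  refine ⟨fun x hx => ?_, fun m hmk x hx1 hx2 => ?_⟩
  · have h := (hs 0 (Nat.zero_le _)).summable (x := x) (by rw [piece_zero]; exact hx)
    exact (h.comp_injective Sum.inl_injective).congr fun q =>
      (termP_putCoeffs hone hp hm xb d K (by omega) x q).symm
  · have hm' := Finset.mem_Icc.mp hmk
    have h := (hs m (by omega)).summable (x := x) ⟨fun _ => hx1, fun _ => hx2.le⟩
    exact ⟨(h.comp_injective Sum.inr_injective).congr fun q =>
        (termM_putCoeffs hone hp hm xb d K (by omega) x q).symm,
      (h.comp_injective Sum.inl_injective).congr fun q =>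
        (termP_putCoeffs hone hp hm xb d K (by omega) x q).symm⟩

theorem eq_formula_putCoeffs (k : ℕ) (x : ℝ) : U k x = (𝓐).formula K k x := by
  have hst := hU.isStage k
  have hanti := hU.strictAnti.antitone
  rw [PutCoeffs.formula]
  change U k x = (if xb 0 ≤ x then _ else 0) + (∑ m ∈ Finset.Icc 1 k,
    if xb m ≤ x ∧ x < xb (m - 1) then _ else 0) + if x < xb k then _ else 0
  rcases le_or_gt (xb 0) x with h0 | h0
  · have hmem : x ∈ piece xb k 0 := by rw [piece_zero]; exact h0
    have hs := (hst.regular 0 (Nat.zero_le _)).summable hmem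
    rw [if_pos h0, if_neg (not_lt.mpr ((hanti (Nat.zero_le k)).trans h0)), Finset.sum_eq_zero]
    · rw [hst.eq_repr 0 (Nat.zero_le _) x hmem, ExpFamily.repr,
        Summable.tsum_sum (hs.comp_injective Sum.inl_injective)
          (hs.comp_injective Sum.inr_injective)]
      have hz : ∀ q, (𝓔).stagePoly xb d K k 0 (Sum.inr q) = 0 := fun q =>
        (𝓔).stagePoly_zero_of_neg xb d K k (μ.zm_neg q)
      simp_rw [termP_putCoeffs hone hp hm xb d K (e := k) (m := 0) (k := k) (by omega)]
      simp [hz, coeffB, coeffC]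
    · intro m _
      rw [if_neg]
      rintro ⟨_, h⟩
      exact absurd (h.trans_le (hanti (Nat.zero_le (m - 1)))) (not_lt.mpr h0)
  · rw [if_neg (not_le.mpr h0), zero_add]
    rcases lt_or_ge x (xb k) with hk | hk
    · rw [if_pos hk, Finset.sum_eq_zero, zero_add, hU.low k x hk.le]
      intro m hmk
      rw [if_neg]
      rintro ⟨h, _⟩
      have := hanti (Finset.mem_Icc.mp hmk).2
      linarith
    · rw [if_neg (not_lt.mpr hk), add_zero]
      have hex : ∃ m, xb m ≤ x := ⟨k, hk⟩
      classical
      -- The first boundary point not above `x` selects the interval containing `x`; strict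
      -- monotonicity makes all other indicators vanish.
      set m := Nat.find hex with hm_def
      have hm1 : xb m ≤ x := Nat.find_spec hex
      have hmk : m ≤ k := Nat.find_min' hex hk
      have hm0 : 1 ≤ m := by
        by_contra h
        have h00 : m = 0 := by omega
        rw [h00] at hm1
        linarith
      have hm2 : x < xb (m - 1) := not_le.mp (Nat.find_min hex (by omega))
      rw [Finset.sum_eq_single m, if_pos ⟨hm1, hm2⟩]
      · have hmem : x ∈ piece xb k m := ⟨fun _ => hm1, fun _ => hm2.le⟩
        have hs := (hst.regular m (by omega)).summable hmem
        rw [hst.eq_repr m (by omega) x hmem, ExpFamily.repr,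
          Summable.tsum_sum (hs.comp_injective Sum.inl_injective)
            (hs.comp_injective Sum.inr_injective)]
        simp_rw [termP_putCoeffs hone hp hm xb d K (e := k - m + 1) (m := m) (k := k) (by omega),
          termM_putCoeffs hone hp hm xb d K (e := k - m + 1) (m := m) (k := k) (by omega)]
        rw [add_comm (∑' q, _)]
        rfl
      · intro l _ hlm
        rw [if_neg]
        rintro ⟨h1, h2⟩
        rcases lt_or_gt_of_ne hlm with h | h
        · have := hanti (show l ≤ m - 1 by omega)
          linarith
        · have := hanti (show m ≤ l - 1 by omega)
          linarith
      · intro h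
        exact absurd (Finset.mem_Icc.mpr ⟨hm0, hmk⟩) h

end ExpMixture

/-! ### Bellman recursion and exercise boundaries -/

/-- The value functions defined by the one-step optimality recursion. -/
noncomputable def valueSeq (ν : Measure ℝ) (d K : ℝ) : ℕ → ℝ → ℝ
  | 0 => putPayoff K
  | k + 1 => fun x => max (putPayoff K x) (d * ∫ y, valueSeq ν d K k (x + y) ∂ν)

/-- A convex function on `(0, ∞)` that is negative near `0` and positive at `K` has exactly one
sign change on `(0, K]`. -/
theorem exists_sign_change {φ : ℝ → ℝ} {s K : ℝ} (hφ : ConvexOn ℝ (Set.Ioi 0) φ) (hs : 0 < s)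
    (hsK : s < K) (hneg : ∀ t, 0 < t → t ≤ s → φ t < 0) (hpos : 0 < φ K) :
    ∃ b, 0 < b ∧ b < K ∧ φ b = 0 ∧ (∀ t, 0 < t → t < b → φ t < 0) ∧
      ∀ t, b < t → t ≤ K → 0 < φ t := by
  have hK : 0 < K := hs.trans hsK
  have hcont : ContinuousOn φ (Set.Icc s K) :=
    (hφ.continuousOn isOpen_Ioi).mono fun t ht => hs.trans_le ht.1
  obtain ⟨b, hb, hb0⟩ := intermediate_value_Icc hsK.le hcont
    (show (0 : ℝ) ∈ Set.Icc (φ s) (φ K) from ⟨(hneg s hs le_rfl).le, hpos.le⟩)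
  have hsb : s < b := lt_of_le_of_ne hb.1 fun h => by
    have := hneg s hs le_rfl
    rw [h, hb0] at this
    exact lt_irrefl _ this
  have hbK : b < K := lt_of_le_of_ne hb.2 fun h => by
    rw [← h, hb0] at hpos
    exact lt_irrefl _ hpos
  refine ⟨b, hs.trans hsb, hbK, hb0, fun t ht htb => ?_, fun t hbt htK => ?_⟩
  · rcases le_or_gt t s with h | h
    · exact hneg t ht h
    · have h1 := hφ.slope_mono_adjacent (x := s) (y := t) (z := b) hs (hs.trans hsb) h htb
      rw [hb0] at h1
      by_contra hcon
      push Not at hcon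
      have h2 : 0 < (φ t - φ s) / (t - s) :=
        div_pos (by linarith [hneg s hs le_rfl]) (by linarith)
      have h3 : (0 - φ t) / (b - t) ≤ 0 :=
        div_nonpos_of_nonpos_of_nonneg (by linarith) (by linarith)
      linarith
  · have h1 := hφ.slope_mono_adjacent (x := s) (y := b) (z := t) hs
      (hs.trans (hsb.trans hbt)) hsb hbt
    rw [hb0] at h1
    by_contra hcon
    push Not at hcon
    have h2 : 0 < (0 - φ s) / (b - s) :=
      div_pos (by linarith [hneg s hs le_rfl]) (by linarith)
    have h3 : (φ t - 0) / (t - b) ≤ 0 :=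
      div_nonpos_of_nonpos_of_nonneg (by linarith) (by linarith)
    linarith

theorem putPayoff_nonneg (K x : ℝ) : 0 ≤ putPayoff K x := le_max_right _ _

theorem putPayoff_of_le {K x : ℝ} (hK : 0 < K) (hx : x ≤ Real.log K) :
    putPayoff K x = K - Real.exp x := by
  have := (Real.le_log_iff_exp_le hK).mp hx
  exact max_eq_left (by linarith)

theorem putPayoff_of_ge {K x : ℝ} (hK : 0 < K) (hx : Real.log K ≤ x) : putPayoff K x = 0 := by
  have := (Real.log_le_iff_le_exp hK).mp hx
  exact max_eq_right (by linarith)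

theorem measurable_putPayoff (K : ℝ) : Measurable (putPayoff K) := by
  unfold putPayoff; fun_prop

theorem convexOn_putPayoff_log (K : ℝ) :
    ConvexOn ℝ (Set.Ioi 0) fun S => putPayoff K (Real.log S) := by
  have h : ConvexOn ℝ (Set.Ioi (0 : ℝ)) fun S => max (K - S) 0 := by
    refine ConvexOn.sup ?_ (convexOn_const 0 (convex_Ioi 0))
    exact (convexOn_const K (convex_Ioi 0)).sub (concaveOn_id (convex_Ioi 0))
  refine h.congr fun S hS => ?_
  rw [putPayoff, Real.exp_log hS]

/-- Because `ν` charges every interval, strictness on a single interval suffices. This is how strict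
inequalities between value functions pass to continuation values. -/
theorem integral_pos_of_pos_on_Ioo {ν : Measure ℝ} (hν : volume ≪ ν) {g : ℝ → ℝ} (hg : Integrable g ν) (h0 : ∀ y, 0 ≤ g y)
    {a b : ℝ} (hab : a < b) (hpos : ∀ y ∈ Set.Ioo a b, 0 < g y) : 0 < ∫ y, g y ∂ν := by
  rw [integral_pos_iff_support_of_nonneg h0 hg]
  refine lt_of_lt_of_le (pos_iff_ne_zero.mpr fun h => ?_)
    (measure_mono (show Set.Ioo a b ⊆ Function.support g from fun y hy => (hpos y hy).ne'))
  have := hν h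
  rw [Real.volume_Ioo, ENNReal.ofReal_eq_zero] at this
  linarith

theorem putPayoff_le_valueSeq {ν : Measure ℝ} {d K : ℝ} (k : ℕ) (x : ℝ) : putPayoff K x ≤ valueSeq ν d K k x := by
  cases k with
  | zero => exact le_rfl
  | succ k => exact le_max_left _ _

theorem valueSeq_nonneg {ν : Measure ℝ} {d K : ℝ} (k : ℕ) (x : ℝ) : 0 ≤ valueSeq ν d K k x :=
  (putPayoff_nonneg K x).trans (putPayoff_le_valueSeq k x)

section ValueSeq

variable {ν : Measure ℝ} [IsProbabilityMeasure ν] {d K : ℝ}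

theorem measurable_integral_add {U : ℝ → ℝ} (hU : Measurable U) :
    Measurable fun x => ∫ y, U (x + y) ∂ν := by
  have h : StronglyMeasurable (Function.uncurry fun x y : ℝ => U (x + y)) :=
    (hU.comp (by fun_prop : Measurable fun p : ℝ × ℝ => p.1 + p.2)).stronglyMeasurable
  exact h.integral_prod_right.measurable

variable (ν d K) in
theorem measurable_valueSeq (k : ℕ) : Measurable (valueSeq ν d K k) := by
  induction k with
  | zero => exact measurable_putPayoff K
  | succ k ih =>
    exact (measurable_putPayoff K).max ((measurable_integral_add ih).const_mul d)

theorem integrable_add_of_bounded {U : ℝ → ℝ} (hU : Measurable U) (hK : ∀ u, |U u| ≤ K) (x : ℝ) :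
    Integrable (fun y => U (x + y)) ν :=
  Integrable.of_bound (hU.comp (by fun_prop)).aestronglyMeasurable K
    (Eventually.of_forall fun y => hK (x + y))

variable (hd0 : 0 < d) (hd1 : d < 1) (hK : 0 < K)

include hd0 hd1 hK

theorem valueSeq_le (k : ℕ) (x : ℝ) : valueSeq ν d K k x ≤ K := by
  have h0 : ∀ x, putPayoff K x ≤ K := fun x => max_le (by linarith [Real.exp_pos x]) hK.le
  induction k generalizing x with
  | zero => exact h0 x
  | succ k ih =>
    refine max_le (h0 x) ?_
    have h1 : ∫ y, valueSeq ν d K k (x + y) ∂ν ≤ ∫ _, K ∂ν :=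
      integral_mono_of_nonneg (Eventually.of_forall fun y => valueSeq_nonneg k _)
        (integrable_const K) (Eventually.of_forall fun y => ih _)
    rw [integral_const, probReal_univ, one_smul] at h1
    nlinarith

theorem abs_valueSeq_le (k : ℕ) (x : ℝ) : |valueSeq ν d K k x| ≤ K := by
  rw [abs_of_nonneg (valueSeq_nonneg k x)]
  exact valueSeq_le hd0 hd1 hK k x

theorem integrable_valueSeq (k : ℕ) (x : ℝ) :
    Integrable (fun y => valueSeq ν d K k (x + y)) ν :=
  integrable_add_of_bounded (measurable_valueSeq ν d K k) (abs_valueSeq_le hd0 hd1 hK k) x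

theorem integral_valueSeq_le (k : ℕ) (x : ℝ) : ∫ y, valueSeq ν d K k (x + y) ∂ν ≤ K := by
  have h1 : ∫ y, valueSeq ν d K k (x + y) ∂ν ≤ ∫ _, K ∂ν :=
    integral_mono (integrable_valueSeq hd0 hd1 hK k x)
      (integrable_const K) fun y => valueSeq_le hd0 hd1 hK k _
  simpa using h1

/-- Adding `y` to `log S` multiplies `S` by `exp y`, a linear map, so convexity in `S` survives both
the shift and the average over `y`. -/
theorem convexOn_integral_log {k : ℕ}
    (hk : ConvexOn ℝ (Set.Ioi 0) fun S => valueSeq ν d K k (Real.log S)) :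
    ConvexOn ℝ (Set.Ioi 0) fun S => d * ∫ y, valueSeq ν d K k (Real.log S + y) ∂ν := by
  refine ⟨convex_Ioi 0, fun S hS T hT a b ha hb hab => ?_⟩
  have hST : a • S + b • T ∈ Set.Ioi (0 : ℝ) := convex_Ioi 0 hS hT ha hb hab
  have hlog : ∀ R ∈ Set.Ioi (0 : ℝ), ∀ y, Real.log R + y = Real.log (Real.exp y * R) := by
    intro R hR y
    rw [Real.log_mul (Real.exp_pos y).ne' (ne_of_gt hR), Real.log_exp, add_comm]
  have hint := integrable_valueSeq (ν := ν) hd0 hd1 hK k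
  have key : ∫ y, valueSeq ν d K k (Real.log (a • S + b • T) + y) ∂ν ≤
      a * (∫ y, valueSeq ν d K k (Real.log S + y) ∂ν) +
        b * ∫ y, valueSeq ν d K k (Real.log T + y) ∂ν := by
    rw [← integral_const_mul, ← integral_const_mul,
      ← integral_add ((hint _).const_mul a) ((hint _).const_mul b)]
    refine integral_mono (hint _) (((hint _).const_mul a).add ((hint _).const_mul b)) fun y => ?_
    have hSy : Real.exp y * S ∈ Set.Ioi (0 : ℝ) := mul_pos (Real.exp_pos y) hS
    have hTy : Real.exp y * T ∈ Set.Ioi (0 : ℝ) := mul_pos (Real.exp_pos y) hT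
    have h := hk.2 hSy hTy ha hb hab
    simp only [smul_eq_mul] at h hST ⊢
    rw [hlog _ hST, hlog S hS, hlog T hT]
    refine le_trans (le_of_eq ?_) h
    ring_nf
  simp only [smul_eq_mul] at key ⊢
  nlinarith

theorem convexOn_valueSeq_log (k : ℕ) :
    ConvexOn ℝ (Set.Ioi 0) fun S => valueSeq ν d K k (Real.log S) := by
  induction k with
  | zero => exact convexOn_putPayoff_log K
  | succ k ih => exact (convexOn_putPayoff_log K).sup (convexOn_integral_log hd0 hd1 hK ih)

variable (hν : volume ≪ ν)

include hν

theorem integral_valueSeq_pos (k : ℕ) (x : ℝ) : 0 < ∫ y, valueSeq ν d K k (x + y) ∂ν := by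
  refine integral_pos_of_pos_on_Ioo hν (integrable_valueSeq hd0 hd1 hK k x)
    (fun y => valueSeq_nonneg k _) (a := Real.log K - x - 1) (b := Real.log K - x) (by linarith)
    fun y hy => ?_
  refine lt_of_lt_of_le ?_ (putPayoff_le_valueSeq k _)
  have hlt : x + y < Real.log K := by linarith [hy.2]
  rw [putPayoff_of_le hK hlt.le]
  have := (Real.lt_log_iff_exp_lt hK).mp hlt
  linarith

theorem exists_boundary (k : ℕ) : ∃ β, β < Real.log K ∧
    d * ∫ y, valueSeq ν d K k (β + y) ∂ν = K - Real.exp β ∧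
    (∀ x, x < β → d * ∫ y, valueSeq ν d K k (x + y) ∂ν < K - Real.exp x) ∧
    ∀ x, β < x → x ≤ Real.log K → K - Real.exp x < d * ∫ y, valueSeq ν d K k (x + y) ∂ν := by
  set φ : ℝ → ℝ := fun S => d * ∫ y, valueSeq ν d K k (Real.log S + y) ∂ν - (K - S) with hφ
  have hconv : ConvexOn ℝ (Set.Ioi 0) φ :=
    (convexOn_integral_log hd0 hd1 hK (convexOn_valueSeq_log hd0 hd1 hK k)).sub
      ((concaveOn_const K (convex_Ioi 0)).sub (convexOn_id (convex_Ioi 0)))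
  -- The continuation value is at most `d * K`, so `φ t ≤ t - K * (1 - d)`; half of `K * (1 - d)`
  -- leaves a strict margin.
  have hneg : ∀ t, 0 < t → t ≤ K * (1 - d) / 2 → φ t < 0 := by
    intro t _ ht2
    have := integral_valueSeq_le (ν := ν) hd0 hd1 hK k (Real.log t)
    have h3 : 0 < K * (1 - d) := mul_pos hK (by linarith)
    simp only [hφ]
    nlinarith
  have hposK : 0 < φ K := by
    have := integral_valueSeq_pos (ν := ν) hd0 hd1 hK hν k (Real.log K)
    simp only [hφ, sub_self, sub_zero]
    positivity
  obtain ⟨b, hb0, hbK, hb, hlo, hhi⟩ := exists_sign_change hconv (s := K * (1 - d) / 2)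
    (by have : 0 < K * (1 - d) := mul_pos hK (by linarith)
        linarith) (by nlinarith) hneg hposK
  have hexp : ∀ x, φ (Real.exp x) =
      d * ∫ y, valueSeq ν d K k (x + y) ∂ν - (K - Real.exp x) := fun x => by
    simp only [hφ, Real.log_exp]
  refine ⟨Real.log b, Real.log_lt_log hb0 hbK, ?_, fun x hx => ?_, fun x hx hxK => ?_⟩
  · have := hexp (Real.log b)
    rw [Real.exp_log hb0, hb] at this
    rw [Real.exp_log hb0]
    linarith
  · have := hlo (Real.exp x) (Real.exp_pos x) ((Real.lt_log_iff_exp_lt hb0).mp hx)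
    rw [hexp] at this
    linarith
  · have := hhi (Real.exp x) ((Real.log_lt_iff_lt_exp hb0).mp hx)
      ((Real.le_log_iff_exp_le hK).mp hxK)
    rw [hexp] at this
    linarith

/-- Here `β k` is the boundary for one step followed by the stage `k` value, hence the point number
`k + 1`. The decrease rests on two strict inequalities that feed each other by induction: stage `k +
1` beats stage `k` above `β k`, and therefore its continuation value is larger everywhere. -/
theorem exists_boundarySeq : ∃ xb : ℕ → ℝ, xb 0 = Real.log K ∧ StrictAnti xb ∧ ∀ k,
    d * ∫ y, valueSeq ν d K k (xb (k + 1) + y) ∂ν = K - Real.exp (xb (k + 1)) ∧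
    (∀ x, x < xb (k + 1) → d * ∫ y, valueSeq ν d K k (x + y) ∂ν < K - Real.exp x) ∧
    ∀ x, xb (k + 1) < x → x ≤ Real.log K →
      K - Real.exp x < d * ∫ y, valueSeq ν d K k (x + y) ∂ν := by
  choose β hβK hβ hlo hhi using exists_boundary (ν := ν) hd0 hd1 hK hν
  have hpay : ∀ k x, β k < x → putPayoff K x < d * ∫ y, valueSeq ν d K k (x + y) ∂ν := by
    intro k x hx
    rcases le_or_gt x (Real.log K) with h | h
    · rw [putPayoff_of_le hK h]
      exact hhi k x hx h
    · rw [putPayoff_of_ge hK h.le]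
      exact mul_pos hd0 (integral_valueSeq_pos hd0 hd1 hK hν k x)
  have hmono : ∀ k x, valueSeq ν d K k x ≤ valueSeq ν d K (k + 1) x := by
    intro k
    induction k with
    | zero => exact fun x => le_max_left _ _
    | succ k ih =>
      intro x
      refine max_le_max le_rfl (mul_le_mul_of_nonneg_left ?_ hd0.le)
      exact integral_mono (integrable_valueSeq hd0 hd1 hK k x)
        (integrable_valueSeq hd0 hd1 hK (k + 1) x) fun y => ih _
  have hint : ∀ k, (∀ x, β k < x → valueSeq ν d K k x < valueSeq ν d K (k + 1) x) → ∀ x,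
      d * ∫ y, valueSeq ν d K k (x + y) ∂ν < d * ∫ y, valueSeq ν d K (k + 1) (x + y) ∂ν := by
    intro k hk x
    refine mul_lt_mul_of_pos_left ?_ hd0
    rw [← sub_pos, ← integral_sub (integrable_valueSeq hd0 hd1 hK (k + 1) x)
      (integrable_valueSeq hd0 hd1 hK k x)]
    refine integral_pos_of_pos_on_Ioo hν
      ((integrable_valueSeq hd0 hd1 hK (k + 1) x).sub (integrable_valueSeq hd0 hd1 hK k x))
      (fun y => sub_nonneg.mpr (hmono k _)) (a := β k - x) (b := β k - x + 1) (by linarith)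
      fun y hy => sub_pos.mpr (hk _ (by linarith [hy.1]))
  have hstrict : ∀ k x, β k < x → valueSeq ν d K k x < valueSeq ν d K (k + 1) x := by
    intro k
    induction k with
    | zero => exact fun x hx => (hpay 0 x hx).trans_le (le_max_right _ _)
    | succ k ih =>
      exact fun x hx => (max_lt (hpay (k + 1) x hx) (hint k ih x)).trans_le (le_max_right _ _)
  -- At `β k` stopping equals continuing with the stage `k` value, so it is strictly worse than
  -- continuing with the stage `k + 1` value. Hence `β k` lies neither below nor at `β (k + 1)`.
  have hanti : ∀ k, β (k + 1) < β k := by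
    intro k
    by_contra hcon
    push Not at hcon
    have h1 := hint k (hstrict k) (β k)
    rw [hβ k] at h1
    rcases hcon.lt_or_eq with h | h
    · exact absurd (hlo (k + 1) (β k) h) (not_lt.mpr h1.le)
    · have := hβ (k + 1)
      rw [← h] at this
      linarith
  refine ⟨fun k => Nat.casesOn k (Real.log K) β, rfl, strictAnti_nat_of_succ_lt fun k => ?_,
    fun k => ⟨hβ k, hlo k, hhi k⟩⟩
  cases k with
  | zero => exact hβK 0
  | succ k => exact hanti k

/-- The boundary points of the put, together with the recursion for the value functions. -/
theorem exists_isValueSeq {ι : Type} [DecidableEq ι] (E : ExpFamily ι)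
    (hE : ∀ g : ℝ → ℝ, ∫ y, g y ∂ν = ∫ y, g y * E.density y) :
    ∃ xb : ℕ → ℝ, xb 0 = Real.log K ∧ IsValueSeq E xb d K (valueSeq ν d K) ∧
      ∀ k, ∀ z < xb k,
        (d * ∫ y, valueSeq ν d K k (z + y) ∂ν - putPayoff K z = 0 ↔ z = xb (k + 1)) := by
  obtain ⟨xb, h0, hanti, h⟩ := exists_boundarySeq (ν := ν) hd0 hd1 hK hν
  have hle : ∀ k, xb k ≤ Real.log K := fun k => h0 ▸ hanti.antitone (Nat.zero_le k)
  have huniq : ∀ k, ∀ z < xb k,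
      (d * ∫ y, valueSeq ν d K k (z + y) ∂ν = K - Real.exp z ↔ z = xb (k + 1)) := by
    intro k z hz
    refine ⟨fun hz0 => ?_, fun hz0 => hz0 ▸ (h k).1⟩
    rcases lt_trichotomy z (xb (k + 1)) with hlt | heq | hgt
    · exact absurd hz0 ((h k).2.1 z hlt).ne
    · exact heq
    · exact absurd hz0 ((h k).2.2 z hgt (hz.le.trans (hle k))).ne'
  refine ⟨xb, h0, ⟨hanti, measurable_valueSeq ν d K, abs_valueSeq_le hd0 hd1 hK, ?_, ?_, ?_, ?_⟩,
    fun k z hz => ?_⟩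
  · exact fun x hx => putPayoff_of_ge hK (h0 ▸ hx)
  · intro k x hx
    have hpay := putPayoff_of_le hK (hx.trans (hle k))
    cases k with
    | zero => exact hpay
    | succ k =>
      rw [← hpay]
      refine max_eq_left ?_
      rw [hpay]
      rcases hx.lt_or_eq with hlt | rfl
      · exact ((h k).2.1 x hlt).le
      · exact (h k).1.le
  · intro k x hx
    rw [← hE fun y => valueSeq ν d K k (x + y)]
    refine max_eq_right ?_
    rcases le_or_gt x (Real.log K) with hxK | hxK
    · rw [putPayoff_of_le hK hxK]
      rcases hx.lt_or_eq with hlt | rfl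
      · exact ((h k).2.2 x hlt hxK).le
      · exact (h k).1.ge
    · rw [putPayoff_of_ge hK hxK.le]
      exact (mul_pos hd0 (integral_valueSeq_pos hd0 hd1 hK hν k x)).le
  · intro k z hz
    rw [← hE fun y => valueSeq ν d K k (z + y)]
    exact huniq k z hz
  · rw [putPayoff_of_le hK (hz.le.trans (hle k)), sub_eq_zero]
    exact huniq k z hz

end ValueSeq

/-! ### The law of a mixture -/

namespace ExpMixture

variable {μ : ExpMixture} (hone : ∀ j, μ.zm j ≠ -1) (hp : NonClustering μ.cp μ.zp)
  (hm : NonClustering μ.cm μ.zm)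

theorem law_eq : μ.law =
    volume.withDensity fun x => ENNReal.ofReal ((μ.toFamily hone hp hm).density x) := by
  simp_rw [density_toFamily]
  rfl

theorem integral_law (g : ℝ → ℝ) :
    ∫ y, g y ∂μ.law = ∫ y, g y * (μ.toFamily hone hp hm).density y := by
  rw [law_eq hone hp hm, integral_withDensity_eq_integral_toReal_smul
    ((ExpFamily.measurable_density _).ennreal_ofReal)
    (Eventually.of_forall fun _ => ENNReal.ofReal_lt_top)]
  refine integral_congr_ae (Eventually.of_forall fun y => ?_)
  simp only [smul_eq_mul]
  rw [ENNReal.toReal_ofReal (ExpFamily.density_nonneg _ y), mul_comm]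

-- Testing the series for expectations with the constant `1` gives integral `∑ w p / z p = 1`.
-- Integrability follows from this value, since a non-integrable density would have integral `0`.
include hone hp hm in
theorem isProbabilityMeasure_law : IsProbabilityMeasure μ.law := by
  set E := μ.toFamily hone hp hm with hE
  have h := E.hasSum_integral_density (v := fun _ => 1) (K := 1) measurable_const (by simp) 0
  simp only [one_mul, mul_zero, Real.exp_zero, mul_one, E.integral_exp_side, mul_one_div,
    E.abs_w_div_abs_z] at h
  have h1 : ∫ y, E.density y = 1 := h.unique E.total
  have hint : Integrable E.density := by
    by_contra hcon
    rw [integral_undef hcon] at h1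
    exact zero_ne_one h1
  constructor
  rw [law_eq hone hp hm, withDensity_apply _ MeasurableSet.univ, Measure.restrict_univ,
    ← ofReal_integral_eq_lintegral_ofReal hint (Eventually.of_forall E.density_nonneg), h1,
    ENNReal.ofReal_one]

-- The index `0` exists on both sides whatever `Np` and `Nm` are, so the density is positive away
-- from the origin.
include hone hp hm in
theorem absolutelyContinuous_law : volume ≪ μ.law := by
  rw [law_eq hone hp hm]
  refine withDensity_absolutelyContinuous'
    ((ExpFamily.measurable_density _).ennreal_ofReal).aemeasurable ?_
  have h0 : ∀ᵐ y : ℝ, y ≠ 0 := by simp [ae_iff, measure_singleton]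
  filter_upwards [h0] with y hy
  rw [ne_eq, ENNReal.ofReal_eq_zero, not_le]
  rcases lt_or_gt_of_ne hy with h | h
  · exact ExpFamily.density_pos _ (p := Sum.inl ⟨0, bot_le⟩)
      (mul_neg_of_pos_of_neg (μ.zp_pos _) h)
  · exact ExpFamily.density_pos _ (p := Sum.inr ⟨0, bot_le⟩)
      (mul_neg_of_neg_of_pos (μ.zm_neg _) h)

end ExpMixture

/-! ### Independence of past and future increments -/

section IndependentIncrements

variable {Ω : Type*} [MeasurableSpace Ω] {P : Measure Ω} [IsProbabilityMeasure P]

-- Finitely many past values are partial sums of increments along one ordered grid, and the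
-- increment from `q` to `t` is the next increment of the same grid.
omit [IsProbabilityMeasure P] in
theorem indepFun_finset_increment {Y : ℝ≥0 → Ω → ℝ} (hY : HasIndepIncrements Y P)
    (hm : ∀ t, Measurable (Y t)) {q t : ℝ≥0} (hqt : q ≤ t) (I : Finset (Set.Iic q)) :
    IndepFun (fun ω (s : I) => Y (s : Set.Iic q) ω - Y 0 ω) (fun ω => Y t ω - Y q ω) P := by
  classical
  -- Including `0` makes the partial sums start at `Y 0`; including `q` makes the last grid step run
  -- exactly from `q` to `t`.
  set S : Finset ℝ≥0 := insert 0 (insert q (I.image fun s : Set.Iic q => (s : ℝ≥0))) with hS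
  have hSne : 0 ∈ S := by simp [hS]
  have hqS : q ∈ S := by simp [hS]
  have hSle : ∀ s ∈ S, s ≤ q := by
    intro s hs
    simp only [hS, Finset.mem_insert, Finset.mem_image] at hs
    rcases hs with rfl | rfl | ⟨a, _, rfl⟩
    · exact bot_le
    · exact le_rfl
    · exact a.2
  obtain ⟨n, hn⟩ : ∃ n, S.card = n + 1 :=
    ⟨S.card - 1, (Nat.succ_pred_eq_of_pos (Finset.card_pos.mpr ⟨0, hSne⟩)).symm⟩
  set e := S.orderEmbOfFin hn with he
  have hrange : ∀ s ∈ S, ∃ i, e i = s := fun s hs => by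
    have : s ∈ Set.range e := by rw [he, Finset.range_orderEmbOfFin]; exact hs
    exact this
  set τ : ℕ → ℝ≥0 := fun i => if h : i < n + 1 then e ⟨i, h⟩ else t with hτ
  have hτe : ∀ i : Fin (n + 1), τ i = e i := fun i => by
    show (if h : _ then _ else _) = _
    rw [dif_pos i.2]
  have hτmono : Monotone τ := by
    intro i j hij
    by_cases hj : j < n + 1
    · have hi : i < n + 1 := lt_of_le_of_lt hij hj
      simp only [hτ, hi, hj, dif_pos]
      exact e.monotone hij
    · by_cases hi : i < n + 1
      · simp only [hτ, hi, hj, dif_pos, dif_neg, not_false_eq_true]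
        exact (hSle _ (Finset.orderEmbOfFin_mem S hn _)).trans hqt
      · simp only [hτ, hi, hj, dif_neg, not_false_eq_true]
        exact le_rfl
  have hτ0 : τ 0 = 0 := by
    obtain ⟨i, hi⟩ := hrange 0 hSne
    have h := hτmono (Nat.zero_le (i : ℕ))
    rw [hτe i, hi] at h
    exact le_antisymm h bot_le
  have hτn : τ n = q := by
    obtain ⟨i, hi⟩ := hrange q hqS
    refine le_antisymm ?_ ?_
    · rw [show τ n = e (Fin.last n) from hτe (Fin.last n)]
      exact hSle _ (Finset.orderEmbOfFin_mem S hn _)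
    · have h := hτmono (Nat.le_of_lt_succ i.2)
      rwa [hτe i, hi] at h
  have hτn1 : τ (n + 1) = t := by simp [hτ]
  have hind := hY.nat hτmono
  have hind2 := hind.indepFun_finset (Finset.range n) {n} (by simp)
    fun i => (hm _).sub (hm _)
  have hidx : ∀ s : I, ∃ i : Fin (n + 1), e i = (s : Set.Iic q) := fun s => hrange _ (by
    simp only [hS, Finset.mem_insert, Finset.mem_image]
    exact Or.inr (Or.inr ⟨s, s.2, rfl⟩))
  choose idx hidx using hidx
  have hcomp := hind2.comp
    (φ := fun (v : Finset.range n → ℝ) (s : I) =>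
      ∑ j : Finset.range n, if (j : ℕ) < idx s then v j else 0)
    (ψ := fun (v : ({n} : Finset ℕ) → ℝ) => v ⟨n, by simp⟩)
    (by
      refine measurable_pi_lambda _ fun s => Finset.measurable_sum _ fun j _ => ?_
      split_ifs
      · exact measurable_pi_apply j
      · exact measurable_const)
    (measurable_pi_apply (X := fun _ : ({n} : Finset ℕ) => ℝ) ⟨n, by simp⟩)
  convert hcomp using 1
  · funext ω s
    simp only [Function.comp_apply]
    have h1 := Finset.sum_coe_sort (Finset.range n) fun j : ℕ =>
      if j < (idx s : ℕ) then Y (τ (j + 1)) ω - Y (τ j) ω else 0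
    rw [h1, ← Finset.sum_filter]
    have h2 : (Finset.range n).filter (fun j => j < (idx s : ℕ)) = Finset.range (idx s) := by
      ext j
      have := (idx s).2
      simp only [Finset.mem_filter, Finset.mem_range]
      omega
    rw [h2, Finset.sum_range_sub (fun j => Y (τ j) ω), hτ0, hτe, hidx]
  · funext ω
    simp [hτn, hτn1]

/-- The past of a process with independent increments that starts at `0` is independent of
its future increments. -/
theorem indepFun_past_increment {Y : ℝ≥0 → Ω → ℝ} (hY : HasIndepIncrements Y P)
    (hm : ∀ t, Measurable (Y t)) (h0 : ∀ᵐ ω ∂P, Y 0 ω = 0) {q t : ℝ≥0} (hqt : q ≤ t) :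
    IndepFun (fun ω (s : Set.Iic q) => Y s ω) (fun ω => Y t ω - Y q ω) P := by
  refine IndepFun.process_congr_left (X := fun (s : Set.Iic q) ω => Y s ω - Y 0 ω) ?_ fun s => ?_
  · exact IndepFun.process_indepFun (fun s => (hm _).sub (hm _)) ((hm _).sub (hm _))
      fun I => indepFun_finset_increment hY hm hqt I
  · filter_upwards [h0] with ω hω
    rw [hω, sub_zero]

end IndependentIncrements

/-! ### The pair of processes after a fixed time -/

section Joint

variable {Ω : Type*} [MeasurableSpace Ω] {P : Measure Ω} [IsProbabilityMeasure P]
  {X : ℝ≥0 → Ω → ℝ} {N : ℝ≥0 → Ω → ℕ} {rate : ℝ≥0}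

omit [IsProbabilityMeasure P] in
theorem IsPoissonProcess.measurable_cast (hN : IsPoissonProcess rate N P) (t : ℝ≥0) :
    Measurable fun ω => (N t ω : ℝ) :=
  measurable_from_top.comp (hN.measurable t)

/-- Independence of `X` and `N` separates the two processes, and independence of increments then
separates past from future within each. The times `s` and `p` may differ, which allows the last cell
before a jump to be treated by subtraction. -/
theorem measure_inter_natural (hX : IsLevyProcess X P) (hN : IsPoissonProcess rate N P)
    (hXN : IndepFun (fun ω t => X t ω) (fun ω t => N t ω) P) {q s p : ℝ≥0} (hqs : q ≤ s)
    (hqp : q ≤ p) {A : Set Ω}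
    (hA : MeasurableSet[⨆ s ≤ q, MeasurableSpace.comap (X s) inferInstance ⊔
      MeasurableSpace.comap (N s) inferInstance] A) {B : Set ℝ} (hB : MeasurableSet B) :
    P (A ∩ ({ω | X s ω - X q ω ∈ B} ∩ {ω | N p ω = N q ω})) =
      P A * (P {ω | X s ω - X q ω ∈ B} * P {ω | N p ω = N q ω}) := by
  set Xp : Ω → Set.Iic q → ℝ := fun ω u => X u ω with hXp
  set Np : Ω → Set.Iic q → ℝ := fun ω u => (N u ω : ℝ) with hNp
  have hXpm : Measurable Xp := measurable_pi_lambda _ fun u => hX.measurable _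
  have hNpm : Measurable Np := measurable_pi_lambda _ fun u => hN.measurable_cast _
  set R := {ω | X s ω - X q ω ∈ B} with hR
  set E := {ω | N p ω = N q ω} with hE
  have hRm : MeasurableSet R := ((hX.measurable s).sub (hX.measurable q)) hB
  have hEm : MeasurableSet E := measurableSet_eq_fun (hN.measurable p) (hN.measurable q)
  have hXind : IndepFun Xp (fun ω => X s ω - X q ω) P :=
    indepFun_past_increment hX.indep hX.measurable hX.zero hqs
  have hNind : IndepFun Np (fun ω => (N p ω : ℝ) - N q ω) P :=
    indepFun_past_increment hN.indep hN.measurable_cast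
      (by filter_upwards [hN.zero] with ω hω; rw [hω, Nat.cast_zero]) hqp
  have hE' : E = (fun ω => (N p ω : ℝ) - N q ω) ⁻¹' {0} := by
    ext ω
    simp [hE, sub_eq_zero]
  have hjoint : IndepFun (fun ω => (Xp ω, X s ω - X q ω))
      (fun ω => (Np ω, (N p ω : ℝ) - N q ω)) P := by
    refine hXN.comp (φ := fun x : ℝ≥0 → ℝ => ((fun u : Set.Iic q => x u), x s - x q))
      (ψ := fun x : ℝ≥0 → ℕ => ((fun u : Set.Iic q => (x u : ℝ)), (x p : ℝ) - x q)) ?_ ?_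
    · fun_prop
    · have h : ∀ u : ℝ≥0, Measurable fun x : ℝ≥0 → ℕ => (x u : ℝ) := fun u =>
        measurable_from_top.comp (measurable_pi_apply u)
      exact (measurable_pi_lambda (fun (x : ℝ≥0 → ℕ) (u : Set.Iic q) => (x u : ℝ))
        fun u => h u).prodMk ((h p).sub (h q))
  -- Past events may involve both processes; equality of finite measures on rectangles extends the
  -- product formula to all of them.
  have hmeas : (P.restrict (R ∩ E)).map (fun ω => (Xp ω, Np ω)) =
      (P R * P E) • P.map fun ω => (Xp ω, Np ω) := by
    have hfin : IsFiniteMeasure ((P R * P E) • P.map fun ω => (Xp ω, Np ω)) :=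
      Measure.smul_finite _ (ENNReal.mul_ne_top (measure_ne_top _ _) (measure_ne_top _ _))
    refine Measure.ext_prod ?_
    intro A1 A2 hA1 hA2
    have hpre : (fun ω => (Xp ω, Np ω)) ⁻¹' (A1 ×ˢ A2) = Xp ⁻¹' A1 ∩ Np ⁻¹' A2 := rfl
    rw [Measure.map_apply (hXpm.prodMk hNpm) (hA1.prod hA2), Measure.smul_apply,
      Measure.map_apply (hXpm.prodMk hNpm) (hA1.prod hA2), hpre,
      Measure.restrict_apply ((hXpm hA1).inter (hNpm hA2)), smul_eq_mul]
    have h1 := hjoint.measure_inter_preimage_eq_mul (A1 ×ˢ B) (A2 ×ˢ {0}) (hA1.prod hB)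
      (hA2.prod (measurableSet_singleton 0))
    have h2 := hjoint.measure_inter_preimage_eq_mul (A1 ×ˢ Set.univ) (A2 ×ˢ Set.univ)
      (hA1.prod MeasurableSet.univ) (hA2.prod MeasurableSet.univ)
    have h3 := hXind.measure_inter_preimage_eq_mul A1 B hA1 hB
    have h4 := hNind.measure_inter_preimage_eq_mul A2 {0} hA2 (measurableSet_singleton 0)
    rw [← hE'] at h4
    have e1 : (fun ω => (Xp ω, X s ω - X q ω)) ⁻¹' (A1 ×ˢ B) = Xp ⁻¹' A1 ∩ R := rfl
    have e2 : (fun ω => (Np ω, (N p ω : ℝ) - N q ω)) ⁻¹' (A2 ×ˢ {0}) = Np ⁻¹' A2 ∩ E := by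
      rw [hE']; rfl
    have e3 : (fun ω => (Xp ω, X s ω - X q ω)) ⁻¹' (A1 ×ˢ Set.univ) = Xp ⁻¹' A1 := by
      ext; simp
    have e4 : (fun ω => (Np ω, (N p ω : ℝ) - N q ω)) ⁻¹' (A2 ×ˢ Set.univ) = Np ⁻¹' A2 := by
      ext; simp
    rw [e1, e2] at h1
    rw [e3, e4] at h2
    change P (Xp ⁻¹' A1 ∩ R) = P (Xp ⁻¹' A1) * P R at h3
    have e5 : Xp ⁻¹' A1 ∩ Np ⁻¹' A2 ∩ (R ∩ E) = Xp ⁻¹' A1 ∩ R ∩ (Np ⁻¹' A2 ∩ E) := by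
      ext; simp only [Set.mem_inter_iff]; tauto
    rw [e5, h1, h2, h3, h4]
    ring
  have hle : (⨆ s ≤ q, MeasurableSpace.comap (X s) inferInstance ⊔
      MeasurableSpace.comap (N s) inferInstance) ≤
      MeasurableSpace.comap (fun ω => (Xp ω, Np ω)) inferInstance := by
    refine iSup₂_le fun u hu => sup_le ?_ ?_
    · rintro _ ⟨C, hC, rfl⟩
      exact ⟨{v | v.1 ⟨u, hu⟩ ∈ C}, (measurable_pi_apply (⟨u, hu⟩ : Set.Iic q)).comp measurable_fst
        hC, rfl⟩
    · rintro _ ⟨C, _, rfl⟩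
      refine ⟨{v | v.2 ⟨u, hu⟩ ∈ (Nat.cast : ℕ → ℝ) '' C},
        (measurable_pi_apply (⟨u, hu⟩ : Set.Iic q)).comp measurable_snd
          (C.to_countable.image _).measurableSet, ?_⟩
      ext ω
      simp [hNp]
  obtain ⟨C, hC, rfl⟩ := hle _ hA
  have h := congrArg (fun m => m C) hmeas
  simp only [Measure.smul_apply, smul_eq_mul] at h
  rw [Measure.map_apply (hXpm.prodMk hNpm) hC, Measure.map_apply (hXpm.prodMk hNpm) hC,
    Measure.restrict_apply (hXpm.prodMk hNpm hC)] at h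
  rw [h]
  ring

omit [IsProbabilityMeasure P] in
/-- Events in the augmented past agree almost surely with events in the raw past. -/
theorem augmentedFiltration_le (hX : ∀ t, Measurable (X t)) (hN : ∀ t, Measurable (N t))
    (q : ℝ≥0) : (augmentedFiltration P hX hN q) ≤
      @eventuallyMeasurableSpace Ω (⨆ s ≤ q, MeasurableSpace.comap (X s) inferInstance ⊔
        MeasurableSpace.comap (N s) inferInstance) (ae P) _ := by
  refine sup_le (@le_eventuallyMeasurableSpace Ω (⨆ s ≤ q, MeasurableSpace.comap (X s) inferInstance ⊔
    MeasurableSpace.comap (N s) inferInstance) (ae P) _) ?_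
  refine MeasurableSpace.generateFrom_le fun A hA => ?_
  exact ⟨∅, @MeasurableSet.empty _ (⨆ s ≤ q, MeasurableSpace.comap (X s) inferInstance ⊔
    MeasurableSpace.comap (N s) inferInstance), ae_eq_empty.mpr hA.2⟩

theorem measure_inter_augmented (hX : IsLevyProcess X P) (hN : IsPoissonProcess rate N P)
    (hXN : IndepFun (fun ω t => X t ω) (fun ω t => N t ω) P) {q s p : ℝ≥0} (hqs : q ≤ s)
    (hqp : q ≤ p) {A : Set Ω}
    (hA : MeasurableSet[augmentedFiltration P hX.measurable hN.measurable q] A)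
    {B : Set ℝ} (hB : MeasurableSet B) :
    P (A ∩ ({ω | X s ω - X q ω ∈ B} ∩ {ω | N p ω = N q ω})) =
      P A * (P {ω | X s ω - X q ω ∈ B} * P {ω | N p ω = N q ω}) := by
  obtain ⟨A', hA', hAA'⟩ := augmentedFiltration_le hX.measurable hN.measurable q A hA
  have hc : (A ∩ ({ω | X s ω - X q ω ∈ B} ∩ {ω | N p ω = N q ω}) : Set Ω) =ᵐ[P]
      (A' ∩ ({ω | X s ω - X q ω ∈ B} ∩ {ω | N p ω = N q ω}) : Set Ω) :=
    ae_eq_set_inter hAA' (ae_eq_refl _)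
  rw [measure_congr hc, measure_congr hAA']
  exact measure_inter_natural hX hN hXN hqs hqp hA' hB

omit [IsProbabilityMeasure P] in
theorem IsPoissonProcess.measure_eq (hN : IsPoissonProcess rate N P) {q p : ℝ≥0} (hqp : q ≤ p) :
    P {ω | N p ω = N q ω} = ENNReal.ofReal (Real.exp (-(rate * (p - q : ℝ)))) := by
  have h : {ω | N p ω = N q ω} = (fun ω => N p ω - N q ω) ⁻¹' {0} := by
    ext ω
    have := hN.mono ω hqp
    simp only [Set.mem_ofPred_eq, Set.mem_preimage, Set.mem_singleton_iff] at this ⊢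
    omega
  rw [h, ← Measure.map_apply (show Measurable fun ω => N p ω - N q ω from
      (hN.measurable p).sub (hN.measurable q)) (measurableSet_singleton 0),
    hN.law q p hqp, poissonMeasure_singleton]
  congr 1
  simp [NNReal.coe_sub hqp]

omit [IsProbabilityMeasure P] in
theorem IsLevyProcess.measure_increment (hX : IsLevyProcess X P) (q p : ℝ≥0) {B : Set ℝ}
    (hB : MeasurableSet B) : P {ω | X (q + p) ω - X q ω ∈ B} = P {ω | X p ω ∈ B} := by
  have h := congrArg (fun m => m B) (hX.stationary q p)
  rw [Measure.map_apply (show Measurable fun ω => X (q + p) ω - X q ω from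
      (hX.measurable _).sub (hX.measurable _)) hB,
    Measure.map_apply (hX.measurable _) hB] at h
  exact h

end Joint

/-! ### Jump times of the Poisson process -/

section JumpTimes

variable {Ω : Type*} [MeasurableSpace Ω] {P : Measure Ω}
  {X : ℝ≥0 → Ω → ℝ} {N : ℝ≥0 → Ω → ℕ} {rate : ℝ≥0}

/-- An integer-valued right-continuous path is constant just after each time, so the infimum
defining the jump time is attained. -/
theorem jumpTime_le_iff (hN : IsPoissonProcess rate N P) {j : ℕ} {ω : Ω} {t : ℝ≥0}
    (h : ∃ s, j ≤ N s ω) : jumpTime N j ω ≤ t ↔ j ≤ N t ω := by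
  refine ⟨fun hle => ?_, fun hj => csInf_le' hj⟩
  refine le_trans ?_ (hN.mono ω hle)
  by_contra hcon
  push Not at hcon
  set T := jumpTime N j ω with hT
  have hc := hN.right_cont ω T
  have hev : ∀ᶠ s in 𝓝[≥] T, N s ω = N T ω := by
    exact hc ((isOpen_discrete {N T ω}).mem_nhds rfl)
  obtain ⟨u, hu, hsub⟩ := (mem_nhdsGE_iff_exists_Ico_subset (a := T)).mp hev
  have hlb : u ≤ T := by
    refine le_csInf h fun s hs => ?_
    by_contra hsu
    push Not at hsu
    have hTs : T ≤ s := csInf_le' hs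
    have h1 : N s ω = N T ω := hsub ⟨hTs, hsu⟩
    have h2 : j ≤ N s ω := hs
    omega
  exact absurd hu (not_lt.mpr hlb)

/-- The infimum of the empty set is `0`, so a level that is never reached has jump time `0`. These
paths form the second event, which is null but has to be carried along for measurability. -/
theorem setOf_jumpTime_le (hN : IsPoissonProcess rate N P) (j : ℕ) (t : ℝ≥0) :
    {ω | jumpTime N j ω ≤ t} = {ω | j ≤ N t ω} ∪ {ω | ∀ i : ℕ, N i ω < j} := by
  ext ω
  simp only [Set.mem_ofPred_eq, Set.mem_union]
  by_cases h : ∃ s, j ≤ N s ω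
  · rw [jumpTime_le_iff hN h]
    obtain ⟨s, hs⟩ := h
    obtain ⟨i, hi⟩ := exists_nat_ge s
    have : ¬ ∀ i : ℕ, N i ω < j := fun hcon =>
      absurd (hcon i) (not_lt.mpr (hs.trans (hN.mono ω hi)))
    simp [this]
  · push Not at h
    have h0 : jumpTime N j ω = 0 := by
      have : {t | j ≤ N t ω} = ∅ := Set.eq_empty_of_forall_notMem fun s hs =>
        absurd (h s) (not_lt.mpr hs)
      rw [jumpTime, this, NNReal.sInf_empty]
    rw [h0]
    exact ⟨fun _ => Or.inr fun i => h i, fun _ => bot_le⟩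

theorem IsPoissonProcess.measure_lt_le (hN : IsPoissonProcess rate N P) (j i : ℕ) :
    P {ω | ∀ i : ℕ, N i ω < j} ≤ poissonMeasure (rate * i) (Finset.range j : Set ℕ) := by
  have h := hN.law 0 i bot_le
  rw [tsub_zero] at h
  rw [← h, Measure.map_apply (show Measurable fun ω => N i ω - N 0 ω from
    (hN.measurable _).sub (hN.measurable _)) (Set.to_countable _).measurableSet]
  refine measure_mono fun ω hω => ?_
  have := hω i
  simp only [Set.mem_preimage, Finset.coe_range, Set.mem_Iio]
  omega

theorem tendsto_poissonMeasure_range (hrate : 0 < rate) (j : ℕ) :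
    Tendsto (fun i : ℕ => poissonMeasure (rate * i) (Finset.range j : Set ℕ)) atTop (𝓝 0) := by
  have h1 : ∀ i : ℕ, poissonMeasure (rate * i) (Finset.range j : Set ℕ) =
      ∑ k ∈ Finset.range j, poissonMeasure (rate * i) {k} := fun i => by
    rw [sum_measure_singleton]
  simp_rw [h1, poissonMeasure_singleton]
  rw [show (0 : ℝ≥0∞) = ∑ k ∈ Finset.range j, ENNReal.ofReal 0 by simp]
  refine tendsto_finsetSum _ fun k _ => ENNReal.tendsto_ofReal ?_
  have h2 : Tendsto (fun i : ℕ => ((rate * i : ℝ≥0) : ℝ)) atTop atTop := by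
    push_cast
    exact tendsto_natCast_atTop_atTop.const_mul_atTop (by exact_mod_cast hrate)
  have h3 := ((Real.tendsto_pow_mul_exp_neg_atTop_nhds_zero k).comp h2).div_const (k.factorial : ℝ)
  rw [zero_div] at h3
  refine h3.congr fun i => ?_
  simp only [Function.comp_apply]
  rw [mul_comm]

theorem IsPoissonProcess.measure_forall_lt (hN : IsPoissonProcess rate N P) (hrate : 0 < rate)
    (j : ℕ) : P {ω | ∀ i : ℕ, N i ω < j} = 0 :=
  le_antisymm (ge_of_tendsto' (tendsto_poissonMeasure_range hrate j) (hN.measure_lt_le j)) bot_le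

theorem IsPoissonProcess.ae_exists_le (hN : IsPoissonProcess rate N P) (hrate : 0 < rate) :
    ∀ᵐ ω ∂P, ∀ j, ∃ s, j ≤ N s ω := by
  rw [ae_all_iff]
  intro j
  rw [ae_iff]
  refine measure_mono_null ?_ (hN.measure_forall_lt hrate j)
  intro ω hω
  simp only [Set.mem_ofPred_eq, not_exists, not_le] at hω ⊢
  exact fun i => hω i

theorem measurableSet_augmentedFiltration_of_null (hX : ∀ t, Measurable (X t))
    (hN : ∀ t, Measurable (N t)) (t : ℝ≥0) {A : Set Ω} (hA : MeasurableSet A) (h0 : P A = 0) :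
    MeasurableSet[augmentedFiltration P hX hN t] A :=
  (le_sup_right : _ ≤ augmentedFiltration P hX hN t) A
    (MeasurableSpace.measurableSet_generateFrom ⟨hA, h0⟩)

theorem measurable_augmentedFiltration_left (hX : ∀ t, Measurable (X t))
    (hN : ∀ t, Measurable (N t)) {s t : ℝ≥0} (hst : s ≤ t) :
    Measurable[augmentedFiltration P hX hN t] (X s) := by
  refine measurable_iff_comap_le.mpr (le_trans ?_ (le_sup_left (b :=
    MeasurableSpace.generateFrom {A | MeasurableSet A ∧ P A = 0})))
  exact le_trans le_sup_left (le_iSup₂ (f := fun s (_ : s ≤ t) =>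
    MeasurableSpace.comap (X s) inferInstance ⊔ MeasurableSpace.comap (N s) inferInstance) s hst)

theorem measurable_augmentedFiltration_right (hX : ∀ t, Measurable (X t))
    (hN : ∀ t, Measurable (N t)) {s t : ℝ≥0} (hst : s ≤ t) :
    Measurable[augmentedFiltration P hX hN t] (N s) := by
  refine measurable_iff_comap_le.mpr (le_trans ?_ (le_sup_left (b :=
    MeasurableSpace.generateFrom {A | MeasurableSet A ∧ P A = 0})))
  exact le_trans le_sup_right (le_iSup₂ (f := fun s (_ : s ≤ t) =>
    MeasurableSpace.comap (X s) inferInstance ⊔ MeasurableSpace.comap (N s) inferInstance) s hst)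

theorem measurableSet_jumpTime_le (hX : ∀ t, Measurable (X t)) (hN : IsPoissonProcess rate N P)
    (hrate : 0 < rate) (j : ℕ) (t : ℝ≥0) :
    MeasurableSet[augmentedFiltration P hX hN.measurable t] {ω | jumpTime N j ω ≤ t} := by
  rw [setOf_jumpTime_le hN]
  refine MeasurableSet.union ?_ ?_
  · exact (measurable_augmentedFiltration_right hX hN.measurable le_rfl) measurableSet_Ici
  · refine measurableSet_augmentedFiltration_of_null hX hN.measurable t ?_
      (hN.measure_forall_lt hrate j)
    rw [Set.ofPred_forall]
    exact MeasurableSet.iInter fun i => hN.measurable i measurableSet_Iio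

theorem isStoppingTime_jumpTime (hX : ∀ t, Measurable (X t)) (hN : IsPoissonProcess rate N P)
    (hrate : 0 < rate) (j : ℕ) :
    IsStoppingTime (enlargedFiltration P hX hN.measurable)
      fun ω => (jumpTime N j ω : WithTop ℝ≥0) := fun t => by
  simp only [WithTop.coe_le_coe]
  exact Filtration.le_rightCont _ t _ (measurableSet_jumpTime_le hX hN hrate j t)

theorem measurableSet_enlargedFiltration_iff (hX : ∀ t, Measurable (X t))
    (hN : ∀ t, Measurable (N t)) {t : ℝ≥0} {A : Set Ω} :
    MeasurableSet[enlargedFiltration P hX hN t] A ↔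
      ∀ u > t, MeasurableSet[augmentedFiltration P hX hN u] A := by
  rw [enlargedFiltration, Filtration.rightCont_eq]
  simp only [MeasurableSpace.measurableSet_iInf]

theorem measurable_jumpTime (hX : ∀ t, Measurable (X t)) (hN : IsPoissonProcess rate N P)
    (hrate : 0 < rate) (j : ℕ) : Measurable (jumpTime N j) :=
  measurable_of_Iic fun t => (augmentedFiltration P hX hN.measurable).le t _
    (measurableSet_jumpTime_le hX hN hrate j t)

/-- The probability is `1 - exp (-l) * (1 + l)`; the bound follows from `exp (-l) ≥ 1 - l`. -/
theorem poissonMeasure_two_le (l : ℝ≥0) :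
    poissonMeasure l {k | 2 ≤ k} ≤ ENNReal.ofReal ((l : ℝ) ^ 2) := by
  have h1 : ({k | 2 ≤ k} : Set ℕ) = ({0, 1} : Set ℕ)ᶜ := by
    ext k
    simp only [Set.mem_ofPred_eq, Set.mem_compl_iff, Set.mem_insert_iff, Set.mem_singleton_iff]
    omega
  have hl : (0 : ℝ) ≤ l := l.2
  rw [h1, prob_compl_eq_one_sub (Set.to_countable _).measurableSet,
    show ({0, 1} : Set ℕ) = {0} ∪ {1} from rfl,
    measure_union (by simp) (measurableSet_singleton 1), poissonMeasure_singleton,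
    poissonMeasure_singleton, ← ENNReal.ofReal_add (by positivity) (by positivity),
    ← ENNReal.ofReal_one, ← ENNReal.ofReal_sub _ (by positivity)]
  refine ENNReal.ofReal_le_ofReal ?_
  have h2 := Real.add_one_le_exp (-(l : ℝ))
  simp only [pow_zero, mul_one, Nat.factorial_zero, Nat.cast_one, div_one, pow_one,
    Nat.factorial_one]
  nlinarith

/-- There are almost surely no double jumps. -/
theorem IsPoissonProcess.ae_no_double_jump (hN : IsPoissonProcess rate N P) (L : ℕ) :
    P {ω | ∀ M : ℕ, 1 ≤ M → ∃ a < L * M, N (a / M : ℝ≥0) ω + 2 ≤ N ((a + 1) / M : ℝ≥0) ω} = 0 := by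
  -- A union bound over `L * M` cells of length `1 / M`, each with two jumps with probability at
  -- most `(rate / M) ^ 2`.
  have hb : ∀ M : ℕ, 1 ≤ M → P {ω | ∀ M : ℕ, 1 ≤ M → ∃ a < L * M,
      N (a / M : ℝ≥0) ω + 2 ≤ N ((a + 1) / M : ℝ≥0) ω} ≤
      ENNReal.ofReal (L * rate ^ 2 * (1 / M)) := by
    intro M hM
    have hM0 : (M : ℝ≥0) ≠ 0 := by positivity
    calc _ ≤ P (⋃ a ∈ Finset.range (L * M),
          {ω | N (a / M : ℝ≥0) ω + 2 ≤ N ((a + 1) / M : ℝ≥0) ω}) := by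
            refine measure_mono fun ω hω => ?_
            obtain ⟨a, ha, h⟩ := hω M hM
            simp only [Set.mem_iUnion, Finset.mem_range]
            exact ⟨a, ha, h⟩
      _ ≤ ∑ a ∈ Finset.range (L * M), P {ω | N (a / M : ℝ≥0) ω + 2 ≤ N ((a + 1) / M : ℝ≥0) ω} :=
            measure_biUnion_finset_le _ _
      _ ≤ ∑ a ∈ Finset.range (L * M), ENNReal.ofReal ((rate / M) ^ 2) := by
            refine Finset.sum_le_sum fun a _ => ?_
            have hle : (a / M : ℝ≥0) ≤ (a + 1) / M := by gcongr; exact le_self_add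
            have hlaw := hN.law _ _ hle
            have hd : ((a + 1) / M - a / M : ℝ≥0) = 1 / M := by
              rw [add_div, add_tsub_cancel_left]
            rw [hd, mul_one_div] at hlaw
            have h2 := poissonMeasure_two_le (rate / M)
            rw [← hlaw, Measure.map_apply (show Measurable fun ω =>
              N ((a + 1) / M : ℝ≥0) ω - N (a / M : ℝ≥0) ω from
              (hN.measurable _).sub (hN.measurable _)) (Set.to_countable _).measurableSet] at h2
            push_cast at h2
            refine le_trans (measure_mono fun ω hω => ?_) h2
            simp only [Set.mem_ofPred_eq, Set.mem_preimage] at hω ⊢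
            omega
      _ = _ := by
            rw [Finset.sum_const, Finset.card_range, nsmul_eq_mul, ← ENNReal.ofReal_natCast,
              ← ENNReal.ofReal_mul (by positivity)]
            congr 1
            have : (M : ℝ) ≠ 0 := by positivity
            push_cast
            field_simp
  have hlim : Tendsto (fun M : ℕ => ENNReal.ofReal (L * rate ^ 2 * (1 / M))) atTop (𝓝 0) := by
    rw [← ENNReal.ofReal_zero]
    refine ENNReal.tendsto_ofReal ?_
    simpa using (tendsto_one_div_atTop_nhds_zero_nat (𝕜 := ℝ)).const_mul ((L : ℝ) * rate ^ 2)
  refine le_antisymm (ge_of_tendsto hlim ?_) bot_le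
  filter_upwards [eventually_ge_atTop 1] with M hM using hb M hM

/-- Almost surely the `j`-th jump time is the first time at which the process equals `j`. -/
theorem IsPoissonProcess.ae_apply_jumpTime (hN : IsPoissonProcess rate N P) (hrate : 0 < rate) :
    ∀ᵐ ω ∂P, (∀ j, ∃ s, j ≤ N s ω) ∧ ∀ j, N (jumpTime N j ω) ω = j := by
  have hdj : ∀ᵐ ω ∂P, ∀ L : ℕ, ¬ ∀ M : ℕ, 1 ≤ M → ∃ a < L * M,
      N (a / M : ℝ≥0) ω + 2 ≤ N ((a + 1) / M : ℝ≥0) ω := by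
    rw [ae_all_iff]
    intro L
    rw [ae_iff]
    simpa only [not_not] using hN.ae_no_double_jump L
  filter_upwards [hN.ae_exists_le hrate, hdj, hN.zero] with ω hω hd h0
  refine ⟨hω, fun j => le_antisymm ?_ ((jumpTime_le_iff hN (hω j)).mp le_rfl)⟩
  by_contra hcon
  push Not at hcon
  set T := jumpTime N j ω with hT
  have hTpos : 0 < T := by
    rw [pos_iff_ne_zero]
    intro hz
    rw [hz, h0] at hcon
    omega
  obtain ⟨L, hL⟩ := exists_nat_ge T
  -- If `N` exceeded `j` at `T`, then for every `M` the cell ending at `⌈T * M⌉₊ / M` would gain at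
  -- least two: it starts strictly before `T`, where `N < j`, and ends at or after `T`.
  refine hd L fun M hM => ?_
  have hM0 : (0 : ℝ≥0) < M := by exact_mod_cast hM
  have hc : 0 < ⌈T * M⌉₊ := Nat.ceil_pos.mpr (mul_pos hTpos hM0)
  have h1 : T * M ≤ ⌈T * M⌉₊ := Nat.le_ceil _
  have h2 : ((⌈T * M⌉₊ - 1 : ℕ) : ℝ≥0) < T * M := Nat.lt_ceil.mp (by omega)
  have h3 : ⌈T * M⌉₊ ≤ L * M := Nat.ceil_le.mpr (by push_cast; gcongr)
  refine ⟨⌈T * M⌉₊ - 1, by omega, ?_⟩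
  have h4 : N (((⌈T * M⌉₊ - 1 : ℕ) : ℝ≥0) / M) ω < j := by
    by_contra h
    push Not at h
    have := (jumpTime_le_iff hN (hω j)).mpr h
    rw [← hT, le_div_iff₀ hM0] at this
    exact absurd h2 (not_lt.mpr this)
  have h5 : T ≤ (((⌈T * M⌉₊ - 1 : ℕ) : ℝ≥0) + 1) / M := by
    rw [le_div_iff₀ hM0]
    refine h1.trans (le_of_eq ?_)
    have : ((⌈T * M⌉₊ - 1 : ℕ) : ℝ≥0) + 1 = ((⌈T * M⌉₊ - 1 + 1 : ℕ) : ℝ≥0) := by push_cast; rfl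
    rw [this, Nat.sub_add_cancel hc]
  have h6 := hN.mono ω h5
  simp only at h6
  omega

theorem jumpTime_mono (hN : IsPoissonProcess rate N P) {ω : Ω} (hω : ∀ j, ∃ s, j ≤ N s ω) :
    Monotone fun j => jumpTime N j ω := fun i j hij => by
  refine (jumpTime_le_iff hN (hω i)).mpr (hij.trans ?_)
  exact (jumpTime_le_iff hN (hω j)).mp le_rfl

theorem jumpTime_strictMono (hN : IsPoissonProcess rate N P) {ω : Ω} (hω : ∀ j, ∃ s, j ≤ N s ω)
    (h : ∀ j, N (jumpTime N j ω) ω = j) : StrictMono fun j => jumpTime N j ω := by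
  refine (jumpTime_mono hN hω).strictMono_of_injective fun i j hij => ?_
  have := congrArg (fun t => N t ω) hij
  simpa only [h] using this

end JumpTimes

/-! ### Discretization in time -/

section Discretization

variable {Ω : Type*} [m : MeasurableSpace Ω]

theorem measurable_apply_of_countable {ι κ β : Type*} [MeasurableSpace β] [MeasurableSpace κ]
    [Countable κ] [MeasurableSingletonClass κ]
    {Y : ι → Ω → β} (hY : ∀ t, Measurable (Y t)) (g : κ → ι) {a : Ω → κ} (ha : Measurable a) :
    Measurable fun ω => Y (g (a ω)) ω :=
  (measurable_from_prod_countable_right (f := fun p : κ × Ω => Y (g p.1) p.2)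
    fun k => hY (g k)).comp (ha.prodMk measurable_id)

/-- Right continuity along a sequence of times approaching from above. -/
theorem tendsto_apply_of_le_of_le {β : Type*} [TopologicalSpace β] {x : ℝ≥0 → β} {t : ℝ≥0}
    (hx : ContinuousWithinAt x (Set.Ici t) t) {s : ℕ → ℝ≥0}
    (hs : ∀ᶠ M in atTop, t ≤ s M ∧ s M ≤ t + 1 / ((M : ℝ≥0) + 1)) :
    Tendsto (fun M => x (s M)) atTop (𝓝 (x t)) := by
  refine Tendsto.comp hx (tendsto_nhdsWithin_iff.mpr ⟨?_, hs.mono fun M h => h.1⟩)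
  have h0 : Tendsto (fun M : ℕ => t + 1 / ((M : ℝ≥0) + 1)) atTop (𝓝 (t + 0)) := by
    refine tendsto_const_nhds.add ?_
    rw [← NNReal.tendsto_coe]
    push_cast
    exact tendsto_one_div_add_atTop_nhds_zero_nat
  rw [add_zero] at h0
  exact tendsto_of_tendsto_of_tendsto_of_le_of_le' tendsto_const_nhds h0
    (hs.mono fun M h => h.1) (hs.mono fun M h => h.2)

/-- The index of the first grid cell of mesh `δ`, counted from the grid point after time `T`, in
which the counting process moves. -/
noncomputable def nextCell (N : ℝ≥0 → Ω → ℕ) (T : Ω → ℝ≥0) (δ : ℝ≥0) (ω : Ω) : ℕ :=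
  sInf {b : ℕ | N ((⌊T ω / δ⌋₊ + 1 + b + 1 : ℕ) * δ) ω ≠ N ((⌊T ω / δ⌋₊ + 1 : ℕ) * δ) ω}

theorem Nat.lt_sInf_iff {S : Set ℕ} {b : ℕ} : b < sInf S ↔ S.Nonempty ∧ ∀ c ≤ b, c ∉ S := by
  constructor
  · intro h
    refine ⟨Nat.nonempty_of_pos_sInf (by omega), fun c hc => Nat.notMem_of_lt_sInf (by omega)⟩
  · rintro ⟨hne, h⟩
    by_contra hcon
    exact h _ (not_lt.mp hcon) (Nat.sInf_mem hne)

theorem measurable_floor_div {T : Ω → ℝ≥0} (hT : Measurable T) (δ : ℝ≥0) :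
    Measurable fun ω => ⌊T ω / δ⌋₊ :=
  Nat.measurable_floor.comp (hT.div_const δ)

theorem measurable_nextCell {N : ℝ≥0 → Ω → ℕ} (hN : ∀ t, Measurable (N t)) {T : Ω → ℝ≥0}
    (hT : Measurable T) (δ : ℝ≥0) : Measurable (nextCell N T δ) := by
  have hR : ∀ b : ℕ, MeasurableSet
      {ω | N ((⌊T ω / δ⌋₊ + 1 + b + 1 : ℕ) * δ) ω ≠ N ((⌊T ω / δ⌋₊ + 1 : ℕ) * δ) ω} := fun b =>
    (measurableSet_eq_fun
      (measurable_apply_of_countable hN (fun a : ℕ => ((a + 1 + b + 1 : ℕ) : ℝ≥0) * δ)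
        (measurable_floor_div hT δ))
      (measurable_apply_of_countable hN (fun a : ℕ => ((a + 1 : ℕ) : ℝ≥0) * δ)
        (measurable_floor_div hT δ))).compl
  refine measurable_of_Ioi fun b => ?_
  have : nextCell N T δ ⁻¹' Set.Ioi b = (⋃ c : ℕ, {ω | N ((⌊T ω / δ⌋₊ + 1 + c + 1 : ℕ) * δ) ω ≠
      N ((⌊T ω / δ⌋₊ + 1 : ℕ) * δ) ω}) ∩ ⋂ c : ℕ, ⋂ _ : c ≤ b,
      {ω | N ((⌊T ω / δ⌋₊ + 1 + c + 1 : ℕ) * δ) ω ≠ N ((⌊T ω / δ⌋₊ + 1 : ℕ) * δ) ω}ᶜ := by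
    ext ω
    simp only [Set.mem_preimage, Set.mem_Ioi, nextCell, Nat.lt_sInf_iff, Set.mem_inter_iff,
      Set.mem_iUnion, Set.mem_iInter, Set.mem_compl_iff]
    rfl
  rw [this]
  exact (MeasurableSet.iUnion hR).inter
    (MeasurableSet.iInter fun c => MeasurableSet.iInter fun _ => (hR c).compl)

-- By monotonicity, having not moved after `b` cells and having moved after `b + 1` determines the
-- first cell of movement. Unboundedness of the path rules out the default value `0` of the infimum
-- of an empty set.
omit m in
theorem nextCell_eq_iff {N : ℝ≥0 → Ω → ℕ} {ω : Ω} (hmono : Monotone fun t => N t ω)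
    {T : Ω → ℝ≥0} {δ : ℝ≥0} (hδ : 0 < δ) (hω : ∀ j, ∃ s, j ≤ N s ω) {a b : ℕ}
    (ha : ⌊T ω / δ⌋₊ = a) : nextCell N T δ ω = b ↔
      N ((a + 1 + b : ℕ) * δ) ω = N ((a + 1 : ℕ) * δ) ω ∧
        N ((a + 1 + b + 1 : ℕ) * δ) ω ≠ N ((a + 1 : ℕ) * δ) ω := by
  subst ha
  set q : ℕ := ⌊T ω / δ⌋₊ + 1 with hq
  set S : Set ℕ := {b : ℕ | N ((q + b + 1 : ℕ) * δ) ω ≠ N ((q : ℕ) * δ) ω} with hS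
  have hm : ∀ {b c : ℕ}, b ≤ c → N ((b : ℕ) * δ) ω ≤ N ((c : ℕ) * δ) ω := fun h =>
    hmono (by gcongr)
  have hne : S.Nonempty := by
    obtain ⟨s, hs⟩ := hω (N ((q : ℕ) * δ) ω + 1)
    obtain ⟨c, hc⟩ := exists_nat_ge (s / δ)
    rw [div_le_iff₀ hδ] at hc
    have h1 := hmono hc
    have h2 : N ((c : ℕ) * δ) ω ≤ N ((q + c + 1 : ℕ) * δ) ω := hm (by omega)
    exact ⟨c, fun h => by simp only at h1; omega⟩
  have hstep : ∀ b : ℕ, b ∉ S ↔ N ((q + (b + 1) : ℕ) * δ) ω = N ((q : ℕ) * δ) ω := fun b => by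
    simp only [hS, Set.mem_ofPred_eq, not_not]
    rfl
  change sInf S = b ↔ _
  constructor
  · rintro rfl
    refine ⟨?_, Nat.sInf_mem hne⟩
    rcases Nat.eq_zero_or_pos (sInf S) with h | h
    · rw [h, add_zero]
    · have := (hstep (sInf S - 1)).mp (Nat.notMem_of_lt_sInf (by omega))
      rwa [Nat.sub_add_cancel h] at this
  · rintro ⟨h1, h2⟩
    refine le_antisymm (Nat.sInf_le h2) ?_
    by_contra hcon
    push Not at hcon
    have h3 := Nat.sInf_mem hne
    have h4 : N ((q + sInf S + 1 : ℕ) * δ) ω ≤ N ((q + b : ℕ) * δ) ω := hm (by omega)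
    have h5 : N ((q : ℕ) * δ) ω ≤ N ((q + sInf S + 1 : ℕ) * δ) ω := hm (by omega)
    exact h3 (by omega)

end Discretization

/-! ### Exact laws of the discretized increments -/

section StrongMarkov

variable {Ω : Type*} [m : MeasurableSpace Ω] {P : Measure Ω} [IsProbabilityMeasure P]
  {X : ℝ≥0 → Ω → ℝ} {N : ℝ≥0 → Ω → ℕ} {rate : ℝ≥0}

omit [IsProbabilityMeasure P] in
theorem measurableSet_inter_lt (hX : ∀ t, Measurable (X t)) (hN : IsPoissonProcess rate N P)
    {T : Ω → ℝ≥0}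
    (hT : IsStoppingTime (enlargedFiltration P hX hN.measurable) fun ω => (T ω : WithTop ℝ≥0))
    {A : Set Ω} (hA : MeasurableSet[hT.measurableSpace] A) (t : ℝ≥0) :
    MeasurableSet[augmentedFiltration P hX hN.measurable t] (A ∩ {ω | T ω < t}) := by
  have : A ∩ {ω | T ω < t} = ⋃ q : ℚ, ⋃ _ : Real.toNNReal q < t,
      A ∩ {ω | (T ω : WithTop ℝ≥0) ≤ (Real.toNNReal q : ℝ≥0)} := by
    ext ω
    simp only [Set.mem_inter_iff, Set.mem_ofPred_eq, Set.mem_iUnion, WithTop.coe_le_coe]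
    constructor
    · rintro ⟨h1, h2⟩
      obtain ⟨q, _, hq1, hq2⟩ := (NNReal.lt_iff_exists_rat_btwn _ _).mp h2
      exact ⟨q, hq2, h1, hq1.le⟩
    · rintro ⟨q, hq, h1, h2⟩
      exact ⟨h1, h2.trans_lt hq⟩
  rw [this]
  exact MeasurableSet.iUnion fun q => MeasurableSet.iUnion fun hq =>
    (measurableSet_enlargedFiltration_iff hX hN.measurable).mp (hA.2 _) t hq

-- The grid point used lies strictly after `T`. An event known at time `T` is therefore already in
-- the augmented filtration at that grid point, and right-continuity of the filtration plays no
-- further role.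
omit [IsProbabilityMeasure P] in
theorem measurableSet_inter_floor (hX : ∀ t, Measurable (X t)) (hN : IsPoissonProcess rate N P)
    {T : Ω → ℝ≥0}
    (hT : IsStoppingTime (enlargedFiltration P hX hN.measurable) fun ω => (T ω : WithTop ℝ≥0))
    {A : Set Ω} (hA : MeasurableSet[hT.measurableSpace] A) {δ : ℝ≥0} (hδ : 0 < δ) (a : ℕ) :
    MeasurableSet[augmentedFiltration P hX hN.measurable ((a + 1 : ℕ) * δ)]
      (A ∩ {ω | ⌊T ω / δ⌋₊ = a}) := by
  have : A ∩ {ω | ⌊T ω / δ⌋₊ = a} =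
      (A ∩ {ω | T ω < (a + 1 : ℕ) * δ}) \ (A ∩ {ω | T ω < (a : ℕ) * δ}) := by
    ext ω
    simp only [Set.mem_inter_iff, Set.mem_ofPred_eq, Set.mem_sdiff, not_and, not_lt]
    rw [Nat.floor_eq_iff (by positivity), le_div_iff₀ hδ, div_lt_iff₀ hδ]
    push_cast
    tauto
  rw [this]
  refine (measurableSet_inter_lt hX hN hT hA _).diff ?_
  refine (augmentedFiltration P hX hN.measurable).mono ?_ _ (measurableSet_inter_lt hX hN hT hA _)
  gcongr
  omega

/-- The law of one grid cell. -/
theorem measure_cell (hX : IsLevyProcess X P) (hN : IsPoissonProcess rate N P)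
    (hXN : IndepFun (fun ω t => X t ω) (fun ω t => N t ω) P) {q : ℝ≥0} {A : Set Ω}
    (hA : MeasurableSet[augmentedFiltration P hX.measurable hN.measurable q] A)
    {u v : ℝ≥0} (huv : u ≤ v) {B : Set ℝ} (hB : MeasurableSet B) :
    P (A ∩ {ω | X (q + v) ω - X q ω ∈ B ∧ N (q + u) ω = N q ω ∧ N (q + v) ω ≠ N q ω}) =
      P A * (P {ω | X v ω ∈ B} *
        ENNReal.ofReal (Real.exp (-(rate * u)) - Real.exp (-(rate * v)))) := by
  have hA' : MeasurableSet A := (augmentedFiltration P hX.measurable hN.measurable).le q A hA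
  have h1 := measure_inter_augmented hX hN hXN (le_self_add : q ≤ q + v)
    (le_self_add : q ≤ q + u) hA hB
  have h2 := measure_inter_augmented hX hN hXN (le_self_add : q ≤ q + v)
    (le_self_add : q ≤ q + v) hA hB
  rw [hX.measure_increment q v hB, hN.measure_eq le_self_add] at h1 h2
  have hR : MeasurableSet {ω | X (q + v) ω - X q ω ∈ B} :=
    ((hX.measurable _).sub (hX.measurable _)) hB
  have hE : ∀ p, MeasurableSet {ω | N p ω = N q ω} := fun p =>
    measurableSet_eq_fun (hN.measurable p) (hN.measurable q)
  have hset : A ∩ {ω | X (q + v) ω - X q ω ∈ B ∧ N (q + u) ω = N q ω ∧ N (q + v) ω ≠ N q ω} =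
      (A ∩ ({ω | X (q + v) ω - X q ω ∈ B} ∩ {ω | N (q + u) ω = N q ω})) \
        (A ∩ ({ω | X (q + v) ω - X q ω ∈ B} ∩ {ω | N (q + v) ω = N q ω})) := by
    ext ω
    simp only [Set.mem_inter_iff, Set.mem_ofPred_eq, Set.mem_sdiff]
    tauto
  rw [hset, measure_sdiff ?_ (hA'.inter (hR.inter (hE _))).nullMeasurableSet (measure_ne_top _ _),
    h1, h2]
  · push_cast
    rw [add_sub_cancel_left, add_sub_cancel_left,
      ENNReal.ofReal_sub _ (Real.exp_pos _).le, ENNReal.mul_sub, ENNReal.mul_sub]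
    · exact fun _ _ => measure_ne_top _ _
    · exact fun _ _ => measure_ne_top _ _
  · rintro ω ⟨hω1, hω2, hω3⟩
    refine ⟨hω1, hω2, ?_⟩
    have h4 := hN.mono ω (show q ≤ q + u from le_self_add)
    have h5 := hN.mono ω (show q + u ≤ q + v by gcongr)
    simp only [Set.mem_ofPred_eq] at hω3 h4 h5 ⊢
    omega

/-- The discretized version of the increment of `X` between `T` and the next jump of `N`. -/
noncomputable def gridIncrement (X : ℝ≥0 → Ω → ℝ) (N : ℝ≥0 → Ω → ℕ) (T : Ω → ℝ≥0) (δ : ℝ≥0)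
    (ω : Ω) : ℝ :=
  X ((⌊T ω / δ⌋₊ + 1 + nextCell N T δ ω + 1 : ℕ) * δ) ω - X ((⌊T ω / δ⌋₊ + 1 : ℕ) * δ) ω

theorem measurable_gridIncrement (hX : ∀ t, Measurable (X t)) (hN : ∀ t, Measurable (N t))
    {T : Ω → ℝ≥0} (hT : Measurable T) (δ : ℝ≥0) : Measurable (gridIncrement X N T δ) :=
  (measurable_apply_of_countable hX (fun p : ℕ × ℕ => ((p.1 + 1 + p.2 + 1 : ℕ) : ℝ≥0) * δ)
      ((measurable_floor_div hT δ).prodMk (measurable_nextCell hN hT δ))).sub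
    (measurable_apply_of_countable hX (fun a : ℕ => ((a + 1 : ℕ) : ℝ≥0) * δ)
      (measurable_floor_div hT δ))

/-- Splitting by the cell `a` of `T` and the number `b` of cells until `N` moves makes each event a
one-cell event at a fixed time. Its second factor does not depend on `a`, so summing over `a`
restores `P A`. -/
theorem measure_inter_gridIncrement (hX : IsLevyProcess X P) (hN : IsPoissonProcess rate N P)
    (hrate : 0 < rate)
    (hXN : IndepFun (fun ω t => X t ω) (fun ω t => N t ω) P) {T : Ω → ℝ≥0} (hTm : Measurable T)
    (hT : IsStoppingTime (enlargedFiltration P hX.measurable hN.measurable)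
      fun ω => (T ω : WithTop ℝ≥0))
    {A : Set Ω} (hA : MeasurableSet[hT.measurableSpace] A) {δ : ℝ≥0} (hδ : 0 < δ)
    {B : Set ℝ} (hB : MeasurableSet B) :
    P (A ∩ {ω | gridIncrement X N T δ ω ∈ B}) = P A * ∑' b : ℕ,
      P {ω | X ((b + 1 : ℕ) * δ) ω ∈ B} * ENNReal.ofReal
        (Real.exp (-(rate * ((b : ℕ) * δ : ℝ≥0))) - Real.exp (-(rate * ((b + 1 : ℕ) * δ : ℝ≥0)))) := by
  have hA' : MeasurableSet A := hT.measurableSpace_le A hA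
  set S : ℕ × ℕ → Set Ω := fun p => A ∩ {ω | gridIncrement X N T δ ω ∈ B} ∩
    {ω | ⌊T ω / δ⌋₊ = p.1 ∧ nextCell N T δ ω = p.2} with hS
  have hfl := measurable_floor_div hTm δ
  have hnc := measurable_nextCell hN.measurable hTm δ
  have hU : A ∩ {ω | gridIncrement X N T δ ω ∈ B} = ⋃ p, S p := by
    ext ω
    simp only [hS, Set.mem_iUnion, Set.mem_inter_iff, Set.mem_ofPred_eq]
    exact ⟨fun h => ⟨(_, _), h, rfl, rfl⟩, fun ⟨_, h, _⟩ => h⟩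
  have hU2 : A = ⋃ a, A ∩ {ω | ⌊T ω / δ⌋₊ = a} := by
    ext ω; simp
  have hcell : ∀ p : ℕ × ℕ, P (S p) = P (A ∩ {ω | ⌊T ω / δ⌋₊ = p.1}) *
      (P {ω | X ((p.2 + 1 : ℕ) * δ) ω ∈ B} * ENNReal.ofReal
        (Real.exp (-(rate * ((p.2 : ℕ) * δ : ℝ≥0))) -
          Real.exp (-(rate * ((p.2 + 1 : ℕ) * δ : ℝ≥0))))) := by
    rintro ⟨a, b⟩
    have hAa := measurableSet_inter_floor hX.measurable hN hT hA hδ a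
    rw [← measure_cell hX hN hXN hAa (u := (b : ℕ) * δ) (v := (b + 1 : ℕ) * δ)
      (by gcongr; omega) hB]
    refine measure_congr ?_
    filter_upwards [hN.ae_exists_le hrate] with ω hω
    refine propext ?_
    have e1 : ((a + 1 : ℕ) * δ + (b : ℕ) * δ : ℝ≥0) = (a + 1 + b : ℕ) * δ := by push_cast; ring
    have e2 : ((a + 1 : ℕ) * δ + (b + 1 : ℕ) * δ : ℝ≥0) = (a + 1 + b + 1 : ℕ) * δ := by
      push_cast; ring
    change (ω ∈ S (a, b)) ↔ ω ∈ A ∩ {ω | ⌊T ω / δ⌋₊ = a} ∩ _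
    simp only [hS, Set.mem_inter_iff, Set.mem_ofPred_eq, e1, e2]
    constructor
    · rintro ⟨⟨h1, h2⟩, h3, h4⟩
      refine ⟨⟨h1, h3⟩, ?_, (nextCell_eq_iff (hN.mono ω) hδ hω h3).mp h4⟩
      rwa [gridIncrement, h3, h4] at h2
    · rintro ⟨⟨h1, h3⟩, h2, h4⟩
      have h5 := (nextCell_eq_iff (hN.mono ω) hδ hω h3).mpr h4
      refine ⟨⟨h1, ?_⟩, h3, h5⟩
      rwa [gridIncrement, h3, h5]
  have hSm : ∀ p, MeasurableSet (S p) := fun p =>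
    (hA'.inter (measurable_gridIncrement hX.measurable hN.measurable hTm δ hB)).inter
      ((hfl (measurableSet_singleton p.1)).inter (hnc (measurableSet_singleton p.2)))
  rw [hU, measure_iUnion ?_ hSm, tsum_congr hcell, ENNReal.tsum_prod']
  · simp only [ENNReal.tsum_mul_left, ENNReal.tsum_mul_right]
    congr 1
    conv_rhs => rw [hU2]
    have hm2 : ∀ a, MeasurableSet (A ∩ {ω | ⌊T ω / δ⌋₊ = a}) := fun a =>
      hA'.inter (hfl (measurableSet_singleton a))
    rw [measure_iUnion ?_ hm2]
    intro a b hab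
    refine Set.disjoint_left.mpr ?_
    rintro ω ⟨_, h1⟩ ⟨_, h2⟩
    exact hab (h1.symm.trans h2)
  · rintro ⟨a, b⟩ ⟨a', b'⟩ hab
    refine Set.disjoint_left.mpr ?_
    rintro ω ⟨_, h1, h2⟩ ⟨_, h3, h4⟩
    exact hab (Prod.ext (h1.symm.trans h3) (h2.symm.trans h4))

theorem expMeasure_Ioc {q : ℝ} (hq : 0 < q) {s t : ℝ} (hs : 0 ≤ s) (hst : s ≤ t) :
    expMeasure q (Set.Ioc s t) =
      ENNReal.ofReal (Real.exp (-(q * s)) - Real.exp (-(q * t))) := by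
  have := isProbabilityMeasure_expMeasure hq
  conv_lhs => rw [← measure_cdf (expMeasure q)]
  rw [StieltjesFunction.measure_Ioc, cdf_expMeasure_eq hq, cdf_expMeasure_eq hq, if_pos hs,
    if_pos (hs.trans hst)]
  congr 1
  ring

theorem expMeasure_Iic_zero {q : ℝ} (hq : 0 < q) : expMeasure q (Set.Iic 0) = 0 := by
  have := isProbabilityMeasure_expMeasure hq
  have h : cdf (expMeasure q) 0 = 0 := by rw [cdf_expMeasure_eq hq]; simp
  rw [← ofReal_cdf, h, ENNReal.ofReal_zero]

/-- The value of `X` at the first grid point after an independent time. -/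
noncomputable def gridApply (X : ℝ≥0 → Ω → ℝ) (δ : ℝ≥0) (p : Ω × ℝ) : ℝ :=
  X ((⌈p.2 / δ⌉₊ : ℕ) * δ) p.1

theorem measurable_gridApply (hX : ∀ t, Measurable (X t)) (δ : ℝ≥0) :
    Measurable (gridApply X δ) :=
  measurable_apply_of_countable (Y := fun t (p : Ω × ℝ) => X t p.1)
    (fun t => (hX t).comp measurable_fst) (fun a : ℕ => (a : ℝ≥0) * δ)
    (a := fun p : Ω × ℝ => ⌈p.2 / δ⌉₊) (Nat.measurable_ceil.comp (measurable_snd.div_const _))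

-- The series agrees with that of `measure_inter_gridIncrement`: an exponential time rounded up and
-- the Poisson cell of the next movement have the same geometric law. The two discretized laws thus
-- coincide exactly, with no error to estimate.
omit [IsProbabilityMeasure P] in
theorem measure_gridApply (hX : ∀ t, Measurable (X t)) {q : ℝ} (hq : 0 < q) {δ : ℝ≥0} (hδ : 0 < δ)
    {B : Set ℝ} (hB : MeasurableSet B) :
    (P.prod (expMeasure q)) {p | gridApply X δ p ∈ B} = ∑' b : ℕ,
      P {ω | X ((b + 1 : ℕ) * δ) ω ∈ B} * ENNReal.ofReal
        (Real.exp (-(q * ((b : ℕ) * δ : ℝ≥0))) - Real.exp (-(q * ((b + 1 : ℕ) * δ : ℝ≥0)))) := by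
  have := isProbabilityMeasure_expMeasure hq
  set S : ℕ → Set (Ω × ℝ) := fun b => {ω | X ((b + 1 : ℕ) * δ) ω ∈ B} ×ˢ
    Set.Ioc (((b : ℕ) * δ : ℝ≥0) : ℝ) ((b + 1 : ℕ) * δ : ℝ≥0) with hS
  have hδ' : (0 : ℝ) < δ := hδ
  have hceil : ∀ (t : ℝ) (b : ℕ), t ∈ Set.Ioc (((b : ℕ) * δ : ℝ≥0) : ℝ) ((b + 1 : ℕ) * δ : ℝ≥0) ↔
      ⌈t / δ⌉₊ = b + 1 := fun t b => by
    rw [Nat.ceil_eq_iff (by omega), lt_div_iff₀ hδ', div_le_iff₀ hδ', Set.mem_Ioc]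
    push_cast
    simp
  have hae : ({p | gridApply X δ p ∈ B} : Set (Ω × ℝ)) =ᵐ[P.prod (expMeasure q)]
      (⋃ b, S b : Set (Ω × ℝ)) := by
    have hpos : ∀ᵐ p ∂(P.prod (expMeasure q)), 0 < p.2 := by
      rw [ae_iff]
      have : {p : Ω × ℝ | ¬ 0 < p.2} = Set.univ ×ˢ Set.Iic 0 := by ext; simp
      rw [this, Measure.prod_prod, expMeasure_Iic_zero hq, mul_zero]
    filter_upwards [hpos] with p hp
    refine propext ?_
    change gridApply X δ p ∈ B ↔ p ∈ ⋃ b, S b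
    simp only [hS, Set.mem_iUnion, Set.mem_prod, Set.mem_ofPred_eq, hceil, gridApply]
    have h1 : 0 < ⌈p.2 / δ⌉₊ := Nat.ceil_pos.mpr (div_pos hp hδ')
    constructor
    · intro h
      refine ⟨⌈p.2 / δ⌉₊ - 1, ?_, (Nat.sub_add_cancel h1).symm⟩
      rwa [Nat.sub_add_cancel h1]
    · rintro ⟨b, h, hb⟩
      rwa [hb]
  have hSm : ∀ b, MeasurableSet (S b) := fun b => (hX _ hB).prod measurableSet_Ioc
  rw [measure_congr hae, measure_iUnion ?_ hSm]
  · refine tsum_congr fun b => ?_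
    rw [Measure.prod_prod, expMeasure_Ioc hq (NNReal.coe_nonneg _)
      (NNReal.coe_le_coe.mpr (by gcongr; omega))]
  · intro b c hbc
    refine Set.disjoint_left.mpr ?_
    rintro p ⟨_, h1⟩ ⟨_, h2⟩
    rw [hceil] at h1 h2
    exact hbc (by omega)

end StrongMarkov

/-! ### Refining the grid -/

section Limit

variable {Ω : Type*} [m : MeasurableSpace Ω] {P : Measure Ω}
  {X : ℝ≥0 → Ω → ℝ} {N : ℝ≥0 → Ω → ℕ} {rate : ℝ≥0}

omit m in
theorem tendsto_gridApply (hX : ∀ ω t, ContinuousWithinAt (fun s => X s ω) (Set.Ici t) t)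
    (p : Ω × ℝ) : Tendsto (fun M : ℕ => gridApply X (1 / ((M : ℝ≥0) + 1)) p) atTop
      (𝓝 (X p.2.toNNReal p.1)) := by
  refine tendsto_apply_of_le_of_le (x := fun t => X t p.1) (hX _ _)
    (Eventually.of_forall fun M => ?_)
  have hM : (0 : ℝ) < (M : ℝ) + 1 := by positivity
  set c := ⌈p.2 / ((1 / ((M : ℝ≥0) + 1) : ℝ≥0) : ℝ)⌉₊ with hc
  have e : p.2 / ((1 / ((M : ℝ≥0) + 1) : ℝ≥0) : ℝ) = p.2 * (M + 1) := by
    push_cast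
    field_simp
  constructor
  · rw [Real.toNNReal_le_iff_le_coe]
    have h := Nat.le_ceil (p.2 / ((1 / ((M : ℝ≥0) + 1) : ℝ≥0) : ℝ))
    rw [← hc, e] at h
    push_cast
    rw [mul_one_div, le_div_iff₀ hM]
    exact h
  · rw [← NNReal.coe_le_coe]
    push_cast
    rw [mul_one_div, ← sub_le_iff_le_add, ← sub_div, div_le_iff₀ hM, sub_le_iff_le_add]
    rcases le_or_gt p.2 0 with h | h
    · have : c = 0 := by
        rw [hc, e]
        exact Nat.ceil_eq_zero.mpr (mul_nonpos_of_nonpos_of_nonneg h hM.le)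
      rw [this]
      have h2 : 0 ≤ max p.2 0 := le_max_right _ _
      simp only [Nat.cast_zero, Real.coe_toNNReal']
      positivity
    · have h2 := (Nat.ceil_lt_add_one (mul_pos h hM).le).le
      rw [hc, e, Real.coe_toNNReal _ h.le]
      exact h2

theorem measurable_apply_toNNReal (hX : ∀ t, Measurable (X t))
    (hX' : ∀ ω t, ContinuousWithinAt (fun s => X s ω) (Set.Ici t) t) :
    Measurable fun p : Ω × ℝ => X p.2.toNNReal p.1 :=
  measurable_of_tendsto_metrizable (fun M => measurable_gridApply hX (1 / ((M : ℝ≥0) + 1)))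
    (tendsto_pi_nhds.mpr fun p => tendsto_gridApply hX' p)

theorem measurable_apply_time (hX : ∀ t, Measurable (X t))
    (hX' : ∀ ω t, ContinuousWithinAt (fun s => X s ω) (Set.Ici t) t) {T : Ω → ℝ≥0}
    (hT : Measurable T) : Measurable fun ω => X (T ω) ω := by
  have := (measurable_apply_toNNReal hX hX').comp (measurable_id.prodMk hT.coe_nnreal_real)
  simpa [Function.comp_def] using this

/-- The discretized increment converges to the increment between consecutive jump times. -/
theorem tendsto_gridIncrement {ω : Ω} (hN : IsPoissonProcess rate N P)
    (hX : ∀ t, ContinuousWithinAt (fun s => X s ω) (Set.Ici t) t)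
    (hω : ∀ j, ∃ s, j ≤ N s ω) (hω' : ∀ j, N (jumpTime N j ω) ω = j) (j : ℕ) :
    Tendsto (fun M : ℕ => gridIncrement X N (jumpTime N j) (1 / ((M : ℝ≥0) + 1)) ω) atTop
      (𝓝 (X (jumpTime N (j + 1) ω) ω - X (jumpTime N j ω) ω)) := by
  have hlt : jumpTime N j ω < jumpTime N (j + 1) ω :=
    jumpTime_strictMono hN hω hω' (Nat.lt_succ_self j)
  set T := jumpTime N j ω with hT
  set T' := jumpTime N (j + 1) ω with hT'
  have hδ : ∀ M : ℕ, (0 : ℝ≥0) < 1 / ((M : ℝ≥0) + 1) := fun M => by positivity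
  have hgrid : ∀ M : ℕ, T ≤ ((⌊T / (1 / ((M : ℝ≥0) + 1))⌋₊ + 1 : ℕ) : ℝ≥0) * (1 / ((M : ℝ≥0) + 1)) ∧
      ((⌊T / (1 / ((M : ℝ≥0) + 1))⌋₊ + 1 : ℕ) : ℝ≥0) * (1 / ((M : ℝ≥0) + 1)) ≤
        T + 1 / ((M : ℝ≥0) + 1) := fun M => by
    have h1 := Nat.lt_floor_add_one (T / (1 / ((M : ℝ≥0) + 1)))
    have h2 := Nat.floor_le (zero_le (a := T / (1 / ((M : ℝ≥0) + 1))))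
    rw [div_lt_iff₀ (hδ M)] at h1
    rw [le_div_iff₀ (hδ M)] at h2
    refine ⟨by exact_mod_cast h1.le, ?_⟩
    push_cast
    rw [add_mul, one_mul]
    gcongr
  -- Once the mesh is smaller than the gap between the two jumps, the first grid point after `T`
  -- still precedes `T'`, so the next movement of `N` on the grid is the jump at `T'`.
  have hsmall : ∀ᶠ M : ℕ in atTop, T + 1 / ((M : ℝ≥0) + 1) < T' := by
    have h0 : Tendsto (fun M : ℕ => T + 1 / ((M : ℝ≥0) + 1)) atTop (𝓝 (T + 0)) := by
      refine tendsto_const_nhds.add ?_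
      rw [← NNReal.tendsto_coe]
      push_cast
      exact tendsto_one_div_add_atTop_nhds_zero_nat
    rw [add_zero] at h0
    exact h0.eventually_lt_const hlt
  refine Tendsto.sub (tendsto_apply_of_le_of_le (x := fun t => X t ω) (hX T') ?_)
    (tendsto_apply_of_le_of_le (x := fun t => X t ω) (hX T) (Eventually.of_forall hgrid))
  filter_upwards [hsmall] with M hM
  obtain ⟨hg1, hg2⟩ := hgrid M
  set δ : ℝ≥0 := 1 / ((M : ℝ≥0) + 1) with hδM
  have hval : ∀ t, T ≤ t → (N t ω = j ↔ t < T') := fun t ht => by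
    have h1 := (jumpTime_le_iff hN (hω j)).mp ht
    rw [← not_le, hT', jumpTime_le_iff hN (hω (j + 1))]
    omega
  obtain ⟨h1, h2⟩ := (nextCell_eq_iff (T := jumpTime N j) (hN.mono ω) (hδ M) hω rfl).mp
    (rfl : nextCell N (jumpTime N j) δ ω = _)
  rw [← hT] at h1 h2 ⊢
  have hs0 := (hval _ hg1).mpr (hg2.trans_lt hM)
  rw [hs0] at h1 h2
  set a := ⌊T / δ⌋₊ + 1 with ha
  set b := nextCell N (jumpTime N j) δ ω with hb
  have hle1 : T ≤ ((a + b : ℕ) : ℝ≥0) * δ := hg1.trans (by gcongr; omega)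
  have hle2 : T ≤ ((a + b + 1 : ℕ) : ℝ≥0) * δ := hg1.trans (by gcongr; omega)
  rw [hval _ hle1] at h1
  rw [ne_eq, hval _ hle2, not_lt] at h2
  refine ⟨h2, ?_⟩
  have e : ((a + b + 1 : ℕ) : ℝ≥0) * δ = ((a + b : ℕ) : ℝ≥0) * δ + δ := by push_cast; ring
  rw [e]
  gcongr

end Limit

/-! ### The Markov property at jump times -/

section StrongMarkov

variable {Ω : Type*} [m : MeasurableSpace Ω] {P : Measure Ω} [IsProbabilityMeasure P]
  {X : ℝ≥0 → Ω → ℝ} {N : ℝ≥0 → Ω → ℕ} {rate : ℝ≥0}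

/-- The increments of `X` between consecutive jump times of `N` are independent of the past and
distributed as `X` at an independent exponential time. -/
theorem map_restrict_jump_increment (hX : IsLevyProcess X P) (hN : IsPoissonProcess rate N P)
    (hrate : 0 < rate) (hXN : IndepFun (fun ω t => X t ω) (fun ω t => N t ω) P) (j : ℕ)
    {A : Set Ω}
    (hA : MeasurableSet[(isStoppingTime_jumpTime hX.measurable hN hrate j).measurableSpace] A) :
    (P.restrict A).map (fun ω => X (jumpTime N (j + 1) ω) ω - X (jumpTime N j ω) ω) =
      P A • lawAtExpTime rate X P := by
  have hrate' : (0 : ℝ) < rate := hrate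
  have := isProbabilityMeasure_expMeasure hrate'
  have hTm := fun i => measurable_jumpTime hX.measurable hN hrate i
  have hjm := measurable_apply_toNNReal hX.measurable hX.right_cont
  have hlaw : IsProbabilityMeasure (lawAtExpTime rate X P) :=
    Measure.isProbabilityMeasure_map hjm.aemeasurable
  have hfin : IsFiniteMeasure (P A • lawAtExpTime rate X P) :=
    Measure.smul_finite _ (measure_ne_top _ _)
  have hDm : Measurable fun ω => X (jumpTime N (j + 1) ω) ω - X (jumpTime N j ω) ω :=
    (measurable_apply_time hX.measurable hX.right_cont (hTm _)).sub
      (measurable_apply_time hX.measurable hX.right_cont (hTm _))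
  have hgm := fun δ => measurable_gridIncrement hX.measurable hN.measurable (hTm j) δ
  -- Equality of laws holds at every mesh; right-continuity of `X` and bounded continuous test
  -- functions carry it to the limit on both sides.
  have hdisc : ∀ M : ℕ, (P.restrict A).map
      (gridIncrement X N (jumpTime N j) (1 / ((M : ℝ≥0) + 1))) =
      P A • (P.prod (expMeasure rate)).map (gridApply X (1 / ((M : ℝ≥0) + 1))) := fun M => by
    ext B hB
    rw [Measure.map_apply (hgm _) hB, Measure.smul_apply,
      Measure.map_apply (measurable_gridApply hX.measurable _) hB,
      Measure.restrict_apply (hgm _ hB), Set.inter_comm, smul_eq_mul]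
    exact (measure_inter_gridIncrement hX hN hrate hXN (hTm j) _ hA (by positivity) hB).trans
      (congrArg _ (measure_gridApply hX.measurable hrate' (by positivity) hB).symm)
  refine ext_of_forall_integral_eq_of_IsFiniteMeasure fun h => ?_
  rw [integral_map hDm.aemeasurable h.continuous.aestronglyMeasurable, integral_smul_measure,
    lawAtExpTime, integral_map hjm.aemeasurable h.continuous.aestronglyMeasurable]
  have hl1 : Tendsto (fun M : ℕ => ∫ ω in A, h (gridIncrement X N (jumpTime N j)
      (1 / ((M : ℝ≥0) + 1)) ω) ∂P) atTop
      (𝓝 (∫ ω in A, h (X (jumpTime N (j + 1) ω) ω - X (jumpTime N j ω) ω) ∂P)) := by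
    refine tendsto_integral_of_dominated_convergence (fun _ => ‖h‖)
      (fun M => (h.continuous.measurable.comp (hgm _)).aestronglyMeasurable)
      (integrable_const _) (fun M => Eventually.of_forall fun ω => h.norm_coe_le_norm _) ?_
    filter_upwards [ae_restrict_of_ae (hN.ae_apply_jumpTime hrate)] with ω hω
    exact (h.continuous.tendsto _).comp
      (tendsto_gridIncrement hN (hX.right_cont ω) hω.1 hω.2 j)
  have hl2 : Tendsto (fun M : ℕ => ∫ p, h (gridApply X (1 / ((M : ℝ≥0) + 1)) p)
      ∂(P.prod (expMeasure rate))) atTop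
      (𝓝 (∫ p, h (X p.2.toNNReal p.1) ∂(P.prod (expMeasure rate)))) := by
    refine tendsto_integral_of_dominated_convergence (fun _ => ‖h‖)
      (fun M => (h.continuous.measurable.comp
        (measurable_gridApply hX.measurable _)).aestronglyMeasurable)
      (integrable_const _) (fun M => Eventually.of_forall fun ω => h.norm_coe_le_norm _)
      (Eventually.of_forall fun p => ?_)
    exact (h.continuous.tendsto _).comp (tendsto_gridApply hX.right_cont p)
  refine tendsto_nhds_unique hl1 ((hl2.const_smul (P A).toReal).congr fun M => ?_)
  rw [← integral_map (hgm _).aemeasurable h.continuous.aestronglyMeasurable, hdisc M,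
    integral_smul_measure, integral_map (measurable_gridApply hX.measurable _).aemeasurable
      h.continuous.aestronglyMeasurable]

theorem isProbabilityMeasure_lawAtExpTime (hX : IsLevyProcess X P) (hrate : 0 < rate) :
    IsProbabilityMeasure (lawAtExpTime rate X P) := by
  have := isProbabilityMeasure_expMeasure (show (0 : ℝ) < rate from hrate)
  exact Measure.isProbabilityMeasure_map
    (measurable_apply_toNNReal hX.measurable hX.right_cont).aemeasurable

omit [IsProbabilityMeasure P] in
/-- Null modifications of events of the past of a stopping time belong to the past. -/
theorem measurableSet_stopping_of_null (hX : ∀ t, Measurable (X t)) (hN : ∀ t, Measurable (N t))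
    {A : Set Ω} (hA : MeasurableSet A) (h0 : P A = 0) (t : ℝ≥0) :
    MeasurableSet[enlargedFiltration P hX hN t] A :=
  (measurableSet_enlargedFiltration_iff hX hN).mpr fun u _ =>
    measurableSet_augmentedFiltration_of_null hX hN u hA h0

omit [IsProbabilityMeasure P] in
/-- The process at a stopping time is measurable with respect to the past of the stopping time. -/
theorem measurableSet_apply_inter_le (hX : IsLevyProcess X P) (hN : ∀ t, Measurable (N t))
    {T : Ω → ℝ≥0}
    (hT : IsStoppingTime (enlargedFiltration P hX.measurable hN) fun ω => (T ω : WithTop ℝ≥0))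
    {B : Set ℝ} (hB : MeasurableSet B) (t : ℝ≥0) :
    MeasurableSet[enlargedFiltration P hX.measurable hN t] ({ω | X (T ω) ω ∈ B} ∩ {ω | T ω ≤ t}) := by
  rw [measurableSet_enlargedFiltration_iff]
  intro u hu
  set F := augmentedFiltration P hX.measurable hN with hF
  have hTu : ∀ s ≤ t, MeasurableSet[F u] {ω | T ω ≤ s} := fun s hs => by
    have := (measurableSet_enlargedFiltration_iff hX.measurable hN).mp (hT s) u (hs.trans_lt hu)
    simpa only [WithTop.coe_le_coe] using this
  have hmin : Measurable[F u] fun ω => min (T ω) t := by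
    refine measurable_of_Iic (mδ := F u) fun s => ?_
    rcases le_or_gt t s with h | h
    · convert @MeasurableSet.univ _ (F u)
      ext ω
      simp [h]
    · convert hTu s h.le using 1
      ext ω
      simp [not_le.mpr h]
  -- Right-continuity requires approximating the time from above, which looks beyond `t`. The strict
  -- inequality `t < u` leaves room, and truncation at `u` keeps all evaluations measurable at time
  -- `u`.
  have hconv : Measurable[F u] fun ω => X (min (T ω) t) ω := by
    have hlim : ∀ ω, Tendsto (fun M : ℕ => X (min ((⌈min (T ω) t / (1 / ((M : ℝ≥0) + 1))⌉₊ : ℕ) *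
        (1 / ((M : ℝ≥0) + 1))) u) ω) atTop (𝓝 (X (min (T ω) t) ω)) := fun ω => by
      refine tendsto_apply_of_le_of_le (x := fun t => X t ω) (hX.right_cont ω _)
        (Eventually.of_forall fun M => ?_)
      have hM : (0 : ℝ≥0) < 1 / ((M : ℝ≥0) + 1) := by positivity
      constructor
      · refine le_min ?_ ((min_le_right _ _).trans hu.le)
        rw [← div_le_iff₀ hM]
        exact Nat.le_ceil _
      · refine (min_le_left _ _).trans ?_
        have h1 := (Nat.ceil_lt_add_one (zero_le (a := min (T ω) t / (1 / ((M : ℝ≥0) + 1))))).le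
        calc _ ≤ (min (T ω) t / (1 / ((M : ℝ≥0) + 1)) + 1) * (1 / ((M : ℝ≥0) + 1)) := by
              gcongr
          _ = _ := by rw [add_mul, one_mul, div_mul_cancel₀ _ hM.ne']
    refine @measurable_of_tendsto_metrizable Ω ℝ (F u) _ _ _ _ _ _ (fun M => ?_)
      (tendsto_pi_nhds.mpr hlim)
    refine @measurable_apply_of_countable Ω (F u) {s : ℝ≥0 // s ≤ u} ℕ ℝ _ _ _ _
      (fun s ω => X s ω) (fun s => measurable_augmentedFiltration_left hX.measurable hN s.2)
      (fun c => ⟨min ((c : ℝ≥0) * (1 / ((M : ℝ≥0) + 1))) u, min_le_right _ _⟩)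
      (fun ω => ⌈min (T ω) t / (1 / ((M : ℝ≥0) + 1))⌉₊) ?_
    exact Nat.measurable_ceil.comp (hmin.div_const _)
  have : {ω | X (T ω) ω ∈ B} ∩ {ω | T ω ≤ t} =
      {ω | X (min (T ω) t) ω ∈ B} ∩ {ω | T ω ≤ t} := by
    ext ω
    simp only [Set.mem_inter_iff, Set.mem_ofPred_eq]
    refine and_congr_left fun h => ?_
    rw [min_eq_left h]
  rw [this]
  exact (hconv hB).inter (hTu t le_rfl)

omit [IsProbabilityMeasure P] in
theorem measurable_apply_stopping (hX : IsLevyProcess X P) (hN : ∀ t, Measurable (N t))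
    {T : Ω → ℝ≥0}
    (hT : IsStoppingTime (enlargedFiltration P hX.measurable hN) fun ω => (T ω : WithTop ℝ≥0)) :
    Measurable[hT.measurableSpace] fun ω => X (T ω) ω := by
  intro B hB
  have hloc := measurableSet_apply_inter_le hX hN hT hB
  refine ⟨?_, fun t => ?_⟩
  swap
  · simp only [WithTop.coe_le_coe]
    exact hloc t
  have : (fun ω => X (T ω) ω) ⁻¹' B = ⋃ k : ℕ, {ω | X (T ω) ω ∈ B} ∩ {ω | T ω ≤ k} := by
    ext ω
    simp only [Set.mem_preimage, Set.mem_iUnion, Set.mem_inter_iff, Set.mem_ofPred_eq]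
    exact ⟨fun h => (exists_nat_ge (T ω)).imp fun k hk => ⟨h, hk⟩, fun ⟨k, h, _⟩ => h⟩
  rw [this]
  exact MeasurableSet.iUnion fun k =>
    (le_iSup (fun t => (enlargedFiltration P hX.measurable hN t : MeasurableSpace Ω)) (k : ℝ≥0)) _
      (hloc k)

/-- The Markov property at jump times. -/
theorem setIntegral_jump_succ (hX : IsLevyProcess X P) (hN : IsPoissonProcess rate N P)
    (hrate : 0 < rate) (hXN : IndepFun (fun ω t => X t ω) (fun ω t => N t ω) P) (j : ℕ)
    {A : Set Ω}
    (hA : MeasurableSet[(isStoppingTime_jumpTime hX.measurable hN hrate j).measurableSpace] A)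
    {g : ℝ → ℝ} (hg : Measurable g) {C : ℝ} (hC : ∀ x, |g x| ≤ C) :
    ∫ ω in A, g (X (jumpTime N (j + 1) ω) ω) ∂P =
      ∫ ω in A, ∫ y, g (X (jumpTime N j ω) ω + y) ∂(lawAtExpTime rate X P) ∂P := by
  set hT := isStoppingTime_jumpTime (P := P) hX.measurable hN hrate j with hTdef
  have hlaw := isProbabilityMeasure_lawAtExpTime (P := P) hX hrate
  have hA' : MeasurableSet A := hT.measurableSpace_le A hA
  have hTm := fun i => measurable_jumpTime hX.measurable hN hrate i
  have hXm := fun i => measurable_apply_time hX.measurable hX.right_cont (hTm i)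
  set Z := fun ω => X (jumpTime N j ω) ω with hZ
  set D := fun ω => X (jumpTime N (j + 1) ω) ω - X (jumpTime N j ω) ω with hD
  have hZm : Measurable Z := hXm j
  have hDm : Measurable D := (hXm (j + 1)).sub (hXm j)
  have hZ' := measurable_apply_stopping hX hN.measurable hT
  -- The position at the jump time belongs to the past, so events about it can be absorbed into `A`;
  -- independence of the increment from the past then gives a product law.
  have hjoint : (P.restrict A).map (fun ω => (Z ω, D ω)) =
      ((P.restrict A).map Z).prod (lawAtExpTime rate X P) := by
    refine Measure.ext_prod ?_
    intro B C' hB hC'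
    rw [Measure.prod_prod, Measure.map_apply hZm hB,
      Measure.map_apply (hZm.prodMk hDm) (hB.prod hC'),
      Measure.restrict_apply (hZm hB), Measure.restrict_apply (hZm.prodMk hDm (hB.prod hC'))]
    have hAB : MeasurableSet[hT.measurableSpace] (Z ⁻¹' B ∩ A) :=
      MeasurableSet.inter (hZ' hB) hA
    have h := congrArg (fun μ => μ C') (map_restrict_jump_increment hX hN hrate hXN j hAB)
    simp only [Measure.smul_apply, smul_eq_mul] at h
    rw [Measure.map_apply hDm hC', Measure.restrict_apply (hDm hC')] at h
    rw [← h]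
    congr 1
    ext ω
    simp only [Set.mem_inter_iff, Set.mem_preimage, Set.mem_prod, hD]
    tauto
  have hgm : Measurable fun p : ℝ × ℝ => g (p.1 + p.2) := hg.comp (measurable_fst.add measurable_snd)
  have h1 : ∫ ω in A, g (X (jumpTime N (j + 1) ω) ω) ∂P =
      ∫ p, g (p.1 + p.2) ∂(P.restrict A).map (fun ω => (Z ω, D ω)) := by
    rw [integral_map (hZm.prodMk hDm).aemeasurable hgm.aestronglyMeasurable]
    refine integral_congr_ae (Eventually.of_forall fun ω => ?_)
    simp only [hZ, hD]
    congr 1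
    ring
  have : IsFiniteMeasure ((P.restrict A).map Z) := Measure.isFiniteMeasure_map _ _
  rw [h1, hjoint, integral_prod _ (Integrable.of_bound hgm.aestronglyMeasurable C
    (Eventually.of_forall fun p => hC _)), integral_map hZm.aemeasurable]
  exact (hgm.stronglyMeasurable.integral_prod_right').aestronglyMeasurable

end StrongMarkov

theorem abs_putPayoff_le {K : ℝ} (hK : 0 < K) (x : ℝ) : |putPayoff K x| ≤ K := by
  rw [abs_of_nonneg (putPayoff_nonneg K x)]
  exact max_le (by linarith [Real.exp_pos x]) hK.le

/-! ### Dynamic programming along the grid -/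

section Discount

variable {Ω : Type*} [m : MeasurableSpace Ω] {P : Measure Ω} {X : ℝ≥0 → Ω → ℝ}
  {N : ℝ≥0 → Ω → ℕ} {rate : ℝ≥0}

omit m in
theorem jumpTime_zero (ω : Ω) : jumpTime N 0 ω = 0 :=
  le_antisymm (csInf_le' (Nat.zero_le _)) bot_le

-- Strictly increasing jump times leave exactly one nonzero term in the discount series.
omit m in
theorem gridDiscount_jumpTime {r : ℝ} {n : ℕ} {ω : Ω}
    (h : StrictMono fun j => jumpTime N j ω) (i : ℕ) :
    gridDiscount r n N ω (jumpTime N i ω) = Real.exp (-r / n) ^ i := by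
  rw [gridDiscount, tsum_eq_single i, if_pos rfl, ← Real.exp_nat_mul]
  · congr 1
    ring
  · intro j hj
    exact if_neg fun hij => hj (h.injective hij).symm

end Discount

section Bellman

variable {Ω : Type*} [m : MeasurableSpace Ω] {P : Measure Ω} [IsProbabilityMeasure P]
  {X : ℝ≥0 → Ω → ℝ} {N : ℝ≥0 → Ω → ℕ} {rate : ℝ≥0}
  (hX : IsLevyProcess X P) (hN : IsPoissonProcess rate N P) (hrate : 0 < rate)
  {d K : ℝ}

include hX hN hrate

omit [IsProbabilityMeasure P] in
theorem measurable_apply_jumpTime (j : ℕ) : Measurable fun ω => X (jumpTime N j ω) ω :=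
  measurable_apply_time hX.measurable hX.right_cont (measurable_jumpTime hX.measurable hN hrate j)

theorem integrable_comp_jumpTime {g : ℝ → ℝ} (hg : Measurable g) {C : ℝ} (hC : ∀ x, |g x| ≤ C)
    (x c : ℝ) (j : ℕ) : Integrable (fun ω => c * g (x + X (jumpTime N j ω) ω)) P :=
  (Integrable.of_bound ((hg.comp ((measurable_apply_jumpTime hX hN hrate j).const_add
    x)).aestronglyMeasurable) C (Eventually.of_forall fun _ => hC _)).const_mul c

variable {τ : Ω → ℝ≥0} (hτ : τ ∈ gridStoppingTimes P hX.measurable hN.measurable)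

omit [IsProbabilityMeasure P] in
include hτ in
theorem measurableSet_jumpTime_lt_gridStopping (j : ℕ) :
    MeasurableSet[(isStoppingTime_jumpTime hX.measurable hN hrate j).measurableSpace]
      {ω | jumpTime N j ω < τ ω} := by
  have h := (IsStoppingTime.measurableSet_stopping_time_le hτ.1
    (isStoppingTime_jumpTime hX.measurable hN hrate j)).compl
  convert h using 1
  ext ω
  simp only [Set.mem_ofPred_eq, Set.mem_compl_iff, WithTop.coe_le_coe, not_le]

omit [IsProbabilityMeasure P] in
include hτ in
theorem measurableSet_jumpTime_le_gridStopping (j : ℕ) :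
    MeasurableSet {ω | jumpTime N j ω ≤ τ ω} := by
  have hT := isStoppingTime_jumpTime (P := P) hX.measurable hN hrate j
  have h := hT.measurableSpace_le _ (IsStoppingTime.measurableSet_le_stopping_time hT hτ.1)
  simpa only [WithTop.coe_le_coe] using h

omit [IsProbabilityMeasure P] in
include hτ in
theorem measurableSet_jumpTime_lt_gridStopping' (j : ℕ) :
    MeasurableSet {ω | jumpTime N j ω < τ ω} :=
  (isStoppingTime_jumpTime hX.measurable hN hrate j).measurableSpace_le _
    (measurableSet_jumpTime_lt_gridStopping hX hN hrate hτ j)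

omit [IsProbabilityMeasure P] in
include hτ in
theorem measurableSet_gridStopping_eq (j : ℕ) : MeasurableSet {ω | τ ω = jumpTime N j ω} := by
  convert (measurableSet_jumpTime_le_gridStopping hX hN hrate hτ j).diff
    (measurableSet_jumpTime_lt_gridStopping' hX hN hrate hτ j) using 1
  ext ω
  simp only [Set.mem_ofPred_eq, Set.mem_sdiff, not_lt]
  exact ⟨fun h => ⟨h.ge, h.le⟩, fun h => le_antisymm h.2 h.1⟩

include hτ in
/-- One step of dynamic programming along the grid. -/
theorem setIntegral_valueSeq_succ
    (hXN : IndepFun (fun ω t => X t ω) (fun ω t => N t ω) P) (hd0 : 0 < d) (hd1 : d < 1)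
    (hK : 0 < K) (x : ℝ) (k j : ℕ) :
    ∫ ω in {ω | jumpTime N (j + 1) ω ≤ τ ω},
        valueSeq (lawAtExpTime rate X P) d K k (x + X (jumpTime N (j + 1) ω) ω) ∂P =
      ∫ ω in {ω | jumpTime N j ω < τ ω}, ∫ y,
        valueSeq (lawAtExpTime rate X P) d K k (x + X (jumpTime N j ω) ω + y)
          ∂(lawAtExpTime rate X P) ∂P := by
  have := isProbabilityMeasure_lawAtExpTime (P := P) hX hrate
  -- For a grid-valued `τ`, reaching the next grid point means not having stopped by the current
  -- one. The latter event is known at the `j`-th jump time, so the Markov property applies.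
  have hset : ({ω | jumpTime N (j + 1) ω ≤ τ ω} : Set Ω) =ᵐ[P]
      ({ω | jumpTime N j ω < τ ω} : Set Ω) := by
    filter_upwards [hN.ae_apply_jumpTime hrate] with ω hω
    refine propext ?_
    change jumpTime N (j + 1) ω ≤ τ ω ↔ jumpTime N j ω < τ ω
    have hs := jumpTime_strictMono hN hω.1 hω.2
    obtain ⟨i, hi⟩ := hτ.2 ω
    rw [hi]
    exact (hs.le_iff_le (a := j + 1) (b := i)).trans
      (Nat.succ_le_iff.trans (hs.lt_iff_lt (a := j) (b := i)).symm)
  rw [setIntegral_congr_set hset, setIntegral_jump_succ hX hN hrate hXN j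
    (measurableSet_jumpTime_lt_gridStopping hX hN hrate hτ j)
    (g := fun z => valueSeq (lawAtExpTime rate X P) d K k (x + z))
    ((measurable_valueSeq _ d K k).comp (measurable_const_add x))
    (fun z => abs_valueSeq_le hd0 hd1 hK k _)]
  simp only [add_assoc]

omit [IsProbabilityMeasure P] in
include hτ in
theorem setIntegral_jumpTime_le_eq_add {g : Ω → ℝ} (hg : Integrable g P) (j : ℕ) :
    ∫ ω in {ω | jumpTime N j ω ≤ τ ω}, g ω ∂P =
      ∫ ω in {ω | τ ω = jumpTime N j ω}, g ω ∂P + ∫ ω in {ω | jumpTime N j ω < τ ω}, g ω ∂P := by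
  rw [← setIntegral_union ?_ (measurableSet_jumpTime_lt_gridStopping' hX hN hrate hτ j)
    hg.integrableOn hg.integrableOn]
  · congr 2
    ext ω
    simp only [Set.mem_ofPred_eq, Set.mem_union]
    rw [le_iff_lt_or_eq, eq_comm, or_comm]
  · refine Set.disjoint_left.mpr fun ω h1 h2 => ?_
    simp only [Set.mem_ofPred_eq] at h1 h2
    exact absurd h1 h2.ne'


include hτ in
/-- The expected reward, decomposed according to the grid point at which one stops. -/
theorem integral_reward {r : ℝ} {n : ℕ} (hK : 0 < K) (k : ℕ) (x : ℝ) :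
    ∫ ω, gridDiscount r n N ω (min (τ ω) (jumpTime N k ω)) *
        putPayoff K (x + X (min (τ ω) (jumpTime N k ω)) ω) ∂P =
      ∑ l ∈ Finset.range k, ∫ ω in {ω | τ ω = jumpTime N l ω},
        Real.exp (-r / n) ^ l * putPayoff K (x + X (jumpTime N l ω) ω) ∂P +
      ∫ ω in {ω | jumpTime N k ω ≤ τ ω},
        Real.exp (-r / n) ^ k * putPayoff K (x + X (jumpTime N k ω) ω) ∂P := by
  have hint := fun j => integrable_comp_jumpTime (P := P) hX hN hrate (measurable_putPayoff K)
    (abs_putPayoff_le hK) x (Real.exp (-r / n) ^ j) j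
  have hle := measurableSet_jumpTime_le_gridStopping hX hN hrate hτ
  have heq := measurableSet_gridStopping_eq hX hN hrate hτ
  simp_rw [← integral_indicator (heq _)]
  rw [← integral_indicator (hle _), ← integral_finsetSum _ fun l _ => (hint l).indicator (heq l),
    ← integral_add (integrable_finsetSum _ fun l _ => (hint l).indicator (heq l))
      ((hint k).indicator (hle k))]
  refine integral_congr_ae ?_
  filter_upwards [hN.ae_apply_jumpTime hrate] with ω hω
  have hs := jumpTime_strictMono hN hω.1 hω.2
  have hinj : ∀ a b, jumpTime N a ω = jumpTime N b ω ↔ a = b := fun a b => hs.injective.eq_iff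
  have hlele : ∀ a b, jumpTime N a ω ≤ jumpTime N b ω ↔ a ≤ b := fun a b => hs.le_iff_le
  obtain ⟨i, hi⟩ := hτ.2 ω
  simp only [Set.indicator, Set.mem_ofPred_eq, hi, hinj, hlele]
  rcases lt_or_ge i k with h | h
  · rw [min_eq_left ((hlele i k).mpr h.le), gridDiscount_jumpTime hs,
      Finset.sum_ite_eq, if_pos (Finset.mem_range.mpr h), if_neg (not_le.mpr h), add_zero]
  · rw [min_eq_right ((hlele k i).mpr h), gridDiscount_jumpTime hs, Finset.sum_ite_eq,
      if_neg (by simpa using h), if_pos h, zero_add]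

/-- The reward collected before the `i`-th grid point together with the value of continuing. -/
noncomputable def partialReward (P : Measure Ω) (X : ℝ≥0 → Ω → ℝ) (N : ℝ≥0 → Ω → ℕ) (rate : ℝ≥0)
    (d K : ℝ) (τ : Ω → ℝ≥0) (x : ℝ) (k i : ℕ) : ℝ :=
  ∑ l ∈ Finset.range i, ∫ ω in {ω | τ ω = jumpTime N l ω},
      d ^ l * putPayoff K (x + X (jumpTime N l ω) ω) ∂P +
    ∫ ω in {ω | jumpTime N i ω ≤ τ ω},
      d ^ i * valueSeq (lawAtExpTime rate X P) d K (k - i) (x + X (jumpTime N i ω) ω) ∂P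

omit hN hrate in
theorem partialReward_zero (k : ℕ) (x : ℝ) : partialReward P X N rate d K τ x k 0 =
    valueSeq (lawAtExpTime rate X P) d K k x := by
  have h : {ω | jumpTime N 0 ω ≤ τ ω} = Set.univ := by
    ext ω; simp [jumpTime_zero]
  have h2 : (fun ω => valueSeq (lawAtExpTime rate X P) d K k (x + X (jumpTime N 0 ω) ω)) =ᵐ[P]
      fun _ => valueSeq (lawAtExpTime rate X P) d K k x := by
    filter_upwards [hX.zero] with ω hω
    rw [jumpTime_zero, hω, add_zero]
  simp only [partialReward, Finset.range_zero, Finset.sum_empty, pow_zero, one_mul, Nat.sub_zero,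
    zero_add, h, Measure.restrict_univ]
  rw [integral_congr_ae h2, integral_const, probReal_univ, one_smul]

-- The drop between consecutive partial rewards is what is lost by stopping at point `i` when it is
-- suboptimal, plus what is lost by continuing there when that is suboptimal. For `i < k` both
-- losses are nonnegative, giving the upper bound; both vanish for a rule that always decides
-- optimally.
include hτ in
theorem partialReward_succ_sub
    (hXN : IndepFun (fun ω t => X t ω) (fun ω t => N t ω) P) (hd0 : 0 < d) (hd1 : d < 1)
    (hK : 0 < K) (x : ℝ) (k i : ℕ) :
    partialReward P X N rate d K τ x k i - partialReward P X N rate d K τ x k (i + 1) =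
      ∫ ω in {ω | τ ω = jumpTime N i ω}, d ^ i *
        (valueSeq (lawAtExpTime rate X P) d K (k - i) (x + X (jumpTime N i ω) ω) -
          putPayoff K (x + X (jumpTime N i ω) ω)) ∂P +
      ∫ ω in {ω | jumpTime N i ω < τ ω}, d ^ i *
        (valueSeq (lawAtExpTime rate X P) d K (k - i) (x + X (jumpTime N i ω) ω) -
          d * ∫ y, valueSeq (lawAtExpTime rate X P) d K (k - (i + 1))
            (x + X (jumpTime N i ω) ω + y) ∂(lawAtExpTime rate X P)) ∂P := by
  have := isProbabilityMeasure_lawAtExpTime (P := P) hX hrate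
  set ν := lawAtExpTime rate X P with hν
  have hW := integrable_comp_jumpTime (P := P) hX hN hrate (measurable_valueSeq ν d K (k - i))
    (abs_valueSeq_le hd0 hd1 hK (k - i)) x (d ^ i) i
  have hf := integrable_comp_jumpTime (P := P) hX hN hrate (measurable_putPayoff K)
    (abs_putPayoff_le hK) x (d ^ i) i
  have hI := integrable_comp_jumpTime (P := P) hX hN hrate
    (measurable_integral_add (ν := ν) (measurable_valueSeq ν d K (k - (i + 1)))) (C := K)
    (fun z => by
      rw [abs_of_nonneg (integral_nonneg fun y => valueSeq_nonneg _ _)]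
      exact integral_valueSeq_le hd0 hd1 hK _ _) x (d ^ (i + 1)) i
  have hstep := setIntegral_valueSeq_succ hX hN hrate hτ hXN hd0 hd1 hK x (k - (i + 1)) i
  simp only [partialReward, Finset.sum_range_succ]
  rw [integral_const_mul (d ^ (i + 1)), hstep, ← integral_const_mul,
    setIntegral_jumpTime_le_eq_add hX hN hrate hτ hW i]
  have e1 : ∀ ω, d ^ i * (valueSeq ν d K (k - i) (x + X (jumpTime N i ω) ω) -
      putPayoff K (x + X (jumpTime N i ω) ω)) =
      d ^ i * valueSeq ν d K (k - i) (x + X (jumpTime N i ω) ω) -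
      d ^ i * putPayoff K (x + X (jumpTime N i ω) ω) := fun ω => by ring
  have e2 : ∀ ω, d ^ i * (valueSeq ν d K (k - i) (x + X (jumpTime N i ω) ω) -
      d * ∫ y, valueSeq ν d K (k - (i + 1)) (x + X (jumpTime N i ω) ω + y) ∂ν) =
      d ^ i * valueSeq ν d K (k - i) (x + X (jumpTime N i ω) ω) -
      d ^ (i + 1) * ∫ y, valueSeq ν d K (k - (i + 1)) (x + X (jumpTime N i ω) ω + y) ∂ν :=
    fun ω => by ring
  simp_rw [e1, e2]
  rw [integral_sub hW.integrableOn hf.integrableOn, integral_sub hW.integrableOn hI.integrableOn]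
  ring

include hτ in
theorem integral_reward_eq_partialReward {r : ℝ} {n : ℕ} (hK : 0 < K) (k : ℕ) (x : ℝ) :
    ∫ ω, gridDiscount r n N ω (min (τ ω) (jumpTime N k ω)) *
        putPayoff K (x + X (min (τ ω) (jumpTime N k ω)) ω) ∂P =
      partialReward P X N rate (Real.exp (-r / n)) K τ x k k := by
  rw [integral_reward hX hN hrate hτ hK, partialReward, Nat.sub_self]
  rfl

include hτ in
/-- No grid-valued stopping time does better than the value function. -/
theorem partialReward_le
    (hXN : IndepFun (fun ω t => X t ω) (fun ω t => N t ω) P) (hd0 : 0 < d) (hd1 : d < 1)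
    (hK : 0 < K) (x : ℝ) (k : ℕ) {i : ℕ} (hi : i ≤ k) :
    partialReward P X N rate d K τ x k i ≤ valueSeq (lawAtExpTime rate X P) d K k x := by
  induction i with
  | zero => exact (partialReward_zero hX k x).le
  | succ i ih =>
    refine le_trans ?_ (ih (by omega))
    rw [← sub_nonneg, partialReward_succ_sub hX hN hrate hτ hXN hd0 hd1 hK x]
    refine add_nonneg (integral_nonneg fun ω => mul_nonneg (by positivity)
      (sub_nonneg.mpr (putPayoff_le_valueSeq _ _))) (integral_nonneg fun ω =>
      mul_nonneg (by positivity) (sub_nonneg.mpr ?_))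
    rw [show k - i = k - (i + 1) + 1 by omega]
    exact le_max_right _ _

include hτ in
/-- A stopping time that stops as soon as stopping is optimal attains the value function. -/
theorem partialReward_eq
    (hXN : IndepFun (fun ω t => X t ω) (fun ω t => N t ω) P) (hd0 : 0 < d) (hd1 : d < 1)
    (hK : 0 < K) (x : ℝ) (k : ℕ)
    (hst : ∀ᵐ ω ∂P, ∀ i < k, τ ω = jumpTime N i ω →
      valueSeq (lawAtExpTime rate X P) d K (k - i) (x + X (jumpTime N i ω) ω) ≤
        putPayoff K (x + X (jumpTime N i ω) ω))
    (hct : ∀ᵐ ω ∂P, ∀ i < k, jumpTime N i ω < τ ω →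
      putPayoff K (x + X (jumpTime N i ω) ω) <
        valueSeq (lawAtExpTime rate X P) d K (k - i) (x + X (jumpTime N i ω) ω))
    {i : ℕ} (hi : i ≤ k) :
    partialReward P X N rate d K τ x k i = valueSeq (lawAtExpTime rate X P) d K k x := by
  induction i with
  | zero => exact partialReward_zero hX k x
  | succ i ih =>
    rw [← ih (by omega), eq_comm, ← sub_eq_zero,
      partialReward_succ_sub hX hN hrate hτ hXN hd0 hd1 hK x]
    rw [setIntegral_congr_ae (g := fun _ => (0 : ℝ))
        (measurableSet_gridStopping_eq hX hN hrate hτ i),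
      setIntegral_congr_ae (g := fun _ => (0 : ℝ))
        (measurableSet_jumpTime_lt_gridStopping' hX hN hrate hτ i)]
    · simp
    · filter_upwards [hct] with ω hω hlt
      have h := hω i (by omega) hlt
      rw [show k - i = k - (i + 1) + 1 by omega] at h ⊢
      -- Strictly exceeding the payoff forces the maximum to be the continuation branch.
      have h2 := (lt_max_iff.mp h).resolve_left (lt_irrefl _)
      have h3 : valueSeq (lawAtExpTime rate X P) d K (k - (i + 1) + 1)
          (x + X (jumpTime N i ω) ω) = d * ∫ y, valueSeq (lawAtExpTime rate X P) d K (k - (i + 1))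
            (x + X (jumpTime N i ω) ω + y) ∂(lawAtExpTime rate X P) := max_eq_right h2.le
      rw [h3, sub_self, mul_zero]
    · filter_upwards [hst] with ω hω heq
      rw [le_antisymm (hω i (by omega) heq) (putPayoff_le_valueSeq _ _), sub_self, mul_zero]

end Bellman

/-! ### The optimal stopping time and the value function -/

section OptimalStopping

variable {Ω : Type*} [m : MeasurableSpace Ω] {P : Measure Ω}
  {X : ℝ≥0 → Ω → ℝ} {N : ℝ≥0 → Ω → ℕ} {rate : ℝ≥0}

/-- The past of an earlier jump time is contained in the past of a later one. -/
theorem measurableSpace_jumpTime_mono (hX : ∀ t, Measurable (X t)) (hN : IsPoissonProcess rate N P)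
    (hrate : 0 < rate) {i j : ℕ} (hij : i ≤ j) :
    (isStoppingTime_jumpTime (P := P) hX hN hrate i).measurableSpace ≤
      (isStoppingTime_jumpTime (P := P) hX hN hrate j).measurableSpace := by
  intro A hA
  refine ⟨hA.1, fun t => ?_⟩
  have hA' : MeasurableSet A := IsStoppingTime.measurableSpace_le _ A hA
  have hm := fun j => measurable_jumpTime hX hN hrate j
  -- Jump times are ordered only almost surely, because a level never reached has jump time `0`. The
  -- second set of the union collects the exceptional paths and is null.
  have : A ∩ {ω | (jumpTime N j ω : WithTop ℝ≥0) ≤ t} =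
      A ∩ {ω | (jumpTime N i ω : WithTop ℝ≥0) ≤ t} ∩
        {ω | (jumpTime N j ω : WithTop ℝ≥0) ≤ t} ∪
      A ∩ {ω | jumpTime N j ω ≤ t} ∩ {ω | t < jumpTime N i ω} := by
    ext ω
    simp only [Set.mem_inter_iff, Set.mem_ofPred_eq, Set.mem_union, WithTop.coe_le_coe]
    rw [← not_le]
    tauto
  rw [this]
  refine ((hA.2 t).inter (isStoppingTime_jumpTime hX hN hrate j t)).union ?_
  refine measurableSet_stopping_of_null hX hN.measurable ((hA'.inter
    (hm j measurableSet_Iic)).inter (hm i measurableSet_Ioi)) ?_ t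
  refine measure_mono_null ?_ (ae_iff.mp (hN.ae_exists_le hrate))
  rintro ω ⟨⟨_, h1⟩, h2⟩ hω
  have h3 := jumpTime_mono hN hω hij
  simp only at h1 h2 h3
  exact absurd (h3.trans h1) (not_le.mpr h2)

/-- The index of the first grid point, among the first `k`, at which the process belongs to the
stopping region. -/
noncomputable def stopIndex (X : ℝ≥0 → Ω → ℝ) (N : ℝ≥0 → Ω → ℕ) (S : ℕ → Set ℝ) (k : ℕ) (ω : Ω) :
    ℕ :=
  sInf {i | k ≤ i ∨ X (jumpTime N i ω) ω ∈ S i}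

omit m in
theorem stopIndex_mem (S : ℕ → Set ℝ) (k : ℕ) (ω : Ω) :
    k ≤ stopIndex X N S k ω ∨
      X (jumpTime N (stopIndex X N S k ω) ω) ω ∈ S (stopIndex X N S k ω) :=
  Nat.sInf_mem (s := {i | k ≤ i ∨ X (jumpTime N i ω) ω ∈ S i}) ⟨k, Or.inl le_rfl⟩

omit m in
theorem notMem_of_lt_stopIndex {S : ℕ → Set ℝ} {k i : ℕ} {ω : Ω} (h : i < stopIndex X N S k ω) :
    X (jumpTime N i ω) ω ∉ S i := fun hi =>
  Nat.notMem_of_lt_sInf h (Or.inr hi)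

/-- Whether the first entrance happens at index `i` depends only on the positions at the grid points
up to `i`, all of which belong to the past of the `i`-th jump time. -/
theorem measurableSet_stopIndex_eq (hX : IsLevyProcess X P) (hN : IsPoissonProcess rate N P)
    (hrate : 0 < rate) {S : ℕ → Set ℝ} (hS : ∀ i, MeasurableSet (S i)) (k i : ℕ) :
    MeasurableSet[(isStoppingTime_jumpTime (P := P) hX.measurable hN hrate i).measurableSpace]
      {ω | stopIndex X N S k ω = i} := by
  have hQ : ∀ l ≤ i, MeasurableSet[(isStoppingTime_jumpTime (P := P) hX.measurable hN hrate
      i).measurableSpace] {ω | k ≤ l ∨ X (jumpTime N l ω) ω ∈ S l} := fun l hl => by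
    refine measurableSpace_jumpTime_mono hX.measurable hN hrate hl _ ?_
    rw [Set.ofPred_or]
    exact MeasurableSet.union (MeasurableSet.const _)
      (measurable_apply_stopping hX hN.measurable (isStoppingTime_jumpTime hX.measurable hN hrate l)
        (hS l))
  have : {ω | stopIndex X N S k ω = i} = {ω | k ≤ i ∨ X (jumpTime N i ω) ω ∈ S i} ∩
      ⋂ l : ℕ, ⋂ _ : l < i, {ω | k ≤ l ∨ X (jumpTime N l ω) ω ∈ S l}ᶜ := by
    ext ω
    simp only [Set.mem_inter_iff, Set.mem_iInter, Set.mem_ofPred_eq, Set.mem_compl_iff]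
    constructor
    · rintro rfl
      exact ⟨stopIndex_mem S k ω, fun l hl => Nat.notMem_of_lt_sInf hl⟩
    · rintro ⟨h1, h2⟩
      refine le_antisymm (Nat.sInf_le h1) ?_
      by_contra hcon
      exact h2 _ (not_le.mp hcon) (stopIndex_mem S k ω)
  rw [this]
  exact (hQ i le_rfl).inter (MeasurableSet.iInter fun l => MeasurableSet.iInter fun hl =>
    (hQ l hl.le).compl)

theorem stopIndex_mem_gridStoppingTimes (hX : IsLevyProcess X P) (hN : IsPoissonProcess rate N P)
    (hrate : 0 < rate) {S : ℕ → Set ℝ} (hS : ∀ i, MeasurableSet (S i)) (k : ℕ) :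
    (fun ω => jumpTime N (stopIndex X N S k ω) ω) ∈
      gridStoppingTimes P hX.measurable hN.measurable := by
  refine ⟨fun t => ?_, fun ω => ⟨_, rfl⟩⟩
  have : {ω | (jumpTime N (stopIndex X N S k ω) ω : WithTop ℝ≥0) ≤ t} =
      ⋃ i : ℕ, {ω | stopIndex X N S k ω = i} ∩ {ω | (jumpTime N i ω : WithTop ℝ≥0) ≤ t} := by
    ext ω
    simp only [Set.mem_ofPred_eq, Set.mem_iUnion, Set.mem_inter_iff]
    exact ⟨fun h => ⟨_, rfl, h⟩, fun ⟨i, hi, h⟩ => hi ▸ h⟩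
  rw [this]
  exact MeasurableSet.iUnion fun i => (measurableSet_stopIndex_eq hX hN hrate hS k i).2 t

/-- The value of the stopping problem is given by the one-step optimality recursion. -/
theorem gridValue_eq_valueSeq [IsProbabilityMeasure P] (hX : IsLevyProcess X P) {n : ℕ}
    (hn : 1 ≤ n) (hN : IsPoissonProcess (n : ℝ≥0) N P)
    (hXN : IndepFun (fun ω t => X t ω) (fun ω t => N t ω) P) {r K : ℝ} (hr : 0 < r) (hK : 0 < K)
    (k : ℕ) (x : ℝ) :
    gridValue P r n (putPayoff K) hX.measurable hN.measurable k x =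
      valueSeq (lawAtExpTime n X P) (Real.exp (-r / n)) K k x := by
  have hrate : (0 : ℝ≥0) < n := by exact_mod_cast hn
  have hn0 : (0 : ℝ) < n := by exact_mod_cast hn
  have hd0 : 0 < Real.exp (-r / n) := Real.exp_pos _
  have hd1 : Real.exp (-r / n) < 1 := Real.exp_lt_one_iff.mpr (div_neg_of_neg_of_pos (by linarith) hn0)
  have hnu : lawAtExpTime (n : ℝ) X P = lawAtExpTime ((n : ℝ≥0) : ℝ) X P := by
    rw [NNReal.coe_natCast]
  have hprob := isProbabilityMeasure_lawAtExpTime (P := P) hX hrate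
  set d := Real.exp (-r / n) with hd
  rw [hnu]
  set ν := lawAtExpTime ((n : ℝ≥0) : ℝ) X P with hν
  -- Stop as soon as immediate exercise is worth the value with the `k - i` remaining steps.
  set S : ℕ → Set ℝ := fun i => {z | valueSeq ν d K (k - i) (x + z) ≤ putPayoff K (x + z)} with hS
  have hSm : ∀ i, MeasurableSet (S i) := fun i =>
    measurableSet_le ((measurable_valueSeq ν d K _).comp (measurable_const_add x))
      ((measurable_putPayoff K).comp (measurable_const_add x))
  have hle : ∀ τ : gridStoppingTimes P hX.measurable hN.measurable,
      ∫ ω, gridDiscount r n N ω (min (τ.1 ω) (jumpTime N k ω)) *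
        putPayoff K (x + X (min (τ.1 ω) (jumpTime N k ω)) ω) ∂P ≤ valueSeq ν d K k x := fun τ => by
    rw [integral_reward_eq_partialReward hX hN hrate τ.2 hK]
    exact partialReward_le hX hN hrate τ.2 hXN hd0 hd1 hK x k le_rfl
  have hopt := stopIndex_mem_gridStoppingTimes hX hN hrate hSm k
  have hgood := hN.ae_apply_jumpTime hrate
  have heq : ∫ ω, gridDiscount r n N ω (min (jumpTime N (stopIndex X N S k ω) ω) (jumpTime N k ω)) *
      putPayoff K (x + X (min (jumpTime N (stopIndex X N S k ω) ω) (jumpTime N k ω)) ω) ∂P =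
      valueSeq ν d K k x := by
    rw [integral_reward_eq_partialReward hX hN hrate hopt hK]
    refine partialReward_eq hX hN hrate hopt hXN hd0 hd1 hK x k ?_ ?_ le_rfl
    · filter_upwards [hgood] with ω hω i hi h
      have hidx := (jumpTime_strictMono hN hω.1 hω.2).injective h
      have := (stopIndex_mem S k ω).resolve_left (by rw [hidx]; omega)
      rwa [hidx] at this
    · filter_upwards [hgood] with ω hω i _ h
      exact not_le.mp (notMem_of_lt_stopIndex
        ((jumpTime_strictMono hN hω.1 hω.2).lt_iff_lt.mp h))
  -- A real supremum requires a nonempty family that is bounded above; the optimal time supplies the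
  -- former and `hle` the latter.
  have : Nonempty (gridStoppingTimes P hX.measurable hN.measurable) := ⟨⟨_, hopt⟩⟩
  refine le_antisymm (ciSup_le hle) ?_
  rw [← heq]
  exact le_ciSup (f := fun τ : gridStoppingTimes P hX.measurable hN.measurable =>
    ∫ ω, gridDiscount r n N ω (min (τ.1 ω) (jumpTime N k ω)) *
      putPayoff K (x + X (min (τ.1 ω) (jumpTime N k ω)) ω) ∂P)
    ⟨_, Set.forall_mem_range.mpr hle⟩ ⟨_, hopt⟩

end OptimalStopping

/-! ### The main theorem -/

theorem proposition4p4 {Ω : Type*} [MeasurableSpace Ω] (P : Measure Ω) [IsProbabilityMeasure P]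
    (X : ℝ≥0 → Ω → ℝ) (hX : IsLevyProcess X P) (hCP : ¬ IsCompoundPoisson X P)
    (n : ℕ) (hn : 1 ≤ n)
    (N : ℝ≥0 → Ω → ℕ) (hN : IsPoissonProcess (n : ℝ≥0) N P)
    (hXN : IndepFun (fun ω t => X t ω) (fun ω t => N t ω) P)
    (r K : ℝ) (hr : 0 < r) (hK : 0 < K)
    (μ : ExpMixture) (hμ : lawAtExpTime (n : ℝ) X P = μ.law)
    (hone : ∀ j, μ.zm j ≠ -1)
    (hp : NonClustering μ.cp μ.zp) (hm : NonClustering μ.cm μ.zm) :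
    ∃ a : PutCoeffs μ,
      a.xb 0 = Real.log K ∧ StrictAnti a.xb ∧
      -- the coefficients are given by the recursive formulae, all of whose series converge
      μ.UpsilonSummable ∧
      (∀ k, 1 ≤ k → a.Recursion (Real.exp (-r / n)) K k ∧
        (∀ j, a.FSummable (μ.zp j) k) ∧ (∀ j, a.FSummable (μ.zm j) k)) ∧
      -- the points `a.xb k` are the optimal exercise boundaries
      (∀ k, 1 ≤ k → ∀ z < a.xb (k - 1),
        (Real.exp (-r / n) * ∫ y, gridValue P r n (putPayoff K) hX.measurable hN.measurable (k - 1)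
            (z + y) ∂(lawAtExpTime (n : ℝ) X P) - putPayoff K z = 0 ↔ z = a.xb k)) ∧
      -- the piecewise formula
      (∀ k, a.FormulaSummable k ∧ ∀ x,
        gridValue P r n (putPayoff K) hX.measurable hN.measurable k x = a.formula K k x) := by
  have hn0 : (0 : ℝ) < n := by exact_mod_cast hn
  have hd0 : 0 < Real.exp (-r / n) := Real.exp_pos _
  have hd1 : Real.exp (-r / n) < 1 := Real.exp_lt_one_iff.mpr (div_neg_of_neg_of_pos (by linarith) hn0)
  have hprob := ExpMixture.isProbabilityMeasure_law hone hp hm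
  obtain ⟨xb, h0, hU, hroot⟩ := exists_isValueSeq (ν := μ.law) hd0 hd1 hK
    (ExpMixture.absolutelyContinuous_law hone hp hm) (μ.toFamily hone hp hm)
    (ExpMixture.integral_law hone hp hm)
  have hV : ∀ k x, gridValue P r n (putPayoff K) hX.measurable hN.measurable k x =
      valueSeq μ.law (Real.exp (-r / n)) K k x := fun k x => by
    rw [gridValue_eq_valueSeq hX hn hN hXN hr hK, hμ]
  refine ⟨ExpMixture.putCoeffs hone hp hm xb (Real.exp (-r / n)) K, h0, hU.strictAnti,
    ExpMixture.upsilonSummable hone hp hm, fun k hk => ?_, fun k hk z hz => ?_, fun k => ⟨?_, ?_⟩⟩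
  · obtain ⟨k, rfl⟩ := Nat.exists_eq_add_of_le' hk
    exact ⟨ExpMixture.recursion_putCoeffs hone hp hm hU k,
      fun j => ExpMixture.fSummable_putCoeffs hone hp hm hU k (Sum.inl j),
      fun j => ExpMixture.fSummable_putCoeffs hone hp hm hU k (Sum.inr j)⟩
  · obtain ⟨k, rfl⟩ := Nat.exists_eq_add_of_le' hk
    simp only [hV, hμ]
    exact hroot k z hz
  · exact ExpMixture.formulaSummable_putCoeffs hone hp hm hU k
  · intro x
    rw [hV]
    exact ExpMixture.eq_formula_putCoeffs hone hp hm hU k x
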